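/- For real $w$ let $W=W(w)=8\prod_{2<\ell\le w,\ \ell\text{ prime}}\ell$; for an integer $b$ with $1\le b\le W$ and $(b,W)=1$ let $\sigma(b)=\#\{x\in\{1,\dots,W\}: x^2\equiv b \pmod W\}$. For $0<\delta<1/8$ and a positive integer $N$ put $z=N^{1/4-2\delta}$, and for integers $n$ define $$a(n)=\begin{cases}\dfrac{2\varphi(W)\sqrt{Wn+b}\,\log z}{W\sigma(b)}, & \text{if } 1\le n\le N \text{ and } Wn+b=x^2 \text{ for some prime } x \text{ with } z\le x\le\sqrt{WN+b},\\[2mm] 0,&\text{otherwise}\end{cases}$$ (so $a$ is identically $0$ if $b$ is not a square modulo $W$). Let $\hat a(\theta)=\sum_{n\in\mathbb Z}a(n)e^{2\pi i n\theta}$. Then there is a threshold $N_0(w,\delta)$, depending only on $w$ and $\delta$, such that for every real $p>4$ there is a constant $C_p$, depending only on $p$, with the following property: for all real $w$, all $0<\delta<1/8$, all integers $1\le b\le W$ with $(b,W)=1$ and all integers $N\ge N_0(w,\delta)$, $$\int_0^1|\hat a(\theta)|^p\,d\theta\le C_p\,N^{p-1}.$$ -/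

import Mathlib

namespace WPrimeSquares

noncomputable section

/-- `e(t) = exp(2πit)`. -/
def e (t : ℝ) : ℂ := Complex.exp (2 * Real.pi * Complex.I * (t : ℂ))

/-- The Fourier transform `f̂(θ) = ∑_{n ∈ ℤ} f(n) e(nθ)` of a finitely supported `f : ℤ → ℝ`. -/
def fourierTransform (f : ℤ → ℝ) (θ : ℝ) : ℂ := ∑ᶠ n : ℤ, (f n : ℂ) * e ((n : ℝ) * θ)

/-- `W = 8 ∏_{2 < p ≤ w} p`, the product being over primes. -/
def modulus (w : ℝ) : ℕ := 8 * ∏ p ∈ (Finset.Icc 3 ⌊w⌋₊).filter Nat.Prime, p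

/-- `σ(b)`, the number of `x ∈ {1, …, W}` with `x² ≡ b (mod W)`. -/
def sigma (W b : ℕ) : ℕ := ((Finset.Icc 1 W).filter fun x => x ^ 2 ≡ b [MOD W]).card

/-- The sieve parameter `z = N ^ (1/4 - 2δ)`. -/
def sieveLevel (δ : ℝ) (N : ℕ) : ℝ := (N : ℝ) ^ (1 / 4 - 2 * δ)

/-- `W n + b` is the square of a prime `x` with `z ≤ x ≤ √(W N + b)`. -/
def IsPrimeSquarePoint (W b N : ℕ) (z : ℝ) (n : ℤ) : Prop :=
  ∃ x : ℕ, x.Prime ∧ (W : ℤ) * n + (b : ℤ) = (x : ℤ) ^ 2 ∧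
    z ≤ (x : ℝ) ∧ (x : ℝ) ≤ √((W : ℝ) * N + b)

open Classical in
/-- The weighted function `a` of the `W`-tricked prime squares on `[1, N]`, extended by `0`
to all of `ℤ`. -/
def a (w δ : ℝ) (b N : ℕ) (n : ℤ) : ℝ :=
  if (1 ≤ n ∧ n ≤ (N : ℤ)) ∧ IsPrimeSquarePoint (modulus w) b N (sieveLevel δ N) n then
    2 * (Nat.totient (modulus w) : ℝ) * √((modulus w : ℝ) * n + b) * Real.log (sieveLevel δ N) /
      ((modulus w : ℝ) * (sigma (modulus w) b : ℝ))
  else 0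

/-- Since `a` vanishes off `[1, N]`, its Fourier transform is a sum over `1 ≤ n ≤ N`. -/
theorem fourierTransform_a (w δ : ℝ) (b N : ℕ) (θ : ℝ) :
    fourierTransform (a w δ b N) θ =
      ∑ n ∈ Finset.Icc (1 : ℤ) N, (a w δ b N n : ℂ) * e ((n : ℝ) * θ) := by
  unfold fourierTransform
  refine finsum_eq_sum_of_support_subset _ fun n hn => ?_
  by_contra h
  have h' : ¬(1 ≤ n ∧ n ≤ (N : ℤ)) := by simpa using h
  have h0 : a w δ b N n = 0 := if_neg fun hc => h' hc.1
  exact hn (by simp [h0])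

end

end WPrimeSquares

open Finset MeasureTheory

namespace WPrimeSquares

/-! ### The additive character -/

/-! The method is Bourgain's restriction argument run on level sets. Put `f θ = ‖â(θ)‖ / N`, where â
is the Fourier transform of `a`. The heart of the proof is a weak-type bound: for small `ε > 0` and
`N ^ (-1/800) ≤ α ≤ α₁`, the set `E` where `f ≥ α` has measure `≪ α ^ (-(4 + 11ε)) / N`
(`exists_measure_level_le`). Integrating it against `t ^ (p - 1)` converges since `p > 4`. Below the
threshold the fourth moment `≪ N ^ (3 + η)` is enough (`exists_fourth_moment_le`): it misses the
truth by `N ^ η`, which the factor `N ^ (-(p - 4)/800)` gained from `f` being small pays for.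

For the weak-type bound, `0 ≤ a ≤ ν` with `ν` a Selberg sieve majorant. By duality and
Cauchy-Schwarz, `α² N² |E|²` is at most `∑ ν` times the average of the transform of `ν` over
differences of points of `E` (`sq_le_sum_mul_integral`). That transform is `≪ N q ^ (-1/2 + ε) / (1
+ N‖θ - a/q‖)` up to a power saving (`exists_norm_sum_majorantWeight_le`). By AM-GM the bound may be
squared at the price of `α ^ (-2)`; its square is dominated by Fejér kernels centred at fractions
with denominator at most `α ^ (-5)`. Averaging these kernels over `E × E` leaves the Fourier
coefficients of the indicator of `E` weighted by the number of small divisors of the frequency. Such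
counts are rarely large, so Bessel's inequality gives almost the whole bound. The decay `q ^ (-1/2)`
of quadratic Gauss sums, squared to `1/q`, is what makes 4 the critical exponent.

The bound for `ν` must be uniform in `W`. On the major arcs the complete sums modulo `qW` vanish
unless `q` is coprime to `W` (`sum_squarePhase_eq_zero`; the factor 8 in `W` and the coprimality of
`b` to `W` are used here). Otherwise they are `σ(b)` times a Gauss sum. Then `σ(b)` cancels against
the normalisation of `a`, and `φ(W) / W` cancels against Selberg's lower bound for `∑ 1/φ(m)`
(`log_le_mul_sieveTotal`). Minor arcs are treated by Weyl differencing. The sieve level is only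
about `N ^ (1/200)`: this costs a constant in the main term and makes every error term negligible
even with crude bounds for the weights.

The threshold `exp W` ensures `W ≤ log N`. Any further threshold depends on `p` alone, and the
trivial bound below it goes into the constant. -/

theorem e_eq (t : ℝ) : e t = Complex.exp (Complex.I * ((2 * Real.pi * t : ℝ) : ℂ)) := by
  unfold e; congr 1; push_cast; ring

theorem e_add (s t : ℝ) : e (s + t) = e s * e t := by
  rw [e, e, e, ← Complex.exp_add]; congr 1; push_cast; ring

theorem e_zero : e 0 = 1 := by simp [e]

theorem norm_e (t : ℝ) : ‖e t‖ = 1 := by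
  rw [e_eq, mul_comm]; exact Complex.norm_exp_ofReal_mul_I _

theorem e_neg (t : ℝ) : e (-t) = (e t)⁻¹ := by
  rw [e, e, ← Complex.exp_neg]; congr 1; push_cast; ring

theorem conj_e (t : ℝ) : (starRingEnd ℂ) (e t) = e (-t) := by
  rw [e_neg, Complex.inv_def, Complex.normSq_eq_norm_sq, norm_e]; simp

theorem e_int (k : ℤ) : e k = 1 := by
  rw [e, Complex.exp_eq_one_iff]; exact ⟨k, by push_cast; ring⟩

theorem e_add_int (t : ℝ) (k : ℤ) : e (t + k) = e t := by rw [e_add, e_int, mul_one]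

theorem e_half : e (1 / 2) = -1 := by
  rw [e, ← Complex.exp_pi_mul_I]; congr 1; push_cast; ring

theorem continuous_e : Continuous e := by
  unfold e; fun_prop

theorem e_nat_mul (t : ℝ) (n : ℕ) : e (n * t) = e t ^ n := by
  rw [e, e, ← Complex.exp_nat_mul]; congr 1; push_cast; ring

theorem norm_e_sub_one_le (t : ℝ) : ‖e t - 1‖ ≤ 2 * Real.pi * |t| := by
  rw [e_eq]
  refine Real.norm_exp_I_mul_ofReal_sub_one_le.trans (le_of_eq ?_)
  rw [Real.norm_eq_abs, abs_mul, abs_of_pos (by positivity)]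

/-- The distance from `t` to the nearest integer. -/
noncomputable def nnInt (t : ℝ) : ℝ := |t - round t|

theorem nnInt_nonneg (t : ℝ) : 0 ≤ nnInt t := abs_nonneg _

theorem nnInt_le (t : ℝ) (k : ℤ) : nnInt t ≤ |t - k| := round_le t k

theorem e_sub_round (t : ℝ) : e (t - round t) = e t := by
  have := e_add_int (t - round t) (round t)
  rw [← this]; simp

/-- Jordan's inequality `sin x ≥ 2x/π` on `[0, π/2]`, applied to `‖e u - 1‖ = 2 |sin (πu)|` after
reducing `t` to `u` with `|u| ≤ 1/2`. -/
theorem four_mul_nnInt_le (t : ℝ) : 4 * nnInt t ≤ ‖e t - 1‖ := by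
  rw [← e_sub_round t, e_eq, Complex.norm_exp_I_mul_ofReal_sub_one]
  set u := t - round t with hu
  have h1 : |u| ≤ 1 / 2 := abs_sub_round t
  have h2 : ‖2 * Real.sin (2 * Real.pi * u / 2)‖ = 2 * Real.sin (Real.pi * |u|) := by
    have h3 : 0 ≤ Real.sin (Real.pi * |u|) := by
      apply Real.sin_nonneg_of_nonneg_of_le_pi (by positivity)
      nlinarith [Real.pi_pos]
    have h4 : 2 * Real.pi * u / 2 = Real.pi * u := by ring
    rw [h4, norm_mul, Real.norm_eq_abs, Real.norm_eq_abs, abs_of_pos two_pos]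
    rcases le_total 0 u with h | h
    · rw [abs_of_nonneg h] at h3 ⊢; rw [abs_of_nonneg h3]
    · rw [abs_of_nonpos h] at h3 ⊢
      rw [mul_neg, Real.sin_neg] at h3 ⊢
      rw [abs_of_nonpos (by linarith)]
  rw [h2]
  have h5 := Real.mul_le_sin (x := Real.pi * |u|) (by positivity) (by nlinarith [Real.pi_pos])
  have h6 : 2 / Real.pi * (Real.pi * |u|) = 2 * |u| := by
    field_simp
  change 4 * |u| ≤ _
  linarith

/-- The bound for a geometric sum of characters. -/
theorem norm_sum_e_le (t : ℝ) (ht : 0 < nnInt t) (n : ℕ) :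
    ‖∑ i ∈ range n, e (t * i)‖ ≤ 1 / (2 * nnInt t) := by
  have h1 : (∑ i ∈ range n, e (t * i)) * (e t - 1) = e (t * n) - 1 := by
    have : ∀ i : ℕ, e (t * i) = e t ^ i := fun i => by rw [mul_comm, e_nat_mul]
    simp only [this]
    exact geom_sum_mul _ _
  have h2 : ‖e (t * n) - 1‖ ≤ 2 := by
    refine (norm_sub_le _ _).trans ?_
    rw [norm_e, norm_one]; norm_num
  have h3 := four_mul_nnInt_le t
  rw [← h1, norm_mul] at h2
  rw [le_div_iff₀ (by positivity)]
  nlinarith [norm_nonneg (∑ i ∈ range n, e (t * i))]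

theorem norm_sum_e_le_card (t : ℝ) (n : ℕ) : ‖∑ i ∈ range n, e (t * i)‖ ≤ n := by
  refine (norm_sum_le _ _).trans ?_
  simp [norm_e]

theorem integral_e (k : ℤ) :
    ∫ θ in Set.Icc (0 : ℝ) 1, e (k * θ) = if k = 0 then 1 else 0 := by
  rw [integral_Icc_eq_integral_Ioc, ← intervalIntegral.integral_of_le zero_le_one]
  split_ifs with h
  · simp [h, e_zero]
  · have hc : (2 * Real.pi * Complex.I * k : ℂ) ≠ 0 := by
      have : (Real.pi : ℂ) ≠ 0 := by exact_mod_cast Real.pi_ne_zero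
      have hk : (k : ℂ) ≠ 0 := by exact_mod_cast h
      simp [this, hk, Complex.I_ne_zero]
    have h1 : ∀ θ : ℝ, e (k * θ) = Complex.exp ((2 * Real.pi * Complex.I * k : ℂ) * θ) := by
      intro θ; rw [e]; congr 1; push_cast; ring
    simp only [h1]
    rw [integral_exp_mul_complex hc]
    have h2 := e_int k
    have h3 := h1 1
    rw [mul_one] at h3
    rw [← h3, h2]; simp

theorem norm_sum_sq_eq {ι : Type*} (s : Finset ι) (f : ι → ℂ) :
    ((‖∑ i ∈ s, f i‖ ^ 2 : ℝ) : ℂ) = ∑ i ∈ s, ∑ j ∈ s, f i * (starRingEnd ℂ) (f j) := by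
  rw [← Complex.normSq_eq_norm_sq, Complex.normSq_eq_conj_mul_self, map_sum, mul_comm, sum_mul_sum]

theorem integrable_of_continuous {f : ℝ → ℂ} (hf : Continuous f) {E : Set ℝ}
    (hE : E ⊆ Set.Icc 0 1) : IntegrableOn f E :=
  (hf.continuousOn.integrableOn_compact isCompact_Icc).mono_set hE

theorem integrable_of_continuous_real {f : ℝ → ℝ} (hf : Continuous f) {E : Set ℝ}
    (hE : E ⊆ Set.Icc 0 1) : IntegrableOn f E :=
  (hf.continuousOn.integrableOn_compact isCompact_Icc).mono_set hE

/-- Orthogonality for exponential polynomials. -/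
theorem integral_norm_sq_sum_e {ι : Type*} (s : Finset ι) (b : ι → ℂ) (k : ι → ℤ) :
    ((∫ θ in Set.Icc (0 : ℝ) 1, ‖∑ i ∈ s, b i * e (k i * θ)‖ ^ 2 : ℝ) : ℂ) =
      ∑ i ∈ s, ∑ j ∈ s, if k i = k j then b i * (starRingEnd ℂ) (b j) else 0 := by
  rw [← integral_complex_ofReal]
  simp only [norm_sum_sq_eq, map_mul, conj_e]
  have h0 : ∀ i j (θ : ℝ), b i * e (k i * θ) * ((starRingEnd ℂ) (b j) * e (-(k j * θ))) =
      b i * (starRingEnd ℂ) (b j) * e (((k i - k j : ℤ) : ℝ) * θ) := by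
    intro i j θ
    have : (((k i - k j : ℤ) : ℝ) * θ) = k i * θ + -(k j * θ) := by push_cast; ring
    rw [this, e_add]; ring
  simp only [h0]
  have hc : ∀ i j, Continuous fun θ : ℝ =>
      b i * (starRingEnd ℂ) (b j) * e (((k i - k j : ℤ) : ℝ) * θ) := fun i j =>
    continuous_const.mul (continuous_e.comp (by fun_prop))
  rw [integral_finsetSum]
  · refine sum_congr rfl fun i _ => ?_
    rw [integral_finsetSum]
    · refine sum_congr rfl fun j _ => ?_
      rw [integral_const_mul, integral_e]
      simp [sub_eq_zero]
    · exact fun j _ => integrable_of_continuous (hc i j) subset_rfl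
  · exact fun i _ => integrable_finsetSum _ fun j _ =>
      integrable_of_continuous (hc i j) subset_rfl

/-! ### Duality and kernels -/

theorem integrable_prod_of_continuous {f : ℝ × ℝ → ℂ} (hf : Continuous f) {E : Set ℝ}
    (hE : E ⊆ Set.Icc 0 1) :
    Integrable f ((volume.restrict E).prod (volume.restrict E)) := by
  rw [Measure.prod_restrict]
  exact (hf.continuousOn.integrableOn_compact (isCompact_Icc.prod isCompact_Icc)).mono_set
    (Set.prod_mono hE hE)

theorem integrable_prod_of_continuous_real {f : ℝ × ℝ → ℝ} (hf : Continuous f) {E : Set ℝ}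
    (hE : E ⊆ Set.Icc 0 1) :
    Integrable f ((volume.restrict E).prod (volume.restrict E)) := by
  rw [Measure.prod_restrict]
  exact (hf.continuousOn.integrableOn_compact (isCompact_Icc.prod isCompact_Icc)).mono_set
    (Set.prod_mono hE hE)

theorem volume_lt_top_of_subset {E : Set ℝ} (hE : E ⊆ Set.Icc 0 1) : volume E < ⊤ :=
  (measure_mono hE).trans_lt (by simp)

theorem isFiniteMeasure_restrict {E : Set ℝ} (hE : E ⊆ Set.Icc 0 1) :
    IsFiniteMeasure (volume.restrict E) :=
  ⟨by rw [Measure.restrict_apply_univ]; exact volume_lt_top_of_subset hE⟩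

/-- The Fourier coefficient of the indicator function of `E`. -/
noncomputable def indCoeff (E : Set ℝ) (k : ℤ) : ℂ := ∫ θ in E, e (k * θ)

theorem norm_indCoeff_le {E : Set ℝ} (hE : E ⊆ Set.Icc 0 1) (k : ℤ) :
    ‖indCoeff E k‖ ≤ volume.real E := by
  have := norm_setIntegral_le_of_norm_le_const (f := fun θ : ℝ => e (k * θ)) (C := 1)
    (volume_lt_top_of_subset hE) (fun θ _ => (norm_e _).le)
  simpa [indCoeff] using this

theorem integral_prod_e {E : Set ℝ} (k : ℤ) :
    ∫ z : ℝ × ℝ, e (k * (z.1 - z.2)) ∂((volume.restrict E).prod (volume.restrict E)) =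
      ((‖indCoeff E k‖ ^ 2 : ℝ) : ℂ) := by
  have h : ∀ z : ℝ × ℝ, e (k * (z.1 - z.2)) = e (k * z.1) * (starRingEnd ℂ) (e (k * z.2)) := by
    intro z; rw [conj_e, ← e_add]; congr 1; ring
  simp only [h]
  rw [integral_prod_mul (f := fun x : ℝ => e (k * x))
    (g := fun x : ℝ => (starRingEnd ℂ) (e (k * x))), integral_conj,
    ← Complex.normSq_eq_norm_sq, Complex.normSq_eq_conj_mul_self, mul_comm]
  rfl

/-- Bessel's inequality for the indicator function of `E`. -/
theorem sum_norm_sq_indCoeff_le {E : Set ℝ} (hE : E ⊆ Set.Icc 0 1) (s : Finset ℤ) :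
    ∑ k ∈ s, ‖indCoeff E k‖ ^ 2 ≤ volume.real E := by
  have hfin := isFiniteMeasure_restrict hE
  set P : ℝ → ℂ := fun θ => ∑ k ∈ s, (starRingEnd ℂ) (indCoeff E k) * e (k * θ) with hP
  have hPc : Continuous P := by
    refine continuous_finsetSum _ fun k _ => continuous_const.mul (continuous_e.comp (by fun_prop))
  have h1 : ∫ θ in E, P θ = ((∑ k ∈ s, ‖indCoeff E k‖ ^ 2 : ℝ) : ℂ) := by
    rw [hP, integral_finsetSum]
    · rw [Complex.ofReal_sum]
      refine sum_congr rfl fun k _ => ?_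
      rw [integral_const_mul, ← Complex.normSq_eq_norm_sq, Complex.normSq_eq_conj_mul_self]
      rfl
    · exact fun k _ => integrable_of_continuous
        (continuous_const.mul (continuous_e.comp (by fun_prop))) hE
  have h2 : ((∫ θ in Set.Icc (0 : ℝ) 1, ‖P θ‖ ^ 2 : ℝ) : ℂ) =
      ((∑ k ∈ s, ‖indCoeff E k‖ ^ 2 : ℝ) : ℂ) := by
    rw [hP, integral_norm_sq_sum_e s _ (fun k => k), Complex.ofReal_sum]
    refine sum_congr rfl fun k hk => ?_
    rw [sum_ite_eq, if_pos hk, ← Complex.normSq_eq_norm_sq, Complex.normSq_eq_conj_mul_self]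
    simp
  have h2' := Complex.ofReal_injective h2
  have h3 : ∫ θ in E, ‖P θ‖ ^ 2 ≤ ∫ θ in Set.Icc (0 : ℝ) 1, ‖P θ‖ ^ 2 :=
    setIntegral_mono_set (integrable_of_continuous_real (by fun_prop) subset_rfl)
      (Filter.Eventually.of_forall fun θ => by positivity) hE.eventuallyLE
  have h4 : ‖∫ θ in E, P θ‖ ≤ ∫ θ in E, ‖P θ‖ := norm_integral_le_integral_norm _
  -- This replaces Cauchy-Schwarz. With `S` the sum to be bounded, `∫_E P = S` and `∫ ‖P‖² = S` over
  -- the whole circle, so `2S ≤ |E| + S`.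
  have h5 : ∫ θ in E, 2 * ‖P θ‖ ≤ ∫ θ in E, (1 + ‖P θ‖ ^ 2) := by
    refine integral_mono (integrable_of_continuous_real (by fun_prop) hE)
      (integrable_of_continuous_real (by fun_prop) hE) fun θ => ?_
    nlinarith [sq_nonneg (‖P θ‖ - 1)]
  rw [integral_const_mul, integral_add (integrable_const _)
    (integrable_of_continuous_real (by fun_prop) hE)] at h5
  have h6 : ∫ _ in E, (1 : ℝ) = volume.real E := by simp
  rw [h6] at h5
  rw [h1, Complex.norm_real, Real.norm_of_nonneg (sum_nonneg fun k _ => by positivity)] at h4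
  linarith

/-- The dual form of the restriction problem for `0 ≤ c ≤ ν`. -/
theorem sq_le_sum_mul_integral {ι : Type*} (s : Finset ι) (k : ι → ℤ) (c ν : ι → ℝ)
    (hc : ∀ i ∈ s, 0 ≤ c i) (hcν : ∀ i ∈ s, c i ≤ ν i) {E : Set ℝ} (hEm : MeasurableSet E)
    (hE : E ⊆ Set.Icc 0 1) {A : ℝ} (hA0 : 0 < A)
    (hA : ∀ θ ∈ E, A ≤ ‖∑ i ∈ s, (c i : ℂ) * e (k i * θ)‖) :
    (A * volume.real E) ^ 2 ≤ (∑ i ∈ s, ν i) *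
      ∫ z : ℝ × ℝ, ‖∑ i ∈ s, (ν i : ℂ) * e (k i * (z.1 - z.2))‖
        ∂((volume.restrict E).prod (volume.restrict E)) := by
  have hfin := isFiniteMeasure_restrict hE
  set S : ℝ → ℂ := fun θ => ∑ i ∈ s, (c i : ℂ) * e (k i * θ) with hS
  have hSc : Continuous S :=
    continuous_finsetSum _ fun i _ => continuous_const.mul (continuous_e.comp (by fun_prop))
  -- The phase that makes `g * S = ‖S‖`, so that the integral of `‖S‖` becomes linear in the
  -- coefficients. Where `S` vanishes, division by zero gives `g = 0`, which does no harm.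
  set g : ℝ → ℂ := fun θ => (starRingEnd ℂ) (S θ) / (‖S θ‖ : ℂ) with hg
  have hgm : Measurable g := by
    have := hSc.measurable
    have h2 : Measurable fun θ => (‖S θ‖ : ℂ) := by fun_prop
    exact ((Complex.continuous_conj.measurable.comp this).div h2)
  have hg1 : ∀ θ, ‖g θ‖ ≤ 1 := by
    intro θ
    simp only [hg, norm_div, RCLike.norm_conj, Complex.norm_real, norm_norm]
    exact div_self_le_one _
  have hgS : ∀ θ, g θ * S θ = (‖S θ‖ : ℂ) := by
    intro θ
    simp only [hg]
    by_cases h : S θ = 0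
    · simp [h]
    · have h' : (‖S θ‖ : ℂ) ≠ 0 := by simpa using h
      rw [div_mul_eq_mul_div, ← Complex.normSq_eq_conj_mul_self, Complex.normSq_eq_norm_sq]
      push_cast
      field_simp
  have hint : ∀ f : ℝ → ℂ, Continuous f → (∀ θ, ‖f θ‖ ≤ 1) →
      Integrable (fun θ => g θ * f θ) (volume.restrict E) := by
    intro f hf hf1
    refine Integrable.of_bound (hgm.aestronglyMeasurable.mul hf.aestronglyMeasurable) 1
      (Filter.Eventually.of_forall fun θ => ?_)
    rw [norm_mul]
    exact mul_le_one₀ (hg1 θ) (norm_nonneg _) (hf1 θ)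
  set G : ι → ℂ := fun i => ∫ θ in E, g θ * e (k i * θ) with hG
  have hec : ∀ i, Continuous fun θ : ℝ => e (k i * θ) := fun i => continuous_e.comp (by fun_prop)
  have h1 : A * volume.real E ≤ ∑ i ∈ s, c i * ‖G i‖ := by
    have h2 : A * volume.real E ≤ ∫ θ in E, ‖S θ‖ := by
      have h6 : ∫ _ in E, A = A * volume.real E := by simp [mul_comm]
      rw [← h6]
      exact setIntegral_mono_on (integrable_const _)
        (integrable_of_continuous_real (by fun_prop) hE) hEm hA
    have h3 : ((∫ θ in E, ‖S θ‖ : ℝ) : ℂ) = ∑ i ∈ s, (c i : ℂ) * G i := by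
      rw [← integral_complex_ofReal]
      have h7 : ∀ θ, ((‖S θ‖ : ℝ) : ℂ) = ∑ i ∈ s, (c i : ℂ) * (g θ * e (k i * θ)) := by
        intro θ
        rw [← hgS]
        change g θ * ∑ i ∈ s, (c i : ℂ) * e (k i * θ) = _
        rw [mul_sum]
        exact sum_congr rfl fun i _ => by ring
      simp only [h7]
      rw [integral_finsetSum]
      · exact sum_congr rfl fun i _ => integral_const_mul _ _
      · exact fun i _ => (hint _ (hec i) (fun θ => (norm_e _).le)).const_mul (c i : ℂ)
    have h4 : ‖((∫ θ in E, ‖S θ‖ : ℝ) : ℂ)‖ ≤ ∑ i ∈ s, c i * ‖G i‖ := by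
      rw [h3]
      refine (norm_sum_le _ _).trans (sum_le_sum fun i hi => ?_)
      rw [norm_mul, Complex.norm_real, Real.norm_of_nonneg (hc i hi)]
    rw [Complex.norm_real] at h4
    exact h2.trans ((le_abs_self _).trans h4)
  -- Cauchy-Schwarz with weight `c`, after which all terms are nonnegative and `c` can be exchanged
  -- for its majorant `ν`; nothing else about `c` is needed.
  have h2 : (∑ i ∈ s, c i * ‖G i‖) ^ 2 ≤ (∑ i ∈ s, ν i) * ∑ i ∈ s, ν i * ‖G i‖ ^ 2 := by
    have h3 : (∑ i ∈ s, c i * ‖G i‖) ^ 2 ≤ (∑ i ∈ s, c i) * ∑ i ∈ s, c i * ‖G i‖ ^ 2 := by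
      refine sum_sq_le_sum_mul_sum_of_sq_le_mul s hc
        (fun i hi => mul_nonneg (hc i hi) (by positivity)) fun i _ => le_of_eq ?_
      ring
    refine h3.trans (mul_le_mul (sum_le_sum hcν) (sum_le_sum fun i hi => ?_)
      (sum_nonneg fun i hi => mul_nonneg (hc i hi) (by positivity))
      (sum_nonneg fun i hi => (hc i hi).trans (hcν i hi)))
    exact mul_le_mul_of_nonneg_right (hcν i hi) (by positivity)
  -- Opening each square as a double integral over `E × E` brings the sum over `i` inside, where it
  -- becomes the transform of `ν` at the difference of the two points.
  have h3 : ((∑ i ∈ s, ν i * ‖G i‖ ^ 2 : ℝ) : ℂ) =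
      ∫ z : ℝ × ℝ, g z.1 * (starRingEnd ℂ) (g z.2) * ∑ i ∈ s, (ν i : ℂ) * e (k i * (z.1 - z.2))
        ∂((volume.restrict E).prod (volume.restrict E)) := by
    have h4 : ∀ z : ℝ × ℝ,
        g z.1 * (starRingEnd ℂ) (g z.2) * ∑ i ∈ s, (ν i : ℂ) * e (k i * (z.1 - z.2)) =
        ∑ i ∈ s, (ν i : ℂ) *
          ((g z.1 * e (k i * z.1)) * (starRingEnd ℂ) (g z.2 * e (k i * z.2))) := by
      intro z
      rw [mul_sum]
      refine sum_congr rfl fun i _ => ?_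
      rw [map_mul, conj_e, show (k i : ℝ) * (z.1 - z.2) = k i * z.1 + -(k i * z.2) by ring, e_add]
      ring
    simp only [h4]
    rw [integral_finsetSum]
    · rw [Complex.ofReal_sum]
      refine sum_congr rfl fun i _ => ?_
      rw [integral_const_mul, integral_prod_mul (f := fun x : ℝ => g x * e (k i * x))
        (g := fun x : ℝ => (starRingEnd ℂ) (g x * e (k i * x))), integral_conj, Complex.ofReal_mul,
        ← Complex.normSq_eq_norm_sq, Complex.normSq_eq_conj_mul_self, mul_comm
          ((starRingEnd ℂ) (G i))]
    · intro i _
      refine Integrable.const_mul ?_ _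
      refine Integrable.mul_prod (f := fun x : ℝ => g x * e (k i * x))
        (g := fun x : ℝ => (starRingEnd ℂ) (g x * e (k i * x)))
        (hint _ (hec i) (fun θ => (norm_e _).le)) ?_
      have := (hint _ (hec i) (fun θ => (norm_e _).le))
      exact (Complex.conjCLE.toContinuousLinearMap.integrable_comp this)
  have h5 : ∑ i ∈ s, ν i * ‖G i‖ ^ 2 ≤
      ∫ z : ℝ × ℝ, ‖∑ i ∈ s, (ν i : ℂ) * e (k i * (z.1 - z.2))‖
        ∂((volume.restrict E).prod (volume.restrict E)) := by
    have hVc : Continuous fun z : ℝ × ℝ => ∑ i ∈ s, (ν i : ℂ) * e (k i * (z.1 - z.2)) :=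
      continuous_finsetSum _ fun i _ => continuous_const.mul (continuous_e.comp (by fun_prop))
    have h6 : ‖((∑ i ∈ s, ν i * ‖G i‖ ^ 2 : ℝ) : ℂ)‖ ≤
        ∫ z : ℝ × ℝ, ‖∑ i ∈ s, (ν i : ℂ) * e (k i * (z.1 - z.2))‖
          ∂((volume.restrict E).prod (volume.restrict E)) := by
      rw [h3]
      refine norm_integral_le_of_norm_le
        (integrable_prod_of_continuous_real (hVc.norm) hE)
        (Filter.Eventually.of_forall fun z => ?_)
      rw [norm_mul, norm_mul, RCLike.norm_conj]
      refine mul_le_of_le_one_left (norm_nonneg _) ?_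
      exact mul_le_one₀ (hg1 _) (norm_nonneg _) (hg1 _)
    rw [Complex.norm_real] at h6
    exact (le_abs_self _).trans h6
  calc (A * volume.real E) ^ 2 ≤ (∑ i ∈ s, c i * ‖G i‖) ^ 2 := by
        refine pow_le_pow_left₀ (by positivity) h1 2
    _ ≤ _ := h2
    _ ≤ _ := mul_le_mul_of_nonneg_left h5 (sum_nonneg fun i hi => (hc i hi).trans (hcν i hi))

/-! ### Fejér kernels centred at fractions with small denominators. -/

theorem sum_e_div {q : ℕ} (hq : 0 < q) (k : ℤ) :
    ∑ a ∈ range q, e (k * a / q) = if (q : ℤ) ∣ k then (q : ℂ) else 0 := by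
  have hq' : (q : ℝ) ≠ 0 := by positivity
  split_ifs with h
  · obtain ⟨l, rfl⟩ := h
    have : ∀ a : ℕ, e (((q * l : ℤ) : ℝ) * a / q) = 1 := by
      intro a
      have h1 : (((q * l : ℤ) : ℝ) * a / q) = ((l * a : ℤ) : ℝ) := by
        push_cast; field_simp
      rw [h1, e_int]
    rw [sum_congr rfl fun a _ => this a]
    simp
  · have h1 : ∀ a : ℕ, e (k * a / q) = e (k / q) ^ a := by
      intro a; rw [← e_nat_mul]; congr 1; ring
    simp only [h1]
    have h2 : e (k / q) ≠ 1 := by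
      intro h3
      rw [e, Complex.exp_eq_one_iff] at h3
      obtain ⟨n, hn⟩ := h3
      have h4 : (2 * Real.pi * Complex.I : ℂ) ≠ 0 := by
        have : (Real.pi : ℂ) ≠ 0 := by exact_mod_cast Real.pi_ne_zero
        simp [this, Complex.I_ne_zero]
      rw [mul_comm (n : ℂ)] at hn
      have h5 := mul_left_cancel₀ h4 hn
      have h6 : (k / q : ℝ) = n := by exact_mod_cast h5
      rw [div_eq_iff hq'] at h6
      apply h
      refine ⟨n, ?_⟩
      rw [mul_comm]; exact_mod_cast h6
    have h7 := geom_sum_mul (e (k / q)) q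
    rw [← h1 q, mul_div_assoc, div_self hq', mul_one, e_int, sub_self] at h7
    exact (mul_eq_zero.mp h7).resolve_right (sub_ne_zero.mpr h2)

/-- A nonnegative exponential polynomial comparable to `min (1, 1 / (N‖t‖)) ^ 2`. -/
noncomputable def fejerPair (N : ℕ) (t : ℝ) : ℝ :=
  (‖∑ n ∈ range N, e (n * t)‖ ^ 2 + ‖∑ n ∈ range N, e (n * (t + 1 / (2 * N)))‖ ^ 2) / N ^ 2

theorem fejerPair_nonneg (N : ℕ) (t : ℝ) : 0 ≤ fejerPair N t := by
  unfold fejerPair; positivity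

theorem continuous_fejerPair (N : ℕ) : Continuous (fejerPair N) := by
  unfold fejerPair
  have h : ∀ s : ℝ, Continuous fun t : ℝ => ∑ n ∈ range N, e (n * (t + s)) := fun s =>
    continuous_finsetSum _ fun n _ => continuous_e.comp (by fun_prop)
  have h0 := h 0
  simp only [add_zero] at h0
  exact ((h0.norm.pow 2).add ((h _).norm.pow 2)).div_const _

/-- A single Fejér kernel has zeros. Shifting by `1/(2N)` turns `e (N t)` into `-e (N t)`, and `‖z -
1‖² + ‖z + 1‖² = 4` on the unit circle, so the two geometric sums cannot both be small. -/
theorem one_le_mul_fejerPair {N : ℕ} (hN : 0 < N) (t : ℝ) :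
    1 ≤ Real.pi ^ 2 * (N * nnInt t + 1 / 2) ^ 2 * fejerPair N t := by
  have hN' : (0 : ℝ) < N := by exact_mod_cast hN
  have hgeo : ∀ s : ℝ, (∑ n ∈ range N, e (n * s)) * (e s - 1) = e (N * s) - 1 := by
    intro s
    simp only [e_nat_mul]
    exact geom_sum_mul _ _
  have hper : ∀ s : ℝ, ‖e (t + s) - 1‖ ≤ 2 * Real.pi * (nnInt t + |s|) := by
    intro s
    have h1 := e_add_int (t - round t + s) (round t)
    have h2 : t - round t + s + (round t : ℝ) = t + s := by ring
    rw [h2] at h1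
    rw [h1]
    refine (norm_e_sub_one_le _).trans ?_
    exact mul_le_mul_of_nonneg_left (abs_add_le _ _) (by positivity)
  set V0 := ‖∑ n ∈ range N, e (n * t)‖
  set V1 := ‖∑ n ∈ range N, e (n * (t + 1 / (2 * N)))‖
  set r := 2 * Real.pi * (nnInt t + 1 / (2 * N)) with hr
  have hu := nnInt_nonneg t
  have hpos : (0 : ℝ) < 1 / (2 * N) := by positivity
  have h0 : ‖e (N * t) - 1‖ ≤ V0 * r := by
    rw [← hgeo, norm_mul]
    refine mul_le_mul_of_nonneg_left ?_ (norm_nonneg _)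
    have := hper 0
    rw [add_zero] at this
    refine this.trans ?_
    rw [hr, abs_zero]
    exact mul_le_mul_of_nonneg_left (by linarith) (by positivity)
  have h1 : ‖e (N * t) + 1‖ ≤ V1 * r := by
    have h2 : ‖e (N * t) + 1‖ = ‖e (N * (t + 1 / (2 * N))) - 1‖ := by
      have h3 : (N : ℝ) * (t + 1 / (2 * N)) = N * t + 1 / 2 := by field_simp
      rw [h3, e_add, e_half, ← norm_neg]; congr 1; ring
    rw [h2, ← hgeo, norm_mul]
    refine mul_le_mul_of_nonneg_left ?_ (norm_nonneg _)
    refine (hper _).trans ?_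
    rw [abs_of_pos hpos]
  have h2 : ‖e (N * t) - 1‖ ^ 2 + ‖e (N * t) + 1‖ ^ 2 = 4 := by
    have := parallelogram_law_with_norm ℝ (e (N * t)) 1
    rw [norm_e, norm_one] at this
    nlinarith
  have h3 : 4 ≤ (V0 ^ 2 + V1 ^ 2) * r ^ 2 := by
    have h4 := pow_le_pow_left₀ (norm_nonneg _) h0 2
    have h5 := pow_le_pow_left₀ (norm_nonneg _) h1 2
    nlinarith
  have h4 : (V0 ^ 2 + V1 ^ 2) * r ^ 2 =
      4 * (Real.pi ^ 2 * (N * nnInt t + 1 / 2) ^ 2 * fejerPair N t) := by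
    have h5 : fejerPair N t = (V0 ^ 2 + V1 ^ 2) / N ^ 2 := rfl
    rw [hr, h5]
    field_simp
    ring
  linarith

theorem one_div_one_add_sq_le {N : ℕ} (hN : 0 < N) (t : ℝ) :
    (1 / (1 + N * nnInt t)) ^ 2 ≤ 16 * fejerPair N t := by
  have h := one_le_mul_fejerPair hN t
  have hF := fejerPair_nonneg N t
  have hu := nnInt_nonneg t
  have hNu : 0 ≤ N * nnInt t := by positivity
  have hpi : Real.pi ^ 2 ≤ 16 := by nlinarith [Real.pi_lt_d2, Real.pi_pos]
  rw [one_div_pow, div_le_iff₀ (by positivity)]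
  calc 1 ≤ Real.pi ^ 2 * (N * nnInt t + 1 / 2) ^ 2 * fejerPair N t := h
    _ ≤ 16 * (1 + N * nnInt t) ^ 2 * fejerPair N t := by
        refine mul_le_mul_of_nonneg_right (mul_le_mul hpi ?_ (by positivity) (by norm_num)) hF
        exact pow_le_pow_left₀ (by positivity) (by linarith) 2
    _ = _ := by ring

/-- Averages of a shifted Fejér kernel over the fractions with denominator `q`. -/
theorem integral_sum_shift_le {E : Set ℝ} (hE : E ⊆ Set.Icc 0 1) {q : ℕ} (hq : 0 < q) (N : ℕ)
    (s : ℝ) :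
    ∫ z : ℝ × ℝ, ∑ a ∈ range q, ‖∑ n ∈ range N, e (n * (z.1 - z.2 - a / q + s))‖ ^ 2
        ∂((volume.restrict E).prod (volume.restrict E)) ≤
      q * ∑ m ∈ range N, ∑ n ∈ range N,
        if (q : ℤ) ∣ (m : ℤ) - n then ‖indCoeff E ((m : ℤ) - n)‖ ^ 2 else 0 := by
  set μ := (volume.restrict E).prod (volume.restrict E)
  have h1 : ∀ z : ℝ × ℝ,
      ((∑ a ∈ range q, ‖∑ n ∈ range N, e (n * (z.1 - z.2 - a / q + s))‖ ^ 2 : ℝ) : ℂ) =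
      ∑ m ∈ range N, ∑ n ∈ range N,
        (e ((((m : ℤ) - n : ℤ) : ℝ) * s) * if (q : ℤ) ∣ (m : ℤ) - n then (q : ℂ) else 0) *
          e ((((m : ℤ) - n : ℤ) : ℝ) * (z.1 - z.2)) := by
    intro z
    rw [Complex.ofReal_sum]
    simp only [norm_sum_sq_eq, conj_e, ← e_add]
    rw [sum_comm]
    refine sum_congr rfl fun m _ => ?_
    rw [sum_comm]
    refine sum_congr rfl fun n _ => ?_
    have h2 : ((q : ℤ) ∣ (m : ℤ) - n) ↔ (q : ℤ) ∣ (n : ℤ) - m := dvd_sub_comm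
    simp only [h2]
    rw [← sum_e_div hq, mul_sum, sum_mul]
    refine sum_congr rfl fun a _ => ?_
    rw [← e_add, ← e_add]
    congr 1
    push_cast
    ring
  have hc : ∀ k : ℤ, Continuous fun z : ℝ × ℝ => e (k * (z.1 - z.2)) := fun k =>
    continuous_e.comp (by fun_prop)
  have h2 : ((∫ z : ℝ × ℝ, ∑ a ∈ range q, ‖∑ n ∈ range N, e (n * (z.1 - z.2 - a / q + s))‖ ^ 2
      ∂μ : ℝ) : ℂ) = ∑ m ∈ range N, ∑ n ∈ range N,
        (e ((((m : ℤ) - n : ℤ) : ℝ) * s) * if (q : ℤ) ∣ (m : ℤ) - n then (q : ℂ) else 0) *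
          ((‖indCoeff E ((m : ℤ) - n)‖ ^ 2 : ℝ) : ℂ) := by
    rw [← integral_complex_ofReal]
    simp only [h1]
    have hi : ∀ (c : ℂ) (k : ℤ), Integrable (fun z : ℝ × ℝ => c * e (k * (z.1 - z.2))) μ :=
      fun c k => integrable_prod_of_continuous (continuous_const.mul (hc k)) hE
    rw [integral_finsetSum _ fun m _ => integrable_finsetSum _ fun n _ => hi _ _]
    refine sum_congr rfl fun m _ => ?_
    rw [integral_finsetSum _ fun n _ => hi _ _]
    refine sum_congr rfl fun n _ => ?_
    rw [integral_const_mul, integral_prod_e]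
  have h3 : ‖((∫ z : ℝ × ℝ, ∑ a ∈ range q, ‖∑ n ∈ range N, e (n * (z.1 - z.2 - a / q + s))‖ ^ 2
      ∂μ : ℝ) : ℂ)‖ ≤ q * ∑ m ∈ range N, ∑ n ∈ range N,
        if (q : ℤ) ∣ (m : ℤ) - n then ‖indCoeff E ((m : ℤ) - n)‖ ^ 2 else 0 := by
    rw [h2, mul_sum]
    refine (norm_sum_le _ _).trans (sum_le_sum fun m _ => ?_)
    rw [mul_sum]
    refine (norm_sum_le _ _).trans (sum_le_sum fun n _ => ?_)
    rw [norm_mul, norm_mul, norm_e, one_mul, Complex.norm_real, norm_pow, norm_norm]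
    split_ifs <;> simp
  rw [Complex.norm_real] at h3
  exact (le_abs_self _).trans h3

/-- The number of `q ≤ Q` dividing `k`. -/
def smallDivisors (Q : ℕ) (k : ℤ) : ℕ := #((Icc 1 Q).filter fun q : ℕ => (q : ℤ) ∣ k)

/-- Summing over all numerators `a < q`, reduced or not, retains exactly the frequencies divisible
by `q`; summing over `q ≤ Q` then counts the small divisors of each frequency. The factor 2 comes
from the two shifts in `fejerPair`. -/
theorem integral_sum_fejerPair_le {E : Set ℝ} (hE : E ⊆ Set.Icc 0 1) (N Q : ℕ) :
    ∫ z : ℝ × ℝ, ∑ q ∈ Icc 1 Q, (1 / q : ℝ) * ∑ a ∈ range q, fejerPair N (z.1 - z.2 - a / q)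
        ∂((volume.restrict E).prod (volume.restrict E)) ≤
      2 / N ^ 2 * ∑ m ∈ range N, ∑ n ∈ range N,
        ‖indCoeff E ((m : ℤ) - n)‖ ^ 2 * smallDivisors Q ((m : ℤ) - n) := by
  set μ := (volume.restrict E).prod (volume.restrict E)
  have hc : ∀ s : ℝ, Continuous fun z : ℝ × ℝ => fejerPair N (z.1 - z.2 - s) := fun s =>
    (continuous_fejerPair N).comp (by fun_prop)
  have hc2 : ∀ s : ℝ, Continuous fun z : ℝ × ℝ => ∑ n ∈ range N, e (n * (z.1 - z.2 + s)) := fun s =>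
    continuous_finsetSum _ fun n _ => continuous_e.comp (by fun_prop)
  have hq : ∀ q ∈ Icc 1 Q, ∫ z : ℝ × ℝ, (1 / q : ℝ) * ∑ a ∈ range q,
      fejerPair N (z.1 - z.2 - a / q) ∂μ ≤ 2 / N ^ 2 * ∑ m ∈ range N, ∑ n ∈ range N,
        if (q : ℤ) ∣ (m : ℤ) - n then ‖indCoeff E ((m : ℤ) - n)‖ ^ 2 else 0 := by
    intro q hq
    have hq0 : 0 < q := (mem_Icc.mp hq).1
    have hq0' : (0 : ℝ) < q := by exact_mod_cast hq0
    have h1 := integral_sum_shift_le hE hq0 N 0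
    have h2 := integral_sum_shift_le hE hq0 N (1 / (2 * N))
    simp only [add_zero] at h1
    have h3 : ∀ z : ℝ × ℝ, (1 / q : ℝ) * ∑ a ∈ range q, fejerPair N (z.1 - z.2 - a / q) =
        1 / (q * N ^ 2) * ((∑ a ∈ range q, ‖∑ n ∈ range N, e (n * (z.1 - z.2 - a / q))‖ ^ 2) +
          ∑ a ∈ range q, ‖∑ n ∈ range N, e (n * (z.1 - z.2 - a / q + 1 / (2 * N)))‖ ^ 2) := by
      intro z
      unfold fejerPair
      rw [← sum_add_distrib, ← sum_div, one_div_mul_eq_div, div_div, mul_comm (q : ℝ),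
        one_div_mul_eq_div]
    simp only [h3]
    have hc3 : ∀ s : ℝ, Continuous fun z : ℝ × ℝ =>
        ∑ a ∈ range q, ‖∑ n ∈ range N, e (n * (z.1 - z.2 - a / q + s))‖ ^ 2 := by
      intro s
      refine continuous_finsetSum _ fun a _ => ?_
      have h5 : ∀ z : ℝ × ℝ, z.1 - z.2 - a / q + s = z.1 - z.2 + (-(a / q) + s) := fun z => by ring
      simp only [h5]
      exact (hc2 (-(a / q) + s)).norm.pow 2
    have hc4 := hc3 0
    simp only [add_zero] at hc4
    rw [integral_const_mul, integral_add (integrable_prod_of_continuous_real hc4 hE)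
      (integrable_prod_of_continuous_real (hc3 _) hE)]
    refine (mul_le_mul_of_nonneg_left (add_le_add h1 h2) (by positivity)).trans (le_of_eq ?_)
    rcases Nat.eq_zero_or_pos N with rfl | hN
    · simp
    · have hN' : (0 : ℝ) < N := by exact_mod_cast hN
      field_simp
      ring
  rw [integral_finsetSum _ fun q _ => ?_]
  · refine (sum_le_sum hq).trans (le_of_eq ?_)
    rw [← mul_sum, sum_comm]
    congr 1
    refine sum_congr rfl fun m _ => ?_
    rw [sum_comm]
    refine sum_congr rfl fun n _ => ?_
    rw [← sum_filter, sum_const, smallDivisors, nsmul_eq_mul, mul_comm]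
  · exact integrable_prod_of_continuous_real
      (continuous_const.mul (continuous_finsetSum _ fun a _ => hc _)) hE

/-! ### Divisor bounds -/

/-- The divisor function grows more slowly than any positive power. -/
theorem exists_card_divisors_le (ε : ℝ) (hε : 0 < ε) :
    ∃ C : ℝ, 1 ≤ C ∧ ∀ n : ℕ, n ≠ 0 → (#n.divisors : ℝ) ≤ C * (n : ℝ) ^ ε := by
  -- A prime `p ≥ 2 ^ (1/ε)` has `p ^ ε ≥ 2`, and `a + 1 ≤ 2 ^ a`, so it costs nothing. Each of the
  -- fewer than `P` smaller primes costs at most `K`, by Bernoulli's inequality.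
  set K : ℝ := 1 + 1 / (ε * Real.log 2) with hK
  have hlog : 0 < Real.log 2 := Real.log_pos (by norm_num)
  have hK1 : 1 ≤ K := by rw [hK]; linarith [show 0 < 1 / (ε * Real.log 2) by positivity]
  obtain ⟨P, hP⟩ := exists_nat_ge ((2 : ℝ) ^ (1 / ε))
  refine ⟨K ^ P, one_le_pow₀ hK1, fun n hn => ?_⟩
  have hfac : ∀ p ∈ n.primeFactors, ((n.factorization p + 1 : ℕ) : ℝ) ≤
      (if p < P then K else 1) * ((p : ℝ) ^ n.factorization p) ^ ε := by
    intro p hp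
    have hp2 : (2 : ℝ) ≤ p := by exact_mod_cast (Nat.prime_of_mem_primeFactors hp).two_le
    set a := n.factorization p
    have h1 : ((p : ℝ) ^ a) ^ ε = ((p : ℝ) ^ ε) ^ a := by
      rw [← Real.rpow_natCast, ← Real.rpow_mul (by positivity), mul_comm, Real.rpow_mul (by positivity),
        Real.rpow_natCast]
    rw [h1]
    split_ifs with h
    · have h2 : (2 : ℝ) ^ ε ≤ (p : ℝ) ^ ε := Real.rpow_le_rpow (by norm_num) hp2 hε.le
      have h3 : 1 + ε * Real.log 2 ≤ (2 : ℝ) ^ ε := by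
        rw [Real.rpow_def_of_pos (by norm_num)]
        have := Real.add_one_le_exp (Real.log 2 * ε)
        linarith
      have h4 : 1 + (a : ℝ) * (ε * Real.log 2) ≤ ((p : ℝ) ^ ε) ^ a := by
        refine (one_add_mul_le_pow (by nlinarith [mul_pos hε hlog]) a).trans ?_
        exact pow_le_pow_left₀ (by positivity) (h3.trans h2) a
      refine le_trans ?_ (mul_le_mul_of_nonneg_left h4 (by linarith))
      rw [hK]
      push_cast
      have h5 : (1 + 1 / (ε * Real.log 2)) * (1 + a * (ε * Real.log 2)) =
        1 + a * (ε * Real.log 2) + 1 / (ε * Real.log 2) + a := by field_simp; ring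
      rw [h5]
      have : 0 ≤ a * (ε * Real.log 2) := by positivity
      have : 0 ≤ 1 / (ε * Real.log 2) := by positivity
      linarith
    · rw [one_mul]
      have h2 : (2 : ℝ) ≤ (p : ℝ) ^ ε := by
        have h3 : (2 : ℝ) ^ (1 / ε) ≤ p := hP.trans (by exact_mod_cast not_lt.mp h)
        have h4 := Real.rpow_le_rpow (by positivity) h3 hε.le
        rwa [← Real.rpow_mul (by norm_num), one_div_mul_cancel hε.ne', Real.rpow_one] at h4
      calc ((a + 1 : ℕ) : ℝ) ≤ ((2 ^ a : ℕ) : ℝ) := by exact_mod_cast Nat.lt_two_pow_self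
        _ = 2 ^ a := by push_cast; rfl
        _ ≤ _ := pow_le_pow_left₀ (by norm_num) h2 a
  rw [Nat.card_divisors hn]
  push_cast
  have h1 : ∏ p ∈ n.primeFactors, ((n.factorization p : ℝ) + 1) ≤
      ∏ p ∈ n.primeFactors, ((if p < P then K else 1) * ((p : ℝ) ^ n.factorization p) ^ ε) :=
    prod_le_prod (fun p _ => by positivity) (fun p hp => by simpa using hfac p hp)
  refine h1.trans ?_
  rw [prod_mul_distrib, Real.finsetProd_rpow _ _ (fun p _ => by positivity)]
  have h2 : (∏ p ∈ n.primeFactors, (p : ℝ) ^ n.factorization p) = n := by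
    have := Nat.prod_factorization_pow_eq_self hn
    conv_rhs => rw [← this]
    rw [Finsupp.prod]
    push_cast
    rfl
  rw [h2]
  refine mul_le_mul_of_nonneg_right ?_ (by positivity)
  rw [prod_ite, prod_const_one, mul_one, prod_const]
  refine pow_le_pow_right₀ hK1 ?_
  calc _ ≤ #(range P) := card_le_card fun p hp => by simp at hp ⊢; exact hp.2
    _ = P := card_range P

/-- The left side counts `B`-tuples of divisors of `k` up to `Q`. Group them by their least common
multiple `m`, which divides `k` and is at most `Q ^ B`; every entry of such a tuple divides `m`. -/
theorem smallDivisors_pow_le (B Q : ℕ) {k : ℕ} (hk : 0 < k) :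
    smallDivisors Q k ^ B ≤ ∑ m ∈ Icc 1 (Q ^ B), if m ∣ k then #m.divisors ^ B else 0 := by
  set s := (Icc 1 Q).filter fun q : ℕ => (q : ℤ) ∣ (k : ℤ)
  have hcard : smallDivisors Q k ^ B = #(Fintype.piFinset fun _ : Fin B => s) := by
    rw [Fintype.card_piFinset_const]; simp [smallDivisors, s]
  rw [hcard, ← sum_filter, card_eq_sum_card_fiberwise (f := fun t : Fin B → ℕ => univ.lcm t)
    (t := (Icc 1 (Q ^ B)).filter fun m => m ∣ k)]
  · refine sum_le_sum fun m hm => ?_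
    have hm0 : m ≠ 0 := by simp at hm; omega
    calc _ ≤ #(Fintype.piFinset fun _ : Fin B => m.divisors) := by
          refine card_le_card fun t ht => ?_
          simp only [mem_filter] at ht
          rw [Fintype.mem_piFinset]
          intro i
          rw [Nat.mem_divisors]
          refine ⟨?_, hm0⟩
          rw [← ht.2]
          exact dvd_lcm (mem_univ i)
      _ = _ := by rw [Fintype.card_piFinset_const]
  · intro t ht
    have ht' : ∀ i, (1 ≤ t i ∧ t i ≤ Q) ∧ t i ∣ k := by
      intro i
      have := Fintype.mem_piFinset.mp ht i
      simpa [s, Int.natCast_dvd_natCast] using this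
    have hd : univ.lcm t ∣ k := Finset.lcm_dvd fun i _ => (ht' i).2
    simp only [coe_filter, mem_Icc, Set.mem_ofPred_eq]
    refine ⟨⟨Nat.pos_of_dvd_of_pos hd hk, ?_⟩, hd⟩
    have h1 : univ.lcm t ∣ ∏ i, t i := Finset.lcm_dvd fun i hi => dvd_prod_of_mem t hi
    refine (Nat.le_of_dvd (prod_pos fun i _ => (ht' i).1.1) h1).trans ?_
    calc ∏ i, t i ≤ ∏ _i : Fin B, Q := prod_le_prod' fun i _ => (ht' i).1.2
      _ = Q ^ B := by simp

theorem card_multiples_le (N m : ℕ) :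
    (#((Icc 1 N).filter fun k => m ∣ k) : ℝ) ≤ N / m := by
  have h : #((Icc 1 N).filter fun k => m ∣ k) = N / m := by
    have h1 : Icc 1 N = Ioc 0 N := by ext k; simp [Nat.succ_le_iff]
    rw [h1, Nat.Ioc_filter_dvd_card_eq_div]
  rw [h]
  exact Nat.cast_div_le

theorem sum_one_div_le_one_add_log (n : ℕ) : ∑ m ∈ Icc 1 n, (1 / m : ℝ) ≤ 1 + Real.log n := by
  have := harmonic_le_one_add_log n
  rw [harmonic_eq_sum_Icc] at this
  push_cast at this
  simpa using this

/-- Each `m ≤ Q ^ B` divides at most `N / m` of the `k`. The exponent `δ` is small enough that the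
divisor powers cost `Q ^ (1/2)`, and the harmonic sum costs another `Q ^ (1/2)`. What matters is
that the power of `Q` does not grow with `B`. -/
theorem exists_sum_smallDivisors_pow_le (B : ℕ) : ∃ C : ℝ, 1 ≤ C ∧ ∀ N Q : ℕ, 1 ≤ Q →
    ∑ k ∈ Icc 1 N, (smallDivisors Q (k : ℕ) : ℝ) ^ B ≤ C * N * Q := by
  set δ : ℝ := 1 / (2 * (B ^ 2 + 1)) with hδ
  obtain ⟨C, hC1, hC⟩ := exists_card_divisors_le δ (by positivity)
  refine ⟨C ^ B * (1 + 2 * B), ?_, fun N Q hQ => ?_⟩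
  · have : 1 ≤ C ^ B := one_le_pow₀ hC1
    have hB : (0 : ℝ) ≤ B := by positivity
    nlinarith
  have hQ' : (1 : ℝ) ≤ Q := by exact_mod_cast hQ
  have h1 : ∀ k ∈ Icc 1 N, (smallDivisors Q (k : ℕ) : ℝ) ^ B ≤
      ∑ m ∈ Icc 1 (Q ^ B), if m ∣ k then (#m.divisors : ℝ) ^ B else 0 := by
    intro k hk
    have := smallDivisors_pow_le B Q (k := k) (mem_Icc.mp hk).1
    exact_mod_cast this
  have h2 : ∀ m ∈ Icc 1 (Q ^ B), (#m.divisors : ℝ) ^ B ≤ C ^ B * (Q : ℝ) ^ (1 / 2 : ℝ) := by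
    intro m hm
    rw [mem_Icc] at hm
    have h3 : (#m.divisors : ℝ) ≤ C * (m : ℝ) ^ δ := hC m (by omega)
    have h4 : (m : ℝ) ^ δ ≤ ((Q : ℝ) ^ B) ^ δ :=
      Real.rpow_le_rpow (by positivity) (by exact_mod_cast hm.2) (by positivity)
    have h5 : (#m.divisors : ℝ) ^ B ≤ (C * ((Q : ℝ) ^ B) ^ δ) ^ B := by
      refine pow_le_pow_left₀ (by positivity) (h3.trans ?_) B
      exact mul_le_mul_of_nonneg_left h4 (by linarith)
    refine h5.trans ?_
    rw [mul_pow]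
    refine mul_le_mul_of_nonneg_left ?_ (by positivity)
    rw [← Real.rpow_natCast (((Q : ℝ) ^ B) ^ δ), ← Real.rpow_natCast (Q : ℝ),
      ← Real.rpow_mul (by positivity), ← Real.rpow_mul (by positivity)]
    refine Real.rpow_le_rpow_of_exponent_le hQ' ?_
    rw [hδ, one_div_mul_eq_div, mul_div_assoc', div_le_div_iff₀ (by positivity) (by positivity)]
    nlinarith
  calc ∑ k ∈ Icc 1 N, (smallDivisors Q (k : ℕ) : ℝ) ^ B
      ≤ ∑ k ∈ Icc 1 N, ∑ m ∈ Icc 1 (Q ^ B), if m ∣ k then (#m.divisors : ℝ) ^ B else 0 :=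
        sum_le_sum h1
    _ = ∑ m ∈ Icc 1 (Q ^ B), (#((Icc 1 N).filter fun k => m ∣ k) : ℝ) * (#m.divisors : ℝ) ^ B := by
        rw [sum_comm]
        refine sum_congr rfl fun m _ => ?_
        rw [← sum_filter, sum_const, nsmul_eq_mul]
    _ ≤ ∑ m ∈ Icc 1 (Q ^ B), (N * (C ^ B * (Q : ℝ) ^ (1 / 2 : ℝ))) * (1 / m) := by
        refine sum_le_sum fun m hm => ?_
        refine (mul_le_mul (card_multiples_le N m) (h2 m hm) (by positivity)
          (by positivity)).trans (le_of_eq (by ring))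
    _ ≤ (N * (C ^ B * (Q : ℝ) ^ (1 / 2 : ℝ))) * ((1 + 2 * B) * (Q : ℝ) ^ (1 / 2 : ℝ)) := by
        rw [← mul_sum]
        refine mul_le_mul_of_nonneg_left ?_ (by positivity)
        refine (sum_one_div_le_one_add_log _).trans ?_
        push_cast
        rw [Real.log_pow]
        have h6 := Real.log_le_rpow_div (x := (Q : ℝ)) (by positivity) (ε := 1 / 2) (by norm_num)
        have h7 : 1 ≤ (Q : ℝ) ^ (1 / 2 : ℝ) := Real.one_le_rpow hQ' (by norm_num)
        have hB : (0 : ℝ) ≤ B := by positivity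
        have h8 : Real.log Q ≤ 2 * (Q : ℝ) ^ (1 / 2 : ℝ) := by linarith
        nlinarith [mul_le_mul_of_nonneg_left h8 hB]
    _ = C ^ B * (1 + 2 * B) * N * ((Q : ℝ) ^ (1 / 2 : ℝ) * (Q : ℝ) ^ (1 / 2 : ℝ)) := by ring
    _ = _ := by
        rw [← Real.rpow_add (by positivity)]; norm_num

theorem smallDivisors_neg (Q : ℕ) (k : ℤ) : smallDivisors Q (-k) = smallDivisors Q k := by
  simp [smallDivisors]

theorem smallDivisors_le (Q : ℕ) (k : ℤ) : smallDivisors Q k ≤ Q :=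
  (card_filter_le _ _).trans (by simp)

theorem sum_sum_sub_le (N : ℕ) (f : ℤ → ℝ) (hf : ∀ k, 0 ≤ f k) :
    ∑ m ∈ range N, ∑ n ∈ range N, f ((m : ℤ) - n) ≤ N * ∑ k ∈ Icc (-(N : ℤ)) N, f k := by
  have h : ∀ m ∈ range N, ∑ n ∈ range N, f ((m : ℤ) - n) ≤ ∑ k ∈ Icc (-(N : ℤ)) N, f k := by
    intro m hm
    rw [mem_range] at hm
    have hinj : Set.InjOn (fun n : ℕ => (m : ℤ) - n) (range N : Finset ℕ) := by
      intro a _ b _ hab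
      simp only at hab
      omega
    rw [← sum_image (s := range N) (g := fun n : ℕ => (m : ℤ) - n) (f := f) hinj]
    refine sum_le_sum_of_subset_of_nonneg (fun k hk => ?_) (fun k _ _ => hf k)
    rw [mem_image] at hk
    obtain ⟨n, hn, rfl⟩ := hk
    rw [mem_range] at hn
    rw [mem_Icc]
    omega
  refine (sum_le_sum h).trans (le_of_eq ?_)
  simp

theorem sum_Icc_neg_eq (N : ℕ) (f : ℤ → ℝ) :
    ∑ k ∈ Icc (-(N : ℤ)) N, f k = f 0 + ∑ k ∈ Icc 1 N, (f (k : ℕ) + f (-(k : ℕ))) := by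
  induction N with
  | zero => simp
  | succ n ih =>
    have h : Icc (-((n + 1 : ℕ) : ℤ)) ((n + 1 : ℕ) : ℤ) =
        insert (-((n + 1 : ℕ) : ℤ)) (insert ((n + 1 : ℕ) : ℤ) (Icc (-(n : ℤ)) n)) := by
      ext k; simp only [mem_insert, mem_Icc]; push_cast; omega
    rw [h, sum_insert, sum_insert, ih, sum_Icc_succ_top (by omega)]
    · ring
    · simp
    · simp only [mem_insert, mem_Icc]; push_cast; omega

/-- The large-sieve type bound for averages of small divisors against the Fourier coefficients of
an indicator function. -/
theorem exists_sum_indCoeff_smallDivisors_le (B : ℕ) : ∃ C : ℝ, 1 ≤ C ∧ ∀ {E : Set ℝ},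
    E ⊆ Set.Icc 0 1 → ∀ (N Q : ℕ) (T : ℝ), 1 ≤ Q → 0 < T →
    ∑ m ∈ range N, ∑ n ∈ range N,
        ‖indCoeff E ((m : ℤ) - n)‖ ^ 2 * smallDivisors Q ((m : ℤ) - n) ≤
      N * Q * volume.real E ^ 2 + N * T * volume.real E +
        C * N ^ 2 * Q / T ^ B * volume.real E ^ 2 := by
  obtain ⟨C, hC1, hC⟩ := exists_sum_smallDivisors_pow_le (B + 1)
  refine ⟨2 * C, by linarith, fun {E} hE N Q T hQ hT => ?_⟩
  set v := volume.real E
  have hv : 0 ≤ v := measureReal_nonneg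
  refine (sum_sum_sub_le N (fun k => ‖indCoeff E k‖ ^ 2 * smallDivisors Q k)
    (fun k => by positivity)).trans ?_
  have hE2 : ∀ k, ‖indCoeff E k‖ ^ 2 ≤ v ^ 2 := fun k =>
    pow_le_pow_left₀ (norm_nonneg _) (norm_indCoeff_le hE k) 2
  -- Counts up to `T` are charged to Bessel's inequality; larger ones are rare and are charged to
  -- the moment of order `B + 1`. The frequency 0, divisible by every `q`, is estimated apart and
  -- yields the first term of the bound.
  have hd : ∀ k : ℤ, (smallDivisors Q k : ℝ) ≤ T + (smallDivisors Q k : ℝ) ^ (B + 1) / T ^ B := by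
    intro k
    set d : ℝ := (smallDivisors Q k : ℝ)
    have hd0 : 0 ≤ d := by positivity
    rcases le_total d T with h | h
    · have : 0 ≤ d ^ (B + 1) / T ^ B := by positivity
      linarith
    · have h1 : T ^ B ≤ d ^ B := pow_le_pow_left₀ hT.le h B
      have h2 : d ≤ d ^ (B + 1) / T ^ B := by
        rw [le_div_iff₀ (by positivity), pow_succ, mul_comm]
        exact mul_le_mul_of_nonneg_right h1 hd0
      linarith
  have hterm : ∀ k : ℤ, ‖indCoeff E k‖ ^ 2 * smallDivisors Q k ≤
      T * ‖indCoeff E k‖ ^ 2 + v ^ 2 * ((smallDivisors Q k : ℝ) ^ (B + 1) / T ^ B) := by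
    intro k
    refine (mul_le_mul_of_nonneg_left (hd k) (by positivity)).trans ?_
    rw [mul_add, mul_comm T]
    exact add_le_add le_rfl (mul_le_mul_of_nonneg_right (hE2 k) (by positivity))
  have hb := sum_norm_sq_indCoeff_le hE (Icc (-(N : ℤ)) N)
  rw [sum_Icc_neg_eq] at hb ⊢
  have h0 : ‖indCoeff E 0‖ ^ 2 * (smallDivisors Q 0 : ℝ) ≤ Q * v ^ 2 := by
    rw [mul_comm]
    exact mul_le_mul (by exact_mod_cast smallDivisors_le Q 0) (hE2 0) (by positivity) (by positivity)
  have h1 : ∑ k ∈ Icc 1 N, (‖indCoeff E (k : ℕ)‖ ^ 2 * (smallDivisors Q (k : ℕ) : ℝ) +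
      ‖indCoeff E (-(k : ℕ))‖ ^ 2 * (smallDivisors Q (-(k : ℕ)) : ℝ)) ≤
      T * ∑ k ∈ Icc 1 N, (‖indCoeff E (k : ℕ)‖ ^ 2 + ‖indCoeff E (-(k : ℕ))‖ ^ 2) +
      2 * v ^ 2 / T ^ B * ∑ k ∈ Icc 1 N, (smallDivisors Q (k : ℕ) : ℝ) ^ (B + 1) := by
    rw [mul_sum, mul_sum, ← sum_add_distrib]
    refine sum_le_sum fun k _ => (add_le_add (hterm k) (hterm (-k))).trans (le_of_eq ?_)
    rw [smallDivisors_neg]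
    ring
  have h2 : 2 * v ^ 2 / T ^ B * ∑ k ∈ Icc 1 N, (smallDivisors Q (k : ℕ) : ℝ) ^ (B + 1) ≤
      2 * v ^ 2 / T ^ B * (C * N * Q) := mul_le_mul_of_nonneg_left (hC N Q hQ) (by positivity)
  have h3 : T * ∑ k ∈ Icc 1 N, (‖indCoeff E (k : ℕ)‖ ^ 2 + ‖indCoeff E (-(k : ℕ))‖ ^ 2) ≤ T * v := by
    refine mul_le_mul_of_nonneg_left ?_ hT.le
    have : 0 ≤ ‖indCoeff E 0‖ ^ 2 := by positivity
    linarith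
  have h4 : ‖indCoeff E 0‖ ^ 2 * (smallDivisors Q 0 : ℝ) +
      ∑ k ∈ Icc 1 N, (‖indCoeff E (k : ℕ)‖ ^ 2 * (smallDivisors Q (k : ℕ) : ℝ) +
        ‖indCoeff E (-(k : ℕ))‖ ^ 2 * (smallDivisors Q (-(k : ℕ)) : ℝ)) ≤
      Q * v ^ 2 + T * v + 2 * v ^ 2 / T ^ B * (C * N * Q) := by linarith
  refine (mul_le_mul_of_nonneg_left h4 (by positivity)).trans (le_of_eq ?_)
  ring

/-! ### The level set estimate -/

/-- The major arc majorant. -/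
noncomputable def arcKernel (N Q : ℕ) (t : ℝ) : ℝ :=
  ∑ q ∈ Icc 1 Q, (1 / q : ℝ) * ∑ a ∈ range q, fejerPair N (t - a / q)

theorem arcKernel_nonneg (N Q : ℕ) (t : ℝ) : 0 ≤ arcKernel N Q t :=
  sum_nonneg fun _ _ => mul_nonneg (by positivity) (sum_nonneg fun _ _ => fejerPair_nonneg _ _)

theorem le_arcKernel {N Q q a : ℕ} (hq : 1 ≤ q) (hqQ : q ≤ Q) (ha : a < q) (t : ℝ) :
    (1 / q : ℝ) * fejerPair N (t - a / q) ≤ arcKernel N Q t := by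
  have h1 : (1 / q : ℝ) * fejerPair N (t - a / q) ≤
      (1 / q : ℝ) * ∑ a ∈ range q, fejerPair N (t - a / q) :=
    mul_le_mul_of_nonneg_left (single_le_sum (f := fun a : ℕ => fejerPair N (t - a / q))
      (fun _ _ => fejerPair_nonneg _ _) (mem_range.mpr ha)) (by positivity)
  exact h1.trans (single_le_sum
    (f := fun q : ℕ => (1 / q : ℝ) * ∑ a ∈ range q, fejerPair N (t - a / q))
    (fun _ _ => mul_nonneg (by positivity) (sum_nonneg fun _ _ => fejerPair_nonneg _ _))
    (mem_Icc.mpr ⟨hq, hqQ⟩))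

theorem continuous_arcKernel (N Q : ℕ) : Continuous (arcKernel N Q) := by
  unfold arcKernel
  exact continuous_finsetSum _ fun q _ => continuous_const.mul
    (continuous_finsetSum _ fun a _ => (continuous_fejerPair N).comp (by fun_prop))

/-- For `q ≤ Q`, AM-GM trades the bound for its square, which a Fejér pair dominates, and `q ^ (2ε)
≤ α ^ (-10ε)`. For `q > Q`, `q ^ (-1/2 + ε) ≤ α ^ (9/4)`, and the spare `α ^ (1/4)` absorbs the
constants. The term in `α ^ 2` is small enough to be absorbed later by the left side of the dual
inequality. -/
theorem le_of_major_arc_bound {ε A α K : ℝ} (hε : 0 < ε) (hε1 : ε ≤ 1 / 20) (hA : 1 ≤ A)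
    (hK : 1 ≤ K) (hα : 0 < α) (hα1 : α ≤ 1) (hαA : A * α ^ (1 / 4 : ℝ) ≤ 1 / (8 * K)) {N Q q a : ℕ}
    (hN : 0 < N) (hq : 1 ≤ q) (ha : a < q) (hQ : Q = ⌊α ^ (-5 : ℝ)⌋₊) (t : ℝ) :
    A * (q : ℝ) ^ (-1 / 2 + ε) / (1 + N * nnInt (t - a / q)) ≤
      3 * α ^ 2 / (8 * K) + 16 * A ^ 2 * K * α ^ (-2 - 10 * ε) * arcKernel N Q t := by
  have hU := arcKernel_nonneg N Q t
  have hu := nnInt_nonneg (t - a / q)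
  have hq' : (0 : ℝ) < q := by exact_mod_cast hq
  rcases le_or_gt q Q with h | h
  · set y := A * (q : ℝ) ^ (-1 / 2 + ε) / (1 + N * nnInt (t - a / q)) with hy
    have h1 : y ≤ α ^ 2 / (4 * K) + y ^ 2 * (K / α ^ 2) := by
      have h2 : α ^ 2 / (4 * K) + y ^ 2 * (K / α ^ 2) - y =
          (α ^ 2 / (4 * K)) * (1 - 2 * K / α ^ 2 * y) ^ 2 := by
        field_simp; ring
      have h3 : 0 ≤ (α ^ 2 / (4 * K)) * (1 - 2 * K / α ^ 2 * y) ^ 2 := by positivity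
      linarith
    have h2 : y ^ 2 ≤ 16 * A ^ 2 * α ^ (-10 * ε) * arcKernel N Q t := by
      have h3 : y ^ 2 = A ^ 2 * (((q : ℝ) ^ (-1 / 2 + ε)) ^ 2 * (1 / (1 + N * nnInt (t - a / q))) ^ 2) := by
        rw [hy]; ring
      have h4 : ((q : ℝ) ^ (-1 / 2 + ε)) ^ 2 ≤ 1 / q * α ^ (-10 * ε) := by
        rw [← Real.rpow_natCast, ← Real.rpow_mul hq'.le]
        have h5 : (-1 / 2 + ε) * ((2 : ℕ) : ℝ) = -1 + 2 * ε := by push_cast; ring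
        rw [h5, Real.rpow_add hq', Real.rpow_neg_one, one_div]
        refine mul_le_mul_of_nonneg_left ?_ (by positivity)
        have h6 : (q : ℝ) ≤ α ^ (-5 : ℝ) := by
          refine le_trans (Nat.cast_le.mpr h) ?_
          rw [hQ]; exact Nat.floor_le (by positivity)
        calc (q : ℝ) ^ (2 * ε) ≤ (α ^ (-5 : ℝ)) ^ (2 * ε) :=
              Real.rpow_le_rpow hq'.le h6 (by positivity)
          _ = α ^ (-10 * ε) := by rw [← Real.rpow_mul hα.le]; congr 1; ring
      have h7 := le_arcKernel (N := N) hq h ha t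
      have h8 := one_div_one_add_sq_le hN (t - a / q)
      have h9 := fejerPair_nonneg N (t - a / q)
      rw [h3]
      calc _ ≤ A ^ 2 * ((1 / q * α ^ (-10 * ε)) * (16 * fejerPair N (t - a / q))) := by gcongr
        _ = 16 * A ^ 2 * α ^ (-10 * ε) * (1 / q * fejerPair N (t - a / q)) := by ring
        _ ≤ _ := by gcongr
    have h3 : y ^ 2 * (K / α ^ 2) ≤ 16 * A ^ 2 * K * α ^ (-2 - 10 * ε) * arcKernel N Q t := by
      calc y ^ 2 * (K / α ^ 2) ≤ (16 * A ^ 2 * α ^ (-10 * ε) * arcKernel N Q t) * (K / α ^ 2) := by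
            gcongr
        _ = _ := by
            rw [show -2 - 10 * ε = -10 * ε + (-2 : ℝ) by ring, Real.rpow_add hα,
              Real.rpow_neg hα.le 2, Real.rpow_two]
            field_simp
    have h4 : α ^ 2 / (4 * K) ≤ 3 * α ^ 2 / (8 * K) := by
      rw [div_le_div_iff₀ (by positivity) (by positivity)]
      nlinarith [show 0 < α ^ 2 * K by positivity]
    linarith
  · have h1 : α ^ (-5 : ℝ) ≤ q := by
      have := Nat.lt_of_floor_lt (hQ ▸ h)
      exact this.le
    have h2 : (q : ℝ) ^ (-1 / 2 + ε) ≤ α ^ 2 * α ^ (1 / 4 : ℝ) := by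
      calc (q : ℝ) ^ (-1 / 2 + ε) ≤ (α ^ (-5 : ℝ)) ^ (-1 / 2 + ε) :=
            Real.rpow_le_rpow_of_nonpos (by positivity) h1 (by linarith)
        _ = α ^ (5 / 2 - 5 * ε) := by rw [← Real.rpow_mul hα.le]; congr 1; ring
        _ ≤ α ^ (2 + 1 / 4 : ℝ) := Real.rpow_le_rpow_of_exponent_ge hα hα1 (by linarith)
        _ = _ := by rw [Real.rpow_add hα, Real.rpow_two]
    have h3 : A * (q : ℝ) ^ (-1 / 2 + ε) / (1 + N * nnInt (t - a / q)) ≤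
        A * (q : ℝ) ^ (-1 / 2 + ε) := by
      refine div_le_self (by positivity) ?_
      have : 0 ≤ N * nnInt (t - a / q) := by positivity
      linarith
    have h4 : A * (q : ℝ) ^ (-1 / 2 + ε) ≤ α ^ 2 / (8 * K) := by
      calc A * (q : ℝ) ^ (-1 / 2 + ε) ≤ A * (α ^ 2 * α ^ (1 / 4 : ℝ)) := by gcongr
        _ = α ^ 2 * (A * α ^ (1 / 4 : ℝ)) := by ring
        _ ≤ α ^ 2 * (1 / (8 * K)) := by gcongr
        _ = _ := by ring
    have h5 : α ^ 2 / (8 * K) ≤ 3 * α ^ 2 / (8 * K) := by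
      gcongr
      nlinarith [sq_nonneg α]
    have : 0 ≤ 16 * A ^ 2 * K * α ^ (-2 - 10 * ε) * arcKernel N Q t := by positivity
    linarith

/-- The two terms quadratic in `v` are each at most `α ^ 4 * v ^ 2 / 4`: the first because `1/N ≤ α
^ 80`, the other because `T ^ (-B) ≤ α ^ 10`. The remaining term is linear in `v`, and dividing by
`v` gives the bound. -/
theorem le_of_level_inequality {ε α v N Q T C2 CB : ℝ} {B : ℕ} (hε1 : ε ≤ 1 / 20)
    (hB : 10 ≤ B * ε) (hα : 0 < α) (hα1' : α ≤ 1) (hN' : 0 < N) (hQ0 : 0 ≤ Q) (hv0 : 0 ≤ v)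
    (hC2pos : 0 < C2) (hCB1 : 1 ≤ CB) (hδB : α ^ (1 / 4 : ℝ) * (4 * C2 * CB) ≤ 1)
    (hNα : N⁻¹ ≤ α ^ (80 : ℝ)) (hQle : Q ≤ α ^ (-5 : ℝ)) (hT : T = α ^ (-ε))
    (h1 : α ^ 4 * v ^ 2 ≤ C2 * α ^ (-10 * ε) * (Q / N * v ^ 2 + T * v / N +
        CB * Q / T ^ B * v ^ 2)) :
    v ≤ 2 * C2 * α ^ (-(4 + 11 * ε)) / N := by
  have hT0 : 0 < T := by rw [hT]; positivity
  have hpow : α ^ (-10 * ε) ≤ α ^ (-1 / 2 : ℝ) :=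
    Real.rpow_le_rpow_of_exponent_ge hα hα1' (by linarith)
  have hx2 : α ^ (1 / 2 : ℝ) ≤ α ^ (1 / 4 : ℝ) :=
    Real.rpow_le_rpow_of_exponent_ge hα hα1' (by norm_num)
  have hα4 : α ^ 4 = α ^ (4 : ℝ) := by
    rw [← Real.rpow_natCast]; norm_num
  have hterm3 : C2 * α ^ (-10 * ε) * (CB * Q / T ^ B) ≤ α ^ 4 / 4 := by
    have h1 : (T ^ B)⁻¹ ≤ α ^ (10 : ℝ) := by
      rw [hT, ← Real.rpow_natCast, ← Real.rpow_mul hα.le, ← Real.rpow_neg hα.le]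
      refine Real.rpow_le_rpow_of_exponent_ge hα hα1' ?_
      linarith
    calc C2 * α ^ (-10 * ε) * (CB * Q / T ^ B)
        = C2 * CB * (α ^ (-10 * ε) * Q * (T ^ B)⁻¹) := by ring
      _ ≤ C2 * CB * (α ^ (-1 / 2 : ℝ) * α ^ (-5 : ℝ) * α ^ (10 : ℝ)) := by gcongr
      _ = C2 * CB * α ^ (1 / 2 : ℝ) * α ^ 4 := by
          rw [hα4, mul_assoc (C2 * CB), ← Real.rpow_add hα, ← Real.rpow_add hα, ← Real.rpow_add hα]
          norm_num
      _ ≤ C2 * CB * α ^ (1 / 4 : ℝ) * α ^ 4 := by gcongr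
      _ ≤ α ^ 4 / 4 := by
          have h2 : C2 * CB * α ^ (1 / 4 : ℝ) ≤ 1 / 4 := by linarith
          have : 0 ≤ α ^ 4 := by positivity
          nlinarith
  have hterm1 : C2 * α ^ (-10 * ε) * (Q / N) ≤ α ^ 4 / 4 := by
    calc C2 * α ^ (-10 * ε) * (Q / N)
        = C2 * (α ^ (-10 * ε) * Q * (N : ℝ)⁻¹) := by ring
      _ ≤ C2 * (α ^ (-1 / 2 : ℝ) * α ^ (-5 : ℝ) * α ^ (80 : ℝ)) := by gcongr
      _ = C2 * (α ^ (70 + 1 / 2 : ℝ) * α ^ 4) := by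
          rw [hα4, ← Real.rpow_add hα, ← Real.rpow_add hα, ← Real.rpow_add hα]
          norm_num
      _ ≤ C2 * (α ^ (1 / 2 : ℝ) * α ^ 4) := by
          gcongr C2 * (?_ * α ^ 4)
          exact Real.rpow_le_rpow_of_exponent_ge hα hα1' (by norm_num)
      _ ≤ C2 * (α ^ (1 / 4 : ℝ) * α ^ 4) := by gcongr
      _ ≤ α ^ 4 / 4 := by
          have h2 : C2 * α ^ (1 / 4 : ℝ) ≤ 1 / 4 := by
            have : C2 * α ^ (1 / 4 : ℝ) * 1 ≤ C2 * α ^ (1 / 4 : ℝ) * CB := by gcongr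
            linarith
          have : 0 ≤ α ^ 4 := by positivity
          nlinarith
  have hfinal : α ^ 4 * v ^ 2 / 2 ≤ C2 * α ^ (-10 * ε) * (T * v / N) := by
    have h2 := mul_le_mul_of_nonneg_right hterm1 (sq_nonneg v)
    have h3 := mul_le_mul_of_nonneg_right hterm3 (sq_nonneg v)
    nlinarith
  rcases hv0.eq_or_lt with h | hvpos
  · rw [← h]; positivity
  · have h1 : α ^ 4 * v / 2 ≤ C2 * (α ^ (-10 * ε) * T) / N := by
      have h2 : α ^ 4 * v ^ 2 / 2 = v * (α ^ 4 * v / 2) := by ring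
      have h3 : C2 * α ^ (-10 * ε) * (T * v / N) = v * (C2 * (α ^ (-10 * ε) * T) / N) := by ring
      rw [h2, h3] at hfinal
      exact le_of_mul_le_mul_left hfinal hvpos
    have h4 : α ^ (-(4 + 11 * ε)) = α ^ (-10 * ε) * T / α ^ 4 := by
      rw [hT, hα4, ← Real.rpow_add hα, ← Real.rpow_sub hα]; congr 1; ring
    rw [h4]
    rw [div_le_div_iff₀ two_pos hN'] at h1
    rw [mul_div_assoc', div_div, le_div_iff₀ (by positivity)]
    linarith

/-- If an exponential sum with nonnegative coefficients has a majorant which is small outside the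
major arcs, then its large values are rare. -/
theorem exists_measure_level_le {ε κ A : ℝ} (hε : 0 < ε) (hε1 : ε ≤ 1 / 20) (hκ : 0 < κ)
    (hκ1 : κ ≤ 1 / 10) (hA : 1 ≤ A) :
    ∃ α₁ C : ℝ, 0 < α₁ ∧ α₁ ≤ 1 ∧ 0 < C ∧ ∀ (s : Finset ℕ) (k : ℕ → ℤ) (c ν : ℕ → ℝ) (N : ℕ),
      0 < N → (∀ i ∈ s, 0 ≤ c i) → (∀ i ∈ s, c i ≤ ν i) →
      (∀ θ : ℝ, ∃ q a : ℕ, 1 ≤ q ∧ a < q ∧ ‖∑ i ∈ s, (ν i : ℂ) * e (k i * θ)‖ ≤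
        A * N * (q : ℝ) ^ (-1 / 2 + ε) / (1 + N * nnInt (θ - a / q)) + (N : ℝ) ^ (1 - κ)) →
      ∀ α : ℝ, (N : ℝ) ^ (-κ / 8) ≤ α → α ≤ α₁ → ∀ E : Set ℝ, MeasurableSet E →
        E ⊆ Set.Icc 0 1 → (∀ θ ∈ E, α * N ≤ ‖∑ i ∈ s, (c i : ℂ) * e (k i * θ)‖) →
        volume.real E ≤ C * α ^ (-(4 + 11 * ε)) / N := by
  -- With `T = α ^ (-ε)`, this makes `T ^ (-B) ≤ α ^ 10`, enough to beat `Q ≤ α ^ (-5)` and still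
  -- leave more than `α ^ 4`.
  obtain ⟨B, hB⟩ := exists_nat_ge (10 / ε)
  rw [div_le_iff₀ hε] at hB
  obtain ⟨CB, hCB1, hCB⟩ := exists_sum_indCoeff_smallDivisors_le B
  set K : ℝ := A + 1 with hK
  have hK1 : 1 ≤ K := by linarith
  set C2 : ℝ := 4 * K * (16 * A ^ 2 * K) with hC2
  have hC2pos : 0 < C2 := by positivity
  -- Chosen so that `α ≤ δ ^ 4` makes `α ^ (1/4)` absorb both `8 * K * A` and `4 * C2 * CB`.
  set δ : ℝ := 1 / (8 * K * A + 4 * C2 * CB) with hδ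
  have hδ0 : 0 < δ := by positivity
  have hδ1 : δ ≤ 1 := by
    rw [hδ, div_le_one (by positivity)]
    have : 0 < 4 * C2 * CB := by positivity
    nlinarith [mul_le_mul hK1 hA (by norm_num) (by linarith : (0 : ℝ) ≤ K)]
  refine ⟨δ ^ (4 : ℝ), 2 * C2, by positivity, Real.rpow_le_one hδ0.le hδ1 (by norm_num),
    by positivity, ?_⟩
  intro s k c ν N hN hc hcν hV α hα0 hα1 E hEm hE hS
  have hN' : (0 : ℝ) < N := by exact_mod_cast hN
  have hN1 : (1 : ℝ) ≤ N := by exact_mod_cast hN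
  have hα : 0 < α := lt_of_lt_of_le (by positivity) hα0
  have hα1' : α ≤ 1 := hα1.trans (Real.rpow_le_one hδ0.le hδ1 (by norm_num))
  have hx : α ^ (1 / 4 : ℝ) ≤ δ := by
    have := Real.rpow_le_rpow hα.le hα1 (by norm_num : (0 : ℝ) ≤ 1 / 4)
    rwa [← Real.rpow_mul hδ0.le, show (4 : ℝ) * (1 / 4) = 1 by norm_num, Real.rpow_one] at this
  have hδ' : δ * (8 * K * A + 4 * C2 * CB) = 1 := by
    rw [hδ]; exact one_div_mul_cancel (by positivity)
  have hδA : δ * (8 * K * A) ≤ 1 := by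
    have : 0 < δ * (4 * C2 * CB) := by positivity
    linarith
  have hδB : δ * (4 * C2 * CB) ≤ 1 := by
    have : 0 < δ * (8 * K * A) := by positivity
    linarith
  have hαA : A * α ^ (1 / 4 : ℝ) ≤ 1 / (8 * K) := by
    rw [le_div_iff₀ (by positivity)]
    calc A * α ^ (1 / 4 : ℝ) * (8 * K) ≤ A * δ * (8 * K) := by gcongr
      _ = δ * (8 * K * A) := by ring
      _ ≤ 1 := hδA
  have hNα : (N : ℝ)⁻¹ ≤ α ^ (80 : ℝ) := by
    calc (N : ℝ)⁻¹ = ((N : ℝ) ^ (-κ / 8)) ^ (8 / κ) := by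
          rw [← Real.rpow_mul hN'.le, ← Real.rpow_neg_one]; congr 1; field_simp
      _ ≤ α ^ (8 / κ) := Real.rpow_le_rpow (by positivity) hα0 (by positivity)
      _ ≤ α ^ (80 : ℝ) := Real.rpow_le_rpow_of_exponent_ge hα hα1' (by
          rw [le_div_iff₀ hκ]; linarith)
  -- The lower limit `N ^ (-κ/8)` for `α` serves to make the power saving at least `α ^ (-8)`, more
  -- than the `α ^ 2` required.
  have hNκ : (N : ℝ) ^ (1 - κ) ≤ N * (α ^ 2 / (8 * K)) := by
    rw [Real.rpow_sub hN', Real.rpow_one, div_eq_mul_inv, ← Real.rpow_neg hN'.le]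
    refine mul_le_mul_of_nonneg_left ?_ hN'.le
    calc (N : ℝ) ^ (-κ) = ((N : ℝ) ^ (-κ / 8)) ^ (8 : ℝ) := by
          rw [← Real.rpow_mul hN'.le]; congr 1; ring
      _ ≤ α ^ (8 : ℝ) := Real.rpow_le_rpow (by positivity) hα0 (by norm_num)
      _ ≤ α ^ (2 + 1 / 4 : ℝ) := Real.rpow_le_rpow_of_exponent_ge hα hα1' (by norm_num)
      _ = α ^ 2 * α ^ (1 / 4 : ℝ) := by rw [Real.rpow_add hα, Real.rpow_two]
      _ ≤ α ^ 2 * (1 / (8 * K)) := by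
          refine mul_le_mul_of_nonneg_left ?_ (by positivity)
          refine le_trans ?_ hαA
          exact le_mul_of_one_le_left (by positivity) hA
      _ = _ := by ring
  set Q : ℕ := ⌊α ^ (-5 : ℝ)⌋₊ with hQ
  have hQ1 : 1 ≤ Q := by
    rw [hQ, Nat.one_le_floor_iff]
    exact Real.one_le_rpow_of_pos_of_le_one_of_nonpos hα hα1' (by norm_num)
  have hQle : (Q : ℝ) ≤ α ^ (-5 : ℝ) := Nat.floor_le (by positivity)
  set C1 : ℝ := 16 * A ^ 2 * K with hC1
  have hVU : ∀ θ : ℝ, ‖∑ i ∈ s, (ν i : ℂ) * e (k i * θ)‖ ≤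
      N * (α ^ 2 / (2 * K)) + N * (C1 * α ^ (-2 - 10 * ε)) * arcKernel N Q θ := by
    intro θ
    obtain ⟨q, a, hq, ha, h⟩ := hV θ
    have h1 := le_of_major_arc_bound hε hε1 hA hK1 hα hα1' hαA hN hq ha hQ θ
    have h2 := mul_le_mul_of_nonneg_left h1 hN'.le
    have h3 : A * N * (q : ℝ) ^ (-1 / 2 + ε) / (1 + N * nnInt (θ - a / q)) =
      N * (A * (q : ℝ) ^ (-1 / 2 + ε) / (1 + N * nnInt (θ - a / q))) := by ring
    rw [h3] at h
    refine h.trans ((add_le_add h2 hNκ).trans (le_of_eq ?_))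
    field_simp
    ring
  -- The total mass is the transform of `ν` at 0, so the assumed bound already controls it.
  have hsum : ∑ i ∈ s, ν i ≤ K * N := by
    obtain ⟨q, a, hq, ha, h⟩ := hV 0
    have h0 : ∑ i ∈ s, (ν i : ℂ) * e (k i * 0) = ((∑ i ∈ s, ν i : ℝ) : ℂ) := by
      simp [e_zero]
    rw [h0, Complex.norm_real] at h
    refine (le_abs_self _).trans (h.trans ?_)
    have h1 : (q : ℝ) ^ (-1 / 2 + ε) ≤ 1 :=
      Real.rpow_le_one_of_one_le_of_nonpos (by exact_mod_cast hq) (by linarith)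
    have h2 : (N : ℝ) ^ (1 - κ) ≤ N := by
      conv_rhs => rw [← Real.rpow_one (N : ℝ)]
      exact Real.rpow_le_rpow_of_exponent_le hN1 (by linarith)
    have h3 : A * N * (q : ℝ) ^ (-1 / 2 + ε) / (1 + N * nnInt (0 - a / q)) ≤ A * N * 1 := by
      refine (div_le_self (by positivity) ?_).trans (by gcongr)
      have := nnInt_nonneg (0 - a / q)
      have : 0 ≤ N * nnInt (0 - a / q) := by positivity
      linarith
    rw [hK]; linarith
  set v := volume.real E with hv
  have hv0 : 0 ≤ v := measureReal_nonneg
  have hfin := isFiniteMeasure_restrict hE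
  set μ := (volume.restrict E).prod (volume.restrict E) with hμ
  have hμ1 : μ.real Set.univ = v ^ 2 := by
    rw [hμ, measureReal_def, ← Set.univ_prod_univ, Measure.prod_prod, Measure.restrict_apply_univ,
      ENNReal.toReal_mul, sq]
    rfl
  have hdual := sq_le_sum_mul_integral s k c ν hc hcν hEm hE (A := α * N) (by positivity) hS
  set I := ∫ z : ℝ × ℝ, arcKernel N Q (z.1 - z.2) ∂μ with hI
  have hcU : Continuous fun z : ℝ × ℝ => arcKernel N Q (z.1 - z.2) :=
    (continuous_arcKernel N Q).comp (by fun_prop)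
  have hI0 : 0 ≤ I := integral_nonneg fun z => arcKernel_nonneg _ _ _
  have hint : ∫ z : ℝ × ℝ, ‖∑ i ∈ s, (ν i : ℂ) * e (k i * (z.1 - z.2))‖ ∂μ ≤
      N * (α ^ 2 / (2 * K)) * v ^ 2 + N * (C1 * α ^ (-2 - 10 * ε)) * I := by
    have hcV : Continuous fun z : ℝ × ℝ => ∑ i ∈ s, (ν i : ℂ) * e (k i * (z.1 - z.2)) :=
      continuous_finsetSum _ fun i _ => continuous_const.mul (continuous_e.comp (by fun_prop))
    have h1 : ∫ z : ℝ × ℝ, ‖∑ i ∈ s, (ν i : ℂ) * e (k i * (z.1 - z.2))‖ ∂μ ≤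
        ∫ z : ℝ × ℝ, (N * (α ^ 2 / (2 * K)) +
          N * (C1 * α ^ (-2 - 10 * ε)) * arcKernel N Q (z.1 - z.2)) ∂μ :=
      integral_mono (integrable_prod_of_continuous_real hcV.norm hE)
        (integrable_prod_of_continuous_real (continuous_const.add (continuous_const.mul hcU)) hE)
        fun z => hVU _
    refine h1.trans (le_of_eq ?_)
    have hi : Integrable (fun z : ℝ × ℝ =>
        N * (C1 * α ^ (-2 - 10 * ε)) * arcKernel N Q (z.1 - z.2)) μ :=
      (integrable_prod_of_continuous_real hcU hE).const_mul _
    rw [integral_add (integrable_const _) hi, integral_const,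
      integral_const_mul, hμ1, smul_eq_mul]
    ring
  have hstep1 : (α * N * v) ^ 2 ≤ K * N * (N * (α ^ 2 / (2 * K)) * v ^ 2 +
      N * (C1 * α ^ (-2 - 10 * ε)) * I) :=
    hdual.trans (mul_le_mul hsum hint (integral_nonneg fun z => norm_nonneg _) (by positivity))
  -- The part of the kernel outside the arcs contributes `K * (α ^ 2 / (2 * K)) = α ^ 2 / 2` times
  -- `v ^ 2`, half of the left side.
  have hstep2 : α ^ 2 * v ^ 2 ≤ 2 * K * C1 * α ^ (-2 - 10 * ε) * I := by
    have h1 : K * N * (N * (α ^ 2 / (2 * K)) * v ^ 2 + N * (C1 * α ^ (-2 - 10 * ε)) * I) =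
        N ^ 2 * (α ^ 2 * v ^ 2 / 2 + K * C1 * α ^ (-2 - 10 * ε) * I) := by
      field_simp
    have h2 : (α * N * v) ^ 2 = N ^ 2 * (α ^ 2 * v ^ 2) := by ring
    rw [h1, h2] at hstep1
    have h3 := le_of_mul_le_mul_left hstep1 (by positivity)
    linarith
  have hstep3 : α ^ 4 * v ^ 2 ≤ 2 * K * C1 * α ^ (-10 * ε) * I := by
    have h1 := mul_le_mul_of_nonneg_left hstep2 (sq_nonneg α)
    have h2 : α ^ (-10 * ε) = α ^ 2 * α ^ (-2 - 10 * ε) := by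
      rw [← Real.rpow_two, ← Real.rpow_add hα]; congr 1; ring
    rw [h2]
    calc α ^ 4 * v ^ 2 = α ^ 2 * (α ^ 2 * v ^ 2) := by ring
      _ ≤ _ := h1
      _ = _ := by ring
  set T : ℝ := α ^ (-ε) with hT
  have hT0 : 0 < T := by positivity
  have hI1 := (integral_sum_fejerPair_le hE N Q).trans
    (mul_le_mul_of_nonneg_left (hCB hE N Q T hQ1 hT0) (by positivity))
  have hI2 : I ≤ 2 * (Q / N * v ^ 2 + T * v / N + CB * Q / T ^ B * v ^ 2) := by
    rw [← hv] at hI1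
    refine hI1.trans (le_of_eq ?_)
    field_simp
  refine le_of_level_inequality hε1 hB hα hα1' hN' (Nat.cast_nonneg Q) hv0 hC2pos hCB1 ?_ hNα hQle hT ?_
  · exact (mul_le_mul_of_nonneg_right hx (by positivity)).trans hδB
  · refine hstep3.trans ((mul_le_mul_of_nonneg_left hI2 (by positivity)).trans (le_of_eq ?_))
    rw [hC2]; ring

/-! ### From level sets to moments -/

/-- The layer-cake formula: the integrand becomes `A * t ^ (p - r - 1)`, integrable at 0 because `p
> r`, and there is nothing above `M`. -/
theorem integral_rpow_le_of_measure_lt_le {μ : Measure ℝ} [IsFiniteMeasure μ] {f : ℝ → ℝ}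
    (hf : Measurable f) (hf0 : ∀ x, 0 ≤ f x) {M p r A : ℝ} (hM : 0 < M) (hfM : ∀ x, f x ≤ M)
    (hr : 0 < r) (hrp : r < p) (hA : 0 ≤ A)
    (h : ∀ t, 0 < t → t < M → μ.real {x | t < f x} ≤ A * t ^ (-r)) :
    ∫ x, f x ^ p ∂μ ≤ p * (A * (M ^ (p - r) / (p - r))) := by
  have hp : 0 < p := hr.trans hrp
  have hint : IntegrableOn (fun t : ℝ => A * t ^ (p - r - 1)) (Set.Ioc 0 M) := by
    refine Integrable.const_mul ?_ A
    have := intervalIntegral.intervalIntegrable_rpow' (a := 0) (b := M) (r := p - r - 1)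
      (by linarith)
    rwa [intervalIntegrable_iff_integrableOn_Ioc_of_le hM.le] at this
  have hval : ∫ t in Set.Ioc 0 M, A * t ^ (p - r - 1) = A * (M ^ (p - r) / (p - r)) := by
    rw [integral_const_mul, ← intervalIntegral.integral_of_le hM.le,
      integral_rpow (Or.inl (by linarith))]
    rw [show p - r - 1 + 1 = p - r by ring, Real.zero_rpow (by linarith)]
    simp
  have hlayer := lintegral_rpow_eq_lintegral_meas_lt_mul μ (f := f)
    (Filter.Eventually.of_forall hf0) hf.aemeasurable hp
  have hb : ∫⁻ t in Set.Ioi (0 : ℝ), μ {a | t < f a} * ENNReal.ofReal (t ^ (p - 1)) ≤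
      ENNReal.ofReal (A * (M ^ (p - r) / (p - r))) := by
    rw [← hval, ofReal_integral_eq_lintegral_ofReal hint
      ((ae_restrict_mem measurableSet_Ioc).mono fun t ht => by
        have := ht.1; positivity)]
    rw [← lintegral_indicator measurableSet_Ioi, ← lintegral_indicator measurableSet_Ioc]
    refine lintegral_mono_ae ?_
    filter_upwards with t
    by_cases ht : t ∈ Set.Ioi (0 : ℝ)
    · rw [Set.indicator_of_mem ht]
      have ht0 : 0 < t := ht
      by_cases htM : t < M
      · rw [Set.indicator_of_mem (show t ∈ Set.Ioc 0 M from ⟨ht0, htM.le⟩)]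
        have h1 : μ {a | t < f a} ≤ ENNReal.ofReal (A * t ^ (-r)) := by
          rw [← ENNReal.ofReal_toReal (measure_ne_top μ {a | t < f a})]
          exact ENNReal.ofReal_le_ofReal (h t ht0 htM)
        refine (mul_le_mul_left h1 _).trans (le_of_eq ?_)
        rw [← ENNReal.ofReal_mul (by positivity)]
        congr 1
        rw [mul_assoc, ← Real.rpow_add ht0]
        congr 2
        ring
      · have h1 : {a | t < f a} = ∅ := by
          ext a
          simp only [Set.mem_ofPred_eq, Set.mem_empty_iff_false, iff_false, not_lt]
          exact (hfM a).trans (not_lt.mp htM)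
        rw [h1]; simp
    · rw [Set.indicator_of_notMem ht]; exact zero_le
  have h2 : ∫⁻ x, ENNReal.ofReal (f x ^ p) ∂μ ≤
      ENNReal.ofReal (p * (A * (M ^ (p - r) / (p - r)))) := by
    rw [hlayer, ENNReal.ofReal_mul hp.le]
    gcongr
  rw [integral_eq_lintegral_of_nonneg_ae
    (Filter.Eventually.of_forall fun x => Real.rpow_nonneg (hf0 x) p)
    (hf.pow_const p).aestronglyMeasurable]
  refine ENNReal.toReal_le_of_le_ofReal ?_ h2
  have : 0 < p - r := by linarith
  positivity

/-- Interpolation between a fourth moment bound for small values and weak-type bounds for large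
values. -/
theorem integral_rpow_le_of_level {f : ℝ → ℝ} (hf : Continuous f) (hf0 : ∀ x, 0 ≤ f x)
    {M p r C J α₀ α₁ : ℝ} (hM : 1 ≤ M) (hfM : ∀ x, f x ≤ M) (hr : 4 < r) (hrp : r < p)
    (hC : 0 ≤ C) (hα₀ : 0 < α₀) (h01 : α₀ ≤ α₁) (h1 : α₁ ≤ 1)
    (hJ : ∫ x in Set.Icc (0 : ℝ) 1, f x ^ 4 ≤ J)
    (h : ∀ α, α₀ ≤ α → α ≤ α₁ → volume.real {x ∈ Set.Icc (0 : ℝ) 1 | α ≤ f x} ≤ C * α ^ (-r)) :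
    ∫ x in Set.Icc (0 : ℝ) 1, f x ^ p ≤
      α₀ ^ (p - 4) * J + p * (C * (M / α₁) ^ r * (M ^ (p - r) / (p - r))) := by
  have hα₁ : 0 < α₁ := hα₀.trans_le h01
  set E : Set ℝ := {x ∈ Set.Icc (0 : ℝ) 1 | α₀ ≤ f x} with hE
  have hEm : MeasurableSet E := measurableSet_Icc.inter (measurableSet_le measurable_const hf.measurable)
  have hE1 : E ⊆ Set.Icc 0 1 := fun x hx => hx.1
  have hfin := isFiniteMeasure_restrict hE1
  have hcp : Continuous fun x => f x ^ p := hf.rpow_const fun x => Or.inr (by linarith)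
  have hvfin : ∀ α, volume {x ∈ Set.Icc (0 : ℝ) 1 | α ≤ f x} ≠ ⊤ := fun α =>
    (volume_lt_top_of_subset fun x hx => hx.1).ne
  have hlarge : ∫ x in E, f x ^ p ≤ p * (C * (M / α₁) ^ r * (M ^ (p - r) / (p - r))) := by
    refine integral_rpow_le_of_measure_lt_le hf.measurable hf0 (by linarith) hfM (by linarith) hrp
      (by positivity) fun t ht htM => ?_
    have hmeas : (volume.restrict E).real {x | t < f x} =
        volume.real ({x | t < f x} ∩ E) := by
      rw [measureReal_restrict_apply (measurableSet_lt measurable_const hf.measurable)]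
    rw [hmeas]
    -- The factor `(M / α₁) ^ r` extends the weak-type bound from `[α₀, α₁]` to all `0 < t < M`.
    -- Below `α₀` one uses that the integral is over `E`; above `α₁` the bound at `α₁` holds by
    -- monotonicity and `t < M` compensates.
    have hM1 : 1 ≤ (M / α₁) ^ r :=
      Real.one_le_rpow (by rw [one_le_div hα₁]; linarith) (by linarith)
    have key : ∀ α, α₀ ≤ α → α ≤ α₁ → ({x | t < f x} ∩ E ⊆ {x ∈ Set.Icc (0 : ℝ) 1 | α ≤ f x}) →
        α ^ (-r) ≤ (M / α₁) ^ r * t ^ (-r) →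
        volume.real ({x | t < f x} ∩ E) ≤ C * (M / α₁) ^ r * t ^ (-r) := by
      intro α ha0 ha1 hsub hle
      refine (measureReal_mono hsub (hvfin α)).trans ((h α ha0 ha1).trans ?_)
      rw [mul_assoc]
      exact mul_le_mul_of_nonneg_left hle hC
    rcases le_total t α₀ with h2 | h2
    · refine key α₀ le_rfl h01 (fun x hx => hx.2) ?_
      refine le_trans (Real.rpow_le_rpow_of_nonpos ht h2 (by linarith)) ?_
      exact le_mul_of_one_le_left (by positivity) hM1
    · rcases le_total t α₁ with h3 | h3
      · refine key t h2 h3 (fun x hx => ⟨hx.2.1, le_of_lt hx.1⟩) ?_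
        exact le_mul_of_one_le_left (by positivity) hM1
      · refine key α₁ h01 le_rfl (fun x hx => ⟨hx.2.1, h3.trans (le_of_lt hx.1)⟩) ?_
        rw [Real.div_rpow (by linarith) hα₁.le, Real.rpow_neg hα₁.le, div_eq_mul_inv,
          mul_comm (M ^ r), mul_assoc]
        refine le_mul_of_one_le_right (by positivity) ?_
        rw [Real.rpow_neg ht.le, ← div_eq_mul_inv, one_le_div (by positivity)]
        exact Real.rpow_le_rpow ht.le htM.le (by linarith)
  have hsmall : ∫ x in Set.Icc (0 : ℝ) 1 \ E, f x ^ p ≤ α₀ ^ (p - 4) * J := by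
    have h2 : ∫ x in Set.Icc (0 : ℝ) 1 \ E, f x ^ p ≤
        ∫ x in Set.Icc (0 : ℝ) 1 \ E, α₀ ^ (p - 4) * f x ^ 4 := by
      refine setIntegral_mono_on (integrable_of_continuous_real hcp Set.sdiff_subset)
        (integrable_of_continuous_real (by fun_prop) Set.sdiff_subset)
        (measurableSet_Icc.diff hEm) fun x hx => ?_
      have hxα : f x < α₀ := by
        by_contra hcon
        exact hx.2 ⟨hx.1, not_lt.mp hcon⟩
      rcases (hf0 x).eq_or_lt with h3 | h3
      · rw [← h3, Real.zero_rpow (by linarith)]; positivity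
      · have h4 : f x ^ p = f x ^ (p - 4) * f x ^ 4 := by
          rw [← Real.rpow_natCast, ← Real.rpow_add h3]; congr 1; push_cast; ring
        rw [h4]
        refine mul_le_mul_of_nonneg_right ?_ (by positivity)
        exact Real.rpow_le_rpow h3.le hxα.le (by linarith)
    refine h2.trans ?_
    rw [integral_const_mul]
    refine mul_le_mul_of_nonneg_left (le_trans ?_ hJ) (by positivity)
    exact setIntegral_mono_set (integrable_of_continuous_real (by fun_prop) subset_rfl)
      (Filter.Eventually.of_forall fun x => by positivity) Set.sdiff_subset.eventuallyLE
  have hsplit : ∫ x in Set.Icc (0 : ℝ) 1, f x ^ p =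
      (∫ x in Set.Icc (0 : ℝ) 1 \ E, f x ^ p) + ∫ x in E, f x ^ p := by
    rw [← setIntegral_union Set.disjoint_sdiff_left hEm
      (integrable_of_continuous_real hcp Set.sdiff_subset) (integrable_of_continuous_real hcp hE1),
      Set.sdiff_union_of_subset hE1]
  rw [hsplit]
  exact add_le_add hsmall hlarge

/-! ### The fourth moment -/

/-- The pairs `(x, y)` with `y ^ 2 = x ^ 2 + k` number at most the number of divisors of `k`. -/
theorem card_sq_sub_sq_le (s : Finset ℕ) {k : ℤ} (hk : k ≠ 0) :
    #((s ×ˢ s).filter fun p : ℕ × ℕ => (p.1 : ℤ) ^ 2 - (p.2 : ℤ) ^ 2 = k) ≤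
      #k.natAbs.divisors := by
  have hfac : ∀ p : ℕ × ℕ, (p.1 : ℤ) ^ 2 - (p.2 : ℤ) ^ 2 = ((p.1 : ℤ) - p.2) * (p.1 + p.2) :=
    fun p => by ring
  have hsub : ∀ p ∈ (s ×ˢ s).filter fun p : ℕ × ℕ => (p.1 : ℤ) ^ 2 - (p.2 : ℤ) ^ 2 = k,
      p.1 + p.2 ∈ k.natAbs.divisors := by
    intro p hp
    rw [mem_filter, hfac] at hp
    rw [Nat.mem_divisors]
    refine ⟨?_, by simpa using hk⟩
    rw [← Int.natCast_dvd_natCast, Int.dvd_natAbs]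
    exact ⟨(p.1 : ℤ) - p.2, by rw [← hp.2]; push_cast; ring⟩
  -- The sum determines the difference, since their product is `k ≠ 0`.
  have hinj : Set.InjOn (fun p : ℕ × ℕ => p.1 + p.2)
      ((s ×ˢ s).filter fun p : ℕ × ℕ => (p.1 : ℤ) ^ 2 - (p.2 : ℤ) ^ 2 = k : Finset (ℕ × ℕ)) := by
    intro p hp p' hp' heq
    have h1 := (mem_filter.mp hp).2
    have h2 := (mem_filter.mp hp').2
    rw [hfac] at h1 h2
    simp only at heq
    have h3 : (p.1 : ℤ) + p.2 = p'.1 + p'.2 := by exact_mod_cast heq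
    have h4 : (p.1 : ℤ) + p.2 ≠ 0 := by
      intro h; rw [h, mul_zero] at h1; exact hk h1.symm
    rw [← h3, ← h1] at h2
    have h5 := mul_right_cancel₀ h4 h2
    ext <;> omega
  exact card_le_card_of_injOn _ hsub hinj

theorem norm_sum_sum_ite_le {ι : Type*} (s : Finset ι) (b : ι → ℂ) (k : ι → ℤ) {M : ℝ}
    (hM : 0 ≤ M) (hb : ∀ i ∈ s, ‖b i‖ ≤ M) :
    ‖∑ i ∈ s, ∑ j ∈ s, if k i = k j then b i * (starRingEnd ℂ) (b j) else 0‖ ≤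
      M ^ 2 * ∑ i ∈ s, (#(s.filter fun j => k i = k j) : ℝ) := by
  rw [mul_sum]
  refine norm_sum_le_of_le _ fun i hi => ?_
  rw [← sum_filter]
  refine (norm_sum_le_of_le (n := fun _ => M ^ 2) _ fun j hj => ?_).trans ?_
  · rw [norm_mul, RCLike.norm_conj, sq]
    exact mul_le_mul (hb i hi) (hb j (mem_filter.mp hj).1) (norm_nonneg _) hM
  · rw [sum_const, nsmul_eq_mul, mul_comm]

/-- The fourth moment of an exponential sum over squares. -/
theorem exists_fourth_moment_le (ε : ℝ) (hε : 0 < ε) : ∃ C : ℝ, 1 ≤ C ∧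
    ∀ (M W : ℕ) (b : ℤ) (s : Finset ℕ) (k : ℕ → ℤ) (c : ℕ → ℝ) (A : ℝ), 1 ≤ M → 0 < W →
      s ⊆ Icc 1 M → (∀ x ∈ s, W * k x + b = (x : ℤ) ^ 2) → (∀ x ∈ s, 0 ≤ c x) →
      (∀ x ∈ s, c x ≤ A) →
      ∫ θ in Set.Icc (0 : ℝ) 1, ‖∑ x ∈ s, (c x : ℂ) * e (k x * θ)‖ ^ 4 ≤
        C * A ^ 4 * (M : ℝ) ^ (2 + ε) := by
  obtain ⟨C, hC1, hC⟩ := exists_card_divisors_le (ε / 2) (by positivity)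
  refine ⟨1 + C, by linarith, fun M W b s k c A hM hW hs hk hc hcA => ?_⟩
  have hM' : (1 : ℝ) ≤ M := by exact_mod_cast hM
  rcases s.eq_empty_or_nonempty with rfl | ⟨x₀, hx₀⟩
  · have : 0 ≤ A ^ 4 := by positivity
    simpa using (by positivity : 0 ≤ (1 + C) * A ^ 4 * (M : ℝ) ^ (2 + ε))
  have hA0 : 0 ≤ A := (hc x₀ hx₀).trans (hcA x₀ hx₀)
  have hscard : (#s : ℝ) ≤ M := by
    have := card_le_card hs
    simp only [Nat.card_Icc, Nat.add_sub_cancel] at this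
    exact_mod_cast this
  -- Writing the fourth power as the square of `S * conj S` produces differences of frequencies, so
  -- that the resulting equation fixes `x² - y²`, which factors.
  have hsq : ∀ θ : ℝ, ‖∑ x ∈ s, (c x : ℂ) * e (k x * θ)‖ ^ 4 =
      ‖∑ p ∈ s ×ˢ s, ((c p.1 : ℂ) * c p.2) * e (((k p.1 - k p.2 : ℤ) : ℝ) * θ)‖ ^ 2 := by
    intro θ
    have h1 : (∑ x ∈ s, (c x : ℂ) * e (k x * θ)) *
        (starRingEnd ℂ) (∑ x ∈ s, (c x : ℂ) * e (k x * θ)) =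
        ∑ p ∈ s ×ˢ s, ((c p.1 : ℂ) * c p.2) * e (((k p.1 - k p.2 : ℤ) : ℝ) * θ) := by
      rw [map_sum, sum_mul_sum, sum_product]
      refine sum_congr rfl fun x _ => sum_congr rfl fun y _ => ?_
      rw [map_mul, conj_e, Complex.conj_ofReal]
      push_cast
      rw [sub_mul, sub_eq_add_neg, e_add]; ring
    rw [← h1, norm_mul, RCLike.norm_conj]; ring
  simp only [hsq]
  have hpars := integral_norm_sq_sum_e (s ×ˢ s) (fun p : ℕ × ℕ => (c p.1 : ℂ) * c p.2)
    (fun p => k p.1 - k p.2)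
  have hkk : ∀ x ∈ s, ∀ y ∈ s, (W : ℤ) * (k x - k y) = (x : ℤ) ^ 2 - (y : ℤ) ^ 2 := by
    intro x hx y hy
    rw [← hk x hx, ← hk y hy]; ring
  have hW' : (W : ℤ) ≠ 0 := by exact_mod_cast hW.ne'
  -- A diagonal pair is matched only by diagonal pairs, at most `M` of them. There are only `#s`
  -- diagonal pairs, so both kinds contribute about `M ^ 2` in total.
  have hcount : ∀ p ∈ s ×ˢ s, (#((s ×ˢ s).filter fun p' : ℕ × ℕ =>
      k p.1 - k p.2 = k p'.1 - k p'.2) : ℝ) ≤ (if p.1 = p.2 then (M : ℝ) else 0) +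
        C * (M : ℝ) ^ ε := by
    intro p hp
    have hp1 := (mem_product.mp hp).1
    have hp2 := (mem_product.mp hp).2
    split_ifs with h
    · have h1 : #((s ×ˢ s).filter fun p' : ℕ × ℕ => k p.1 - k p.2 = k p'.1 - k p'.2) ≤ #s := by
        refine card_le_card_of_injOn Prod.fst (fun p' hp' => ?_) ?_
        · exact (mem_product.mp (mem_filter.mp hp').1).1
        · have h2 : ∀ p' ∈ (s ×ˢ s).filter fun p' : ℕ × ℕ => k p.1 - k p.2 = k p'.1 - k p'.2,
              p'.1 = p'.2 := by
            intro p' hp'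
            rw [mem_filter, mem_product] at hp'
            have h3 := hkk _ hp'.1.1 _ hp'.1.2
            rw [← hp'.2, h, sub_self, mul_zero] at h3
            have h4 : (p'.1 : ℤ) ^ 2 = (p'.2 : ℤ) ^ 2 := by linarith
            have h5 : p'.1 ^ 2 = p'.2 ^ 2 := by exact_mod_cast h4
            exact Nat.pow_left_injective two_ne_zero h5
          intro p' hp' p'' hp'' heq
          have h5 := h2 p' hp'
          have h6 := h2 p'' hp''
          ext
          · exact heq
          · rw [← h5, ← h6]; exact heq
      have : 0 ≤ C * (M : ℝ) ^ ε := by positivity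
      have h7 : (#((s ×ˢ s).filter fun p' : ℕ × ℕ => k p.1 - k p.2 = k p'.1 - k p'.2) : ℝ) ≤ #s := by
        exact_mod_cast h1
      linarith
    · have hx1 := mem_Icc.mp (hs hp1)
      have hx2 := mem_Icc.mp (hs hp2)
      set l : ℤ := (p.1 : ℤ) ^ 2 - (p.2 : ℤ) ^ 2 with hl
      have hl0 : l ≠ 0 := by
        intro h0
        have h4 : (p.1 : ℤ) ^ 2 = (p.2 : ℤ) ^ 2 := by linarith
        have h5 : p.1 ^ 2 = p.2 ^ 2 := by exact_mod_cast h4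
        exact h (Nat.pow_left_injective two_ne_zero h5)
      have hlM : l.natAbs ≤ M ^ 2 := by
        have h1 : (p.1 : ℤ) ^ 2 ≤ (M : ℤ) ^ 2 :=
          pow_le_pow_left₀ (by positivity) (by exact_mod_cast hx1.2) 2
        have h2 : (p.2 : ℤ) ^ 2 ≤ (M : ℤ) ^ 2 :=
          pow_le_pow_left₀ (by positivity) (by exact_mod_cast hx2.2) 2
        have h3 : 0 ≤ (p.1 : ℤ) ^ 2 := by positivity
        have h4 : 0 ≤ (p.2 : ℤ) ^ 2 := by positivity
        have h5 : ((M ^ 2 : ℕ) : ℤ) = (M : ℤ) ^ 2 := by push_cast; rfl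
        omega
      have hsub : ((s ×ˢ s).filter fun p' : ℕ × ℕ => k p.1 - k p.2 = k p'.1 - k p'.2) ⊆
          (s ×ˢ s).filter fun p' : ℕ × ℕ => (p'.1 : ℤ) ^ 2 - (p'.2 : ℤ) ^ 2 = l := by
        intro p' hp'
        rw [mem_filter] at hp' ⊢
        refine ⟨hp'.1, ?_⟩
        have hp'1 := mem_product.mp hp'.1
        rw [← hkk _ hp'1.1 _ hp'1.2, ← hp'.2, hkk _ hp1 _ hp2]
      have h1 := (card_le_card hsub).trans (card_sq_sub_sq_le s hl0)
      have h2 := hC l.natAbs (by simpa using hl0)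
      have h3 : ((l.natAbs : ℝ)) ^ (ε / 2) ≤ (M : ℝ) ^ ε := by
        calc ((l.natAbs : ℝ)) ^ (ε / 2) ≤ ((M : ℝ) ^ (2 : ℝ)) ^ (ε / 2) := by
              refine Real.rpow_le_rpow (by positivity) ?_ (by positivity)
              rw [Real.rpow_two]; exact_mod_cast hlM
          _ = (M : ℝ) ^ ε := by rw [← Real.rpow_mul (by positivity)]; congr 1; ring
      rw [zero_add]
      calc _ ≤ (#l.natAbs.divisors : ℝ) := by exact_mod_cast h1
        _ ≤ C * (l.natAbs : ℝ) ^ (ε / 2) := h2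
        _ ≤ _ := by gcongr
  have hnorm := norm_sum_sum_ite_le (s ×ˢ s) (fun p : ℕ × ℕ => (c p.1 : ℂ) * c p.2)
    (fun p => k p.1 - k p.2) (M := A * A) (by positivity) (fun p hp => by
      have hp1 := (mem_product.mp hp).1
      have hp2 := (mem_product.mp hp).2
      rw [norm_mul, Complex.norm_real, Complex.norm_real, Real.norm_of_nonneg (hc _ hp1),
        Real.norm_of_nonneg (hc _ hp2)]
      exact mul_le_mul (hcA _ hp1) (hcA _ hp2) (hc _ hp2) hA0)
  rw [← hpars, Complex.norm_real] at hnorm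
  refine (le_abs_self _).trans (hnorm.trans ?_)
  have hsum : ∑ p ∈ s ×ˢ s, (#((s ×ˢ s).filter fun p' : ℕ × ℕ =>
      k p.1 - k p.2 = k p'.1 - k p'.2) : ℝ) ≤ (1 + C) * (M : ℝ) ^ (2 + ε) := by
    refine (sum_le_sum hcount).trans ?_
    rw [sum_add_distrib, sum_const, card_product, nsmul_eq_mul]
    have h1 : ∑ p ∈ s ×ˢ s, (if p.1 = p.2 then (M : ℝ) else 0) = #s * M := by
      rw [sum_product]
      have : ∀ x ∈ s, ∑ y ∈ s, (if x = y then (M : ℝ) else 0) = M := by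
        intro x hx
        rw [sum_ite_eq, if_pos hx]
      simp only
      rw [sum_congr rfl this]; simp
    rw [h1]
    push_cast
    have h2 : 1 ≤ (M : ℝ) ^ ε := Real.one_le_rpow hM' hε.le
    rw [Real.rpow_add (by positivity), Real.rpow_two]
    have h3 : (#s : ℝ) * #s ≤ M ^ 2 := by
      rw [sq]; exact mul_le_mul hscard hscard (by positivity) (by positivity)
    have h4 : (#s : ℝ) * M ≤ M ^ 2 * (M : ℝ) ^ ε := by
      rw [sq]
      calc (#s : ℝ) * M ≤ M * M := by gcongr
        _ ≤ M * M * (M : ℝ) ^ ε := le_mul_of_one_le_right (by positivity) h2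
    have h5 : (#s : ℝ) * #s * (C * (M : ℝ) ^ ε) ≤ M ^ 2 * (C * (M : ℝ) ^ ε) := by gcongr
    linarith
  calc (A * A) ^ 2 * _ ≤ (A * A) ^ 2 * ((1 + C) * (M : ℝ) ^ (2 + ε)) := by gcongr
    _ = _ := by ring

/-! ### Selberg's weights -/

/-- A reparametrisation device: choosing a preimage under `g` for every index is automatically
injective, so unneeded parameters can be dropped by positivity. -/
theorem sum_le_sum_of_surj {α β : Type*} [DecidableEq β] [Nonempty β] {s : Finset α} {t : Finset β} (f : α → ℝ)
    (F : β → ℝ) (g : β → α) (hF : ∀ b ∈ t, 0 ≤ F b)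
    (h : ∀ a ∈ s, ∃ b ∈ t, g b = a ∧ f a ≤ F b) : ∑ a ∈ s, f a ≤ ∑ b ∈ t, F b := by
  choose! i hit hgi hfi using h
  calc ∑ a ∈ s, f a ≤ ∑ a ∈ s, F (i a) := sum_le_sum hfi
    _ = ∑ b ∈ s.image i, F b := by
        rw [sum_image]
        intro a ha a' ha' haa
        rw [← hgi a ha, ← hgi a' ha', haa]
    _ ≤ ∑ b ∈ t, F b := by
        refine sum_le_sum_of_subset_of_nonneg (fun b hb => ?_) fun b hb _ => hF b hb
        obtain ⟨a, ha, rfl⟩ := mem_image.mp hb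
        exact hit a ha

/-- The squarefree integers up to `D` which are coprime to `W`. -/
def sieveSupport (W D : ℕ) : Finset ℕ := (Icc 1 D).filter fun m => Squarefree m ∧ m.Coprime W

/-- The Selberg sum `∑ 1 / φ(m)` over the support of the sieve. -/
noncomputable def sieveTotal (W D : ℕ) : ℝ := ∑ m ∈ sieveSupport W D, (1 / m.totient : ℝ)

theorem totient_cast_of_squarefree {m : ℕ} (hm : Squarefree m) :
    (m.totient : ℝ) = ∏ p ∈ m.primeFactors, ((p : ℝ) - 1) := by
  have h1 := Nat.totient_mul_prod_primeFactors m
  rw [Nat.prod_primeFactors_of_squarefree hm, mul_comm] at h1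
  have h2 := Nat.eq_of_mul_eq_mul_left (Nat.pos_of_ne_zero hm.ne_zero) h1
  rw [h2]
  push_cast
  refine prod_congr rfl fun p hp => ?_
  rw [Nat.cast_sub (Nat.prime_of_mem_primeFactors hp).one_le]
  simp

/-- Expand the Euler product of `1 + 1/(p - 1)` over the primes dividing `W`. -/
theorem div_totient_eq_sum {W : ℕ} (hW : W ≠ 0) :
    (W : ℝ) / W.totient = ∑ T ∈ W.primeFactors.powerset, ∏ p ∈ T, (1 / ((p : ℝ) - 1)) := by
  have h1 := Nat.totient_mul_prod_primeFactors W
  have hpos : ∀ p ∈ W.primeFactors, 0 < (p : ℝ) - 1 := fun p hp => by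
    have : (1 : ℝ) < p := by exact_mod_cast (Nat.prime_of_mem_primeFactors hp).one_lt
    linarith
  have h2 : (W.totient : ℝ) * ∏ p ∈ W.primeFactors, (p : ℝ) =
      W * ∏ p ∈ W.primeFactors, ((p : ℝ) - 1) := by
    have h3 : ∏ p ∈ W.primeFactors, ((p : ℝ) - 1) = ((∏ p ∈ W.primeFactors, (p - 1) : ℕ) : ℝ) := by
      push_cast
      refine prod_congr rfl fun p hp => ?_
      rw [Nat.cast_sub (Nat.prime_of_mem_primeFactors hp).one_le]
      simp
    rw [h3, ← Nat.cast_prod, ← Nat.cast_mul, ← Nat.cast_mul, h1]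
  have hφ : (0 : ℝ) < W.totient := by
    exact_mod_cast Nat.totient_pos.mpr (Nat.pos_of_ne_zero hW)
  have hprod : 0 < ∏ p ∈ W.primeFactors, ((p : ℝ) - 1) := prod_pos hpos
  rw [← prod_add_one]
  have h4 : ∏ p ∈ W.primeFactors, (1 / ((p : ℝ) - 1) + 1) =
      (∏ p ∈ W.primeFactors, (p : ℝ)) / ∏ p ∈ W.primeFactors, ((p : ℝ) - 1) := by
    rw [← prod_div_distrib]
    refine prod_congr rfl fun p hp => ?_
    have := (hpos p hp).ne'
    field_simp
    ring
  rw [h4, div_eq_div_iff hφ.ne' hprod.ne']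
  linarith

theorem sum_one_div_sq_le (n : ℕ) : ∑ b ∈ Icc 1 n, (1 / (b : ℝ) ^ 2) ≤ 2 := by
  have h : ∀ n : ℕ, ∑ b ∈ Icc 1 (n + 1), (1 / (b : ℝ) ^ 2) ≤ 2 - 1 / ((n : ℝ) + 1) := by
    intro n
    induction n with
    | zero => norm_num
    | succ n ih =>
      rw [sum_Icc_succ_top (by omega)]
      have h1 : (1 : ℝ) / ((n + 1 + 1 : ℕ) : ℝ) ^ 2 ≤ 1 / (n + 1) - 1 / (n + 1 + 1) := by
        push_cast
        rw [div_sub_div _ _ (by positivity) (by positivity),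
          div_le_div_iff₀ (by positivity) (by positivity)]
        nlinarith [show (0 : ℝ) ≤ n by positivity]
      push_cast at h1 ⊢
      linarith
  rcases n with _ | n
  · simp
  · have := h n
    have h2 : (0 : ℝ) ≤ 1 / ((n : ℝ) + 1) := by positivity
    linarith

/-- The lower bound for the Selberg sum. -/
theorem log_le_mul_sieveTotal {W : ℕ} (hW : W ≠ 0) (D : ℕ) :
    Real.log (D + 1) ≤ 2 * ((W : ℝ) / W.totient * sieveTotal W D) := by
  have h1 : Real.log (D + 1) ≤ ∑ n ∈ Icc 1 D, (1 / n : ℝ) := by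
    have := log_add_one_le_harmonic D
    rw [harmonic_eq_sum_Icc] at this
    push_cast at this
    simpa using this
  -- Write `n = b² m` with `m` squarefree; the square part costs `∑ 1/b² ≤ 2`.
  have h2 : ∑ n ∈ Icc 1 D, (1 / n : ℝ) ≤
      ∑ p ∈ ((Icc 1 D).filter Squarefree) ×ˢ Icc 1 D, (1 / p.1 : ℝ) * (1 / (p.2 : ℝ) ^ 2) := by
    refine sum_le_sum_of_surj _ _ (fun p : ℕ × ℕ => p.2 ^ 2 * p.1) (fun p _ => by positivity)
      fun n hn => ?_
    rw [mem_Icc] at hn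
    obtain ⟨a, b, ha, hb, hab, hsq⟩ := Nat.sq_mul_squarefree_of_pos (n := n) (by omega)
    have hb2 : b ≤ b ^ 2 := Nat.le_self_pow two_ne_zero b
    have h3 : b ^ 2 ≤ n := by rw [← hab]; exact Nat.le_mul_of_pos_right _ ha
    have h4 : a ≤ n := by rw [← hab]; exact Nat.le_mul_of_pos_left _ (by positivity)
    refine ⟨(a, b), ?_, hab, ?_⟩
    · simp only [mem_product, mem_filter, mem_Icc]
      exact ⟨⟨⟨ha, h4.trans hn.2⟩, hsq⟩, hb, by omega⟩
    · rw [← hab]; push_cast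
      rw [one_div_mul_one_div, mul_comm]
  have h3 : ∑ p ∈ ((Icc 1 D).filter Squarefree) ×ˢ Icc 1 D, (1 / p.1 : ℝ) * (1 / (p.2 : ℝ) ^ 2) ≤
      (∑ m ∈ (Icc 1 D).filter Squarefree, (1 / m.totient : ℝ)) * 2 := by
    rw [sum_product]
    simp only
    rw [← sum_mul_sum]
    refine mul_le_mul (sum_le_sum fun m hm => ?_) (sum_one_div_sq_le D)
      (sum_nonneg fun _ _ => by positivity) (sum_nonneg fun _ _ => by positivity)
    rw [mem_filter, mem_Icc] at hm
    have hφ : 0 < m.totient := Nat.totient_pos.mpr hm.1.1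
    exact one_div_le_one_div_of_le (by exact_mod_cast hφ) (by exact_mod_cast m.totient_le)
  -- Split `m` into its gcd with `W` and a cofactor coprime to `W`. The gcd is recorded by its set
  -- of primes, and the sum over these sets is `W / φ(W)`.
  have h4 : ∑ m ∈ (Icc 1 D).filter Squarefree, (1 / m.totient : ℝ) ≤
      ∑ p ∈ W.primeFactors.powerset ×ˢ sieveSupport W D,
        (∏ l ∈ p.1, (1 / ((l : ℝ) - 1))) * (1 / p.2.totient : ℝ) := by
    refine sum_le_sum_of_surj _ _ (fun p : Finset ℕ × ℕ => (∏ l ∈ p.1, l) * p.2)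
      (fun p hp => mul_nonneg (prod_nonneg fun l hl => ?_) (by positivity)) fun m hm => ?_
    · have h5 := mem_powerset.mp (mem_product.mp hp).1 hl
      have : (1 : ℝ) < l := by exact_mod_cast (Nat.prime_of_mem_primeFactors h5).one_lt
      have : 0 < (l : ℝ) - 1 := by linarith
      positivity
    · rw [mem_filter, mem_Icc] at hm
      obtain ⟨⟨hm1, hmD⟩, hsq⟩ := hm
      set g := Nat.gcd m W with hg
      obtain ⟨m', hm'⟩ : g ∣ m := Nat.gcd_dvd_left m W
      have hsq' : Squarefree (g * m') := hm' ▸ hsq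
      have hcop : Nat.Coprime g m' := Nat.coprime_of_squarefree_mul hsq'
      have hgsq : Squarefree g := hsq'.of_mul_left
      have hm0 : 0 < m' := Nat.pos_of_ne_zero hsq'.of_mul_right.ne_zero
      have hg0 : 0 < g := Nat.pos_of_ne_zero hgsq.ne_zero
      refine ⟨(g.primeFactors, m'), ?_, ?_, ?_⟩
      · simp only [mem_product, mem_powerset, sieveSupport, mem_filter, mem_Icc]
        refine ⟨Nat.primeFactors_mono (Nat.gcd_dvd_right m W) hW, ⟨hm0, ?_⟩,
          hsq'.of_mul_right, ?_⟩
        · refine le_trans ?_ hmD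
          rw [hm']; exact Nat.le_mul_of_pos_left _ hg0
        · rw [Nat.coprime_iff_gcd_eq_one]
          set r := Nat.gcd m' W
          have hr1 : r ∣ g := Nat.dvd_gcd
            ((Nat.gcd_dvd_left m' W).trans (hm' ▸ Dvd.intro_left g rfl)) (Nat.gcd_dvd_right m' W)
          exact Nat.eq_one_of_dvd_coprimes hcop hr1 (Nat.gcd_dvd_left m' W)
      · simp only
        rw [Nat.prod_primeFactors_of_squarefree hgsq, ← hm']
      · simp only
        rw [hm', Nat.totient_mul hcop, Nat.cast_mul, totient_cast_of_squarefree hgsq,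
          prod_div_distrib, prod_const_one, one_div_mul_one_div]
  have h5 : ∑ p ∈ W.primeFactors.powerset ×ˢ sieveSupport W D,
        (∏ l ∈ p.1, (1 / ((l : ℝ) - 1))) * (1 / p.2.totient : ℝ) =
      (W : ℝ) / W.totient * sieveTotal W D := by
    rw [div_totient_eq_sum hW, sieveTotal, sum_mul_sum, sum_product]
  linarith

/-- Selberg's sieve weights. -/
noncomputable def sieveWeight (W D d : ℕ) : ℝ :=
  (ArithmeticFunction.moebius d : ℝ) * (d / sieveTotal W D) *
    ∑ m ∈ (sieveSupport W D).filter fun m => d ∣ m, (1 / m.totient : ℝ)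

theorem sieveTotal_pos {W D : ℕ} (hD : 1 ≤ D) : 0 < sieveTotal W D := by
  refine sum_pos (fun m hm => ?_) ⟨1, ?_⟩
  · have : 0 < m.totient := Nat.totient_pos.mpr (mem_Icc.mp (mem_filter.mp hm).1).1
    positivity
  · simp [sieveSupport, hD]

theorem sieveWeight_one {W D : ℕ} (hD : 1 ≤ D) : sieveWeight W D 1 = 1 := by
  have := (sieveTotal_pos (W := W) hD).ne'
  simp only [sieveWeight, ArithmeticFunction.moebius_apply_one, one_dvd, filter_true]
  rw [← sieveTotal]
  field_simp
  simp

theorem mem_sieveSupport_of_dvd {W D d m : ℕ} (hm : m ∈ sieveSupport W D) (hd : d ∣ m) :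
    d ∈ sieveSupport W D := by
  simp only [sieveSupport, mem_filter, mem_Icc] at hm ⊢
  have h0 : 0 < d := Nat.pos_of_dvd_of_pos hd hm.1.1
  exact ⟨⟨h0, (Nat.le_of_dvd hm.1.1 hd).trans hm.1.2⟩, hm.2.1.squarefree_of_dvd hd,
    hm.2.2.coprime_dvd_left hd⟩

theorem sieveWeight_eq_zero {W D d : ℕ} (hd : d ∉ sieveSupport W D) : sieveWeight W D d = 0 := by
  rw [sieveWeight, sum_eq_zero, mul_zero]
  intro m hm
  rw [mem_filter] at hm
  exact absurd (mem_sieveSupport_of_dvd hm.1 hm.2) hd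

theorem abs_moebius_cast_le (d : ℕ) : |(ArithmeticFunction.moebius d : ℝ)| ≤ 1 := by
  exact_mod_cast ArithmeticFunction.abs_moebius_le_one (n := d)

/-- Cruder than the classical bound by 1, but it is used only in error terms, where powers of `D`
are cheap. -/
theorem abs_sieveWeight_le {W D : ℕ} (hD : 1 ≤ D) (d : ℕ) : |sieveWeight W D d| ≤ d := by
  have hG := sieveTotal_pos (W := W) hD
  have h1 : ∑ m ∈ (sieveSupport W D).filter fun m => d ∣ m, (1 / m.totient : ℝ) ≤
      sieveTotal W D :=
    sum_le_sum_of_subset_of_nonneg (filter_subset _ _) fun _ _ _ => by positivity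
  have h0 : 0 ≤ ∑ m ∈ (sieveSupport W D).filter fun m => d ∣ m, (1 / m.totient : ℝ) :=
    sum_nonneg fun _ _ => by positivity
  rw [sieveWeight, abs_mul, abs_mul, abs_of_nonneg h0,
    abs_of_nonneg (show 0 ≤ (d : ℝ) / sieveTotal W D by positivity)]
  calc _ ≤ 1 * (d / sieveTotal W D) * sieveTotal W D := by
        gcongr
        exact abs_moebius_cast_le d
    _ = d := by field_simp

/-! ### Selberg's quadratic form in arithmetic progressions -/

/-- With `m = g * l`, the sum is `μ(g)` times the full Möbius sum over the divisors of `l`. -/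
theorem sum_moebius_multiples {m g : ℕ} (hm : Squarefree m) (hg : g ∣ m) :
    |∑ f ∈ m.divisors.filter fun f => g ∣ f, ArithmeticFunction.moebius f| ≤
      if g = m then 1 else 0 := by
  obtain ⟨l, rfl⟩ := hg
  have hg0 : g ≠ 0 := left_ne_zero_of_mul hm.ne_zero
  have hl0 : l ≠ 0 := right_ne_zero_of_mul hm.ne_zero
  have hcop : Nat.Coprime g l := Nat.coprime_of_squarefree_mul hm
  have himg : (g * l).divisors.filter (fun f => g ∣ f) = l.divisors.image fun f => g * f := by
    ext f
    simp only [mem_filter, Nat.mem_divisors, mem_image]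
    constructor
    · rintro ⟨⟨h1, _⟩, f', rfl⟩
      exact ⟨f', ⟨Nat.dvd_of_mul_dvd_mul_left (Nat.pos_of_ne_zero hg0) h1, hl0⟩, rfl⟩
    · rintro ⟨f', ⟨h1, _⟩, rfl⟩
      exact ⟨⟨mul_dvd_mul_left g h1, hm.ne_zero⟩, dvd_mul_right _ _⟩
  rw [himg, sum_image (fun a _ b _ h => Nat.eq_of_mul_eq_mul_left (Nat.pos_of_ne_zero hg0) h)]
  have h1 : ∀ f ∈ l.divisors, ArithmeticFunction.moebius (g * f) =
      ArithmeticFunction.moebius g * ArithmeticFunction.moebius f := fun f hf =>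
    ArithmeticFunction.isMultiplicative_moebius.map_mul_of_coprime
      (hcop.coprime_dvd_right (Nat.dvd_of_mem_divisors hf))
  rw [sum_congr rfl h1, ← mul_sum]
  have h2 : ∑ f ∈ l.divisors, ArithmeticFunction.moebius f = if l = 1 then 1 else 0 := by
    rw [← ArithmeticFunction.coe_mul_zeta_apply, ArithmeticFunction.moebius_mul_coe_zeta,
      ArithmeticFunction.one_apply]
  rw [h2]
  by_cases hl1 : l = 1
  · simp [hl1, ArithmeticFunction.abs_moebius_le_one]
  · rw [if_neg hl1, mul_zero, abs_zero]
    positivity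

-- If `e'` divides `m`, then `f` ranges over the multiples of `g` dividing the part of `m / e'`
-- coprime to `q`. The Möbius sum survives only when `g` equals that part, and then the cofactor `k`
-- divides `q`.
open Classical in
theorem abs_sum_moebius_le {m D q e' g : ℕ} (hm : Squarefree m) (hmD : m ≤ D) :
    |∑ f ∈ (Icc 1 D).filter fun f => (g ∣ f ∧ f.Coprime q) ∧ e' * f ∣ m,
      (ArithmeticFunction.moebius (e' * f) : ℝ)| ≤
      if ∃ k, k ∣ q ∧ e' * g * k = m then 1 else 0 := by
  by_cases he : e' ∣ m
  swap
  · rw [sum_eq_zero]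
    · rw [abs_zero]; positivity
    · intro f hf
      exact absurd ((dvd_mul_right e' f).trans (mem_filter.mp hf).2.2) he
  obtain ⟨m', rfl⟩ := he
  have he0 : 0 < e' := Nat.pos_of_ne_zero (left_ne_zero_of_mul hm.ne_zero)
  have hcop : Nat.Coprime e' m' := Nat.coprime_of_squarefree_mul hm
  set k := Nat.gcd m' q with hk
  obtain ⟨m1, hm1⟩ : k ∣ m' := Nat.gcd_dvd_left m' q
  have hm'sq : Squarefree m' := hm.of_mul_right
  have hm'0 : 0 < m' := Nat.pos_of_ne_zero hm'sq.ne_zero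
  have hkm1 : Nat.Coprime k m1 := Nat.coprime_of_squarefree_mul (hm1 ▸ hm'sq)
  have hm1sq : Squarefree m1 := (hm1 ▸ hm'sq : Squarefree (k * m1)).of_mul_right
  have hm1q : Nat.Coprime m1 q := by
    rw [Nat.coprime_iff_gcd_eq_one]
    refine Nat.eq_one_of_dvd_coprimes hkm1 (Nat.dvd_gcd ?_ (Nat.gcd_dvd_right m1 q))
      (Nat.gcd_dvd_left m1 q)
    exact (Nat.gcd_dvd_left m1 q).trans (hm1 ▸ Dvd.intro_left k rfl)
  have hset : (Icc 1 D).filter (fun f => (g ∣ f ∧ f.Coprime q) ∧ e' * f ∣ e' * m') =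
      m1.divisors.filter fun f => g ∣ f := by
    ext f
    simp only [mem_filter, mem_Icc, Nat.mem_divisors]
    constructor
    · rintro ⟨⟨hf1, _⟩, ⟨hgf, hfq⟩, hdvd⟩
      have h1 : f ∣ m' := Nat.dvd_of_mul_dvd_mul_left he0 hdvd
      refine ⟨⟨?_, hm1sq.ne_zero⟩, hgf⟩
      rw [hm1] at h1
      exact (hfq.coprime_dvd_right (Nat.gcd_dvd_right m' q)).dvd_of_dvd_mul_left h1
    · rintro ⟨⟨hf1, _⟩, hgf⟩
      have h1 : f ∣ m' := hf1.trans (hm1 ▸ Dvd.intro_left k rfl)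
      refine ⟨⟨Nat.pos_of_dvd_of_pos h1 hm'0, ?_⟩, ⟨hgf, hm1q.coprime_dvd_left hf1⟩,
        mul_dvd_mul_left e' h1⟩
      exact (Nat.le_of_dvd hm'0 h1).trans ((Nat.le_mul_of_pos_left m' he0).trans hmD)
  rw [hset]
  have hmu : ∀ f ∈ m1.divisors.filter fun f => g ∣ f,
      (ArithmeticFunction.moebius (e' * f) : ℝ) =
        (ArithmeticFunction.moebius e' : ℝ) * (ArithmeticFunction.moebius f : ℤ) := by
    intro f hf
    have h1 : f ∣ m' := (Nat.dvd_of_mem_divisors (mem_filter.mp hf).1).trans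
      (hm1 ▸ Dvd.intro_left k rfl)
    rw [ArithmeticFunction.isMultiplicative_moebius.map_mul_of_coprime
      (hcop.coprime_dvd_right h1)]
    push_cast; rfl
  rw [sum_congr rfl hmu, ← mul_sum, abs_mul]
  by_cases hgm : g ∣ m1
  · have h1 := sum_moebius_multiples hm1sq hgm
    have h2 : |∑ f ∈ m1.divisors.filter fun f => g ∣ f, ((ArithmeticFunction.moebius f : ℤ) : ℝ)| ≤
        if g = m1 then 1 else 0 := by
      have h3 : ((|∑ f ∈ m1.divisors.filter fun f => g ∣ f, ArithmeticFunction.moebius f| : ℤ) : ℝ)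
        ≤ ((if g = m1 then 1 else 0 : ℤ) : ℝ) := by exact_mod_cast h1
      push_cast at h3
      exact h3
    refine (mul_le_mul (abs_moebius_cast_le e') h2 (abs_nonneg _) zero_le_one).trans ?_
    rw [one_mul]
    by_cases h : g = m1
    · rw [if_pos h, if_pos]
      refine ⟨k, Nat.gcd_dvd_right m' q, ?_⟩
      rw [h, hm1]; ring
    · rw [if_neg h]; positivity
  · rw [sum_eq_zero, abs_zero, mul_zero]
    · positivity
    · intro f hf
      rw [mem_filter] at hf
      exact absurd (hf.2.trans (Nat.dvd_of_mem_divisors hf.1)) hgm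

/-- In `n = ∑ φ(d)` over `d ∣ n`, every term is at most `φ(n)`. -/
theorem le_totient_mul_card_divisors (n : ℕ) : n ≤ n.totient * #n.divisors := by
  rcases Nat.eq_zero_or_pos n with rfl | hn
  · simp
  · conv_lhs => rw [← Nat.sum_totient n]
    rw [mul_comm, ← smul_eq_mul]
    refine sum_le_card_nsmul _ _ _ fun d hd => ?_
    exact Nat.le_of_dvd (Nat.totient_pos.mpr hn) (Nat.totient_dvd_of_dvd (Nat.dvd_of_mem_divisors hd))

theorem card_divisors_le_of_dvd {a b : ℕ} (hb : b ≠ 0) (h : a ∣ b) : #a.divisors ≤ #b.divisors :=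
  card_le_card (Nat.divisors_subset_of_dvd hb h)

/-- The diagonalising variables of Selberg's quadratic form, restricted by a modulus `q`. -/
noncomputable def sieveVar (W D q e' g : ℕ) : ℝ :=
  ∑ f ∈ (Icc 1 D).filter fun f => g ∣ f ∧ f.Coprime q, sieveWeight W D (e' * f) / f

/-- Selberg's weights make the Möbius sums collapse to the `m = e' * g * k` with `k ∣ q`. These are
at most `d(q)` terms, each at most `1 / (φ(e') φ(g))`; the other factor `d(q)` bounds `e' / φ(e')`.
-/
theorem abs_sieveVar_le {W D q e' : ℕ} (hD : 1 ≤ D) (hq : q ≠ 0) (he : e' ∣ q) (g : ℕ) :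
    |sieveVar W D q e' g| ≤
      if g ∈ sieveSupport W D then (#q.divisors : ℝ) ^ 2 / (sieveTotal W D * g.totient) else 0 := by
  classical
  have hG := sieveTotal_pos (W := W) hD
  set G := sieveTotal W D
  have h1 : sieveVar W D q e' g = (e' / G) * ∑ m ∈ sieveSupport W D, (1 / m.totient : ℝ) *
      ∑ f ∈ (Icc 1 D).filter fun f => (g ∣ f ∧ f.Coprime q) ∧ e' * f ∣ m,
        (ArithmeticFunction.moebius (e' * f) : ℝ) := by
    have h2 : ∀ f ∈ (Icc 1 D).filter fun f => g ∣ f ∧ f.Coprime q, sieveWeight W D (e' * f) / f =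
        (e' / G) * ∑ m ∈ sieveSupport W D, (1 / m.totient : ℝ) *
          if e' * f ∣ m then (ArithmeticFunction.moebius (e' * f) : ℝ) else 0 := by
      intro f hf
      have hf0 : (f : ℝ) ≠ 0 := by
        have := (mem_Icc.mp (mem_filter.mp hf).1).1
        positivity
      rw [sieveWeight, sum_filter, show sieveTotal W D = G from rfl]
      simp only [mul_ite, mul_zero]
      have h3 : ∀ m ∈ sieveSupport W D, (if e' * f ∣ m then
          (1 / m.totient : ℝ) * (ArithmeticFunction.moebius (e' * f) : ℝ) else 0) =
          (ArithmeticFunction.moebius (e' * f) : ℝ) *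
            if e' * f ∣ m then (1 / m.totient : ℝ) else 0 := by
        intro m _
        split_ifs <;> ring
      rw [sum_congr rfl h3, ← mul_sum]
      push_cast
      field_simp
    rw [sieveVar, sum_congr rfl h2, ← mul_sum, sum_comm]
    congr 1
    refine sum_congr rfl fun m _ => ?_
    rw [← mul_sum, ← sum_filter, filter_filter]
  have h3 : |sieveVar W D q e' g| ≤ (e' / G) * ∑ m ∈ sieveSupport W D, (1 / m.totient : ℝ) *
      (if ∃ k, k ∣ q ∧ e' * g * k = m then 1 else 0) := by
    rw [h1, abs_mul, abs_of_nonneg (show (0 : ℝ) ≤ e' / G by positivity)]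
    refine mul_le_mul_of_nonneg_left ((abs_sum_le_sum_abs _ _).trans (sum_le_sum fun m hm => ?_))
      (by positivity)
    rw [abs_mul, abs_of_nonneg (show (0 : ℝ) ≤ 1 / m.totient by positivity)]
    simp only [sieveSupport, mem_filter, mem_Icc] at hm
    exact mul_le_mul_of_nonneg_left (abs_sum_moebius_le hm.2.1 hm.1.2) (by positivity)
  simp only [mul_ite, mul_one, mul_zero, ← sum_filter] at h3
  by_cases hg : g ∈ sieveSupport W D
  · rw [if_pos hg]
    have h4 : ∑ m ∈ (sieveSupport W D).filter (fun m => ∃ k, k ∣ q ∧ e' * g * k = m),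
        (1 / m.totient : ℝ) ≤ ∑ k ∈ q.divisors, (1 / (e'.totient * g.totient) : ℝ) := by
      refine sum_le_sum_of_surj _ _ (fun k => e' * g * k) (fun k _ => by positivity) fun m hm => ?_
      rw [mem_filter] at hm
      obtain ⟨hmS, k, hk, rfl⟩ := hm
      refine ⟨k, Nat.mem_divisors.mpr ⟨hk, hq⟩, rfl, ?_⟩
      simp only [sieveSupport, mem_filter] at hmS
      have hsq : Squarefree (e' * g * k) := hmS.2.1
      have hc1 := Nat.coprime_of_squarefree_mul hsq
      have hc2 := Nat.coprime_of_squarefree_mul hsq.of_mul_left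
      have p1 : 0 < e'.totient := Nat.totient_pos.mpr
        (Nat.pos_of_ne_zero hsq.of_mul_left.of_mul_left.ne_zero)
      have p2 : 0 < g.totient := Nat.totient_pos.mpr
        (Nat.pos_of_ne_zero hsq.of_mul_left.of_mul_right.ne_zero)
      have p3 : 0 < k.totient := Nat.totient_pos.mpr (Nat.pos_of_ne_zero hsq.of_mul_right.ne_zero)
      rw [Nat.totient_mul hc1, Nat.totient_mul hc2]
      push_cast
      refine one_div_le_one_div_of_le (by positivity) (le_mul_of_one_le_right (by positivity) ?_)
      exact_mod_cast p3
    rw [sum_const, nsmul_eq_mul] at h4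
    have he0 : e' ≠ 0 := fun h => hq (by simpa [h] using he)
    have p1 : (0 : ℝ) < e'.totient := by
      exact_mod_cast Nat.totient_pos.mpr (Nat.pos_of_ne_zero he0)
    have p2 : (0 : ℝ) < g.totient := by
      have := (mem_Icc.mp (mem_filter.mp hg).1).1
      exact_mod_cast Nat.totient_pos.mpr this
    have h5 : (e' : ℝ) ≤ e'.totient * #q.divisors := by
      have h6 := (le_totient_mul_card_divisors e').trans
        (Nat.mul_le_mul_left _ (card_divisors_le_of_dvd hq he))
      exact_mod_cast h6
    calc |sieveVar W D q e' g| ≤ (e' / G) * (#q.divisors * (1 / (e'.totient * g.totient))) :=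
          h3.trans (mul_le_mul_of_nonneg_left h4 (by positivity))
      _ ≤ (e'.totient * #q.divisors / G) * (#q.divisors * (1 / (e'.totient * g.totient))) := by
          gcongr
      _ = _ := by field_simp
  · rw [if_neg hg]
    refine h3.trans (le_of_eq ?_)
    rw [sum_eq_zero, mul_zero]
    intro m hm
    rw [mem_filter] at hm
    obtain ⟨hmS, k, hk, rfl⟩ := hm
    exact absurd (mem_sieveSupport_of_dvd hmS ((dvd_mul_left g e').mul_right k)) hg

/-- `1 / lcm = gcd / (a b)`, and the gcd is the sum of `φ` over the common divisors; this
diagonalises Selberg's form. -/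
theorem one_div_lcm_eq {D a b : ℕ} (ha : a ∈ Icc 1 D) (hb : b ∈ Icc 1 D) :
    (1 / (Nat.lcm a b) : ℝ) = ∑ g ∈ Icc 1 D,
      if g ∣ a ∧ g ∣ b then (g.totient : ℝ) * ((1 / a) * (1 / b)) else 0 := by
  rw [mem_Icc] at ha hb
  have ha0 : (a : ℝ) ≠ 0 := by exact_mod_cast (by omega : a ≠ 0)
  have hb0 : (b : ℝ) ≠ 0 := by exact_mod_cast (by omega : b ≠ 0)
  have hl0 : (Nat.lcm a b : ℝ) ≠ 0 := by
    exact_mod_cast Nat.lcm_ne_zero (by omega) (by omega)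
  rw [← sum_filter, ← sum_mul]
  have hset : (Icc 1 D).filter (fun g => g ∣ a ∧ g ∣ b) = (Nat.gcd a b).divisors := by
    ext g
    simp only [mem_filter, mem_Icc, Nat.mem_divisors, Nat.dvd_gcd_iff]
    constructor
    · rintro ⟨_, h1⟩
      exact ⟨h1, Nat.gcd_ne_zero_left (by omega)⟩
    · rintro ⟨h1, _⟩
      have := Nat.le_of_dvd (by omega) h1.1
      exact ⟨⟨Nat.pos_of_dvd_of_pos h1.1 (by omega), by omega⟩, h1⟩
  rw [hset, ← Nat.cast_sum, Nat.sum_totient]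
  have h1 : (Nat.gcd a b : ℝ) * Nat.lcm a b = a * b := by exact_mod_cast Nat.gcd_mul_lcm a b
  field_simp
  linarith

/-- The bound for Selberg's quadratic form in arithmetic progressions. -/
theorem abs_sieve_form_le {W D q e₁ e₂ : ℕ} (hD : 1 ≤ D) (hq : q ≠ 0) (h₁ : e₁ ∣ q) (h₂ : e₂ ∣ q) :
    |∑ f₁ ∈ (Icc 1 D).filter fun f => f.Coprime q, ∑ f₂ ∈ (Icc 1 D).filter fun f => f.Coprime q,
      sieveWeight W D (e₁ * f₁) * sieveWeight W D (e₂ * f₂) * (1 / (Nat.lcm f₁ f₂) : ℝ)| ≤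
      (#q.divisors : ℝ) ^ 4 / sieveTotal W D := by
  have hG := sieveTotal_pos (W := W) hD
  have h1 : ∑ f₁ ∈ (Icc 1 D).filter fun f => f.Coprime q,
      ∑ f₂ ∈ (Icc 1 D).filter fun f => f.Coprime q,
      sieveWeight W D (e₁ * f₁) * sieveWeight W D (e₂ * f₂) * (1 / (Nat.lcm f₁ f₂) : ℝ) =
      ∑ g ∈ Icc 1 D, (g.totient : ℝ) * (sieveVar W D q e₁ g * sieveVar W D q e₂ g) := by
    have h2 : ∀ g ∈ Icc 1 D, (g.totient : ℝ) * (sieveVar W D q e₁ g * sieveVar W D q e₂ g) =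
        ∑ f₁ ∈ (Icc 1 D).filter fun f => f.Coprime q, ∑ f₂ ∈ (Icc 1 D).filter fun f => f.Coprime q,
          sieveWeight W D (e₁ * f₁) * sieveWeight W D (e₂ * f₂) *
            if g ∣ f₁ ∧ g ∣ f₂ then (g.totient : ℝ) * ((1 / f₁) * (1 / f₂)) else 0 := by
      intro g _
      have h3 : ∀ e' : ℕ, sieveVar W D q e' g = ∑ f ∈ (Icc 1 D).filter fun f => f.Coprime q,
          if g ∣ f then sieveWeight W D (e' * f) / f else 0 := by
        intro e'
        rw [sieveVar, ← sum_filter, filter_filter]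
        simp only [and_comm]
      rw [h3, h3, sum_mul_sum, mul_sum]
      refine sum_congr rfl fun f₁ _ => ?_
      rw [mul_sum]
      refine sum_congr rfl fun f₂ _ => ?_
      by_cases ha : g ∣ f₁ <;> by_cases hb : g ∣ f₂ <;> simp [ha, hb]
      ring
    rw [sum_congr rfl h2]
    conv_rhs => rw [sum_comm]
    refine sum_congr rfl fun f₁ hf₁ => ?_
    conv_rhs => rw [sum_comm]
    refine sum_congr rfl fun f₂ hf₂ => ?_
    rw [one_div_lcm_eq (mem_filter.mp hf₁).1 (mem_filter.mp hf₂).1, mul_sum]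
  rw [h1]
  refine (abs_sum_le_sum_abs _ _).trans ?_
  set G := sieveTotal W D with hGdef
  set d : ℝ := (#q.divisors : ℝ) with hd
  -- The factor `φ(g)` of the form cancels one of the two `1/φ(g)` from the variables. Summing what
  -- remains over the support gives one `G`, leaving `1/G` overall.
  have h4 : ∀ g ∈ Icc 1 D, |(g.totient : ℝ) * (sieveVar W D q e₁ g * sieveVar W D q e₂ g)| ≤
      if g ∈ sieveSupport W D then d ^ 4 / G ^ 2 * (1 / g.totient) else 0 := by
    intro g hg
    have p2 : (0 : ℝ) < g.totient := by
      exact_mod_cast Nat.totient_pos.mpr (mem_Icc.mp hg).1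
    rw [abs_mul, abs_mul, abs_of_pos p2]
    have h5 := abs_sieveVar_le (W := W) hD hq h₁ g
    have h6 := abs_sieveVar_le (W := W) hD hq h₂ g
    split_ifs at h5 h6 ⊢ with hgS
    · calc _ ≤ (g.totient : ℝ) * (d ^ 2 / (G * g.totient) * (d ^ 2 / (G * g.totient))) := by
            gcongr
        _ = _ := by field_simp
    · have h7 := le_antisymm h5 (abs_nonneg _)
      rw [h7, zero_mul, mul_zero]
  refine (sum_le_sum h4).trans (le_of_eq ?_)
  rw [← sum_filter]
  have hset : (Icc 1 D).filter (fun g => g ∈ sieveSupport W D) = sieveSupport W D := by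
    ext g
    simp only [mem_filter, sieveSupport]
    tauto
  rw [hset, ← mul_sum, ← sieveTotal, ← hGdef]
  field_simp

/-! ### Complete exponential sums -/

theorem periodic_emod {f : ℤ → ℂ} {P : ℕ} (hf : ∀ x k : ℤ, f (x + P * k) = f x) (x : ℤ) :
    f (x % P) = f x := by
  conv_rhs => rw [← Int.emod_add_mul_ediv x P]
  rw [hf]

/-- A sum over a complete residue system does not depend on the system. -/
theorem sum_residue_system {ι : Type*} (t : Finset ι) (φ : ι → ℤ) {P : ℕ} (hP : 0 < P) {f : ℤ → ℂ}
    (hf : ∀ x k : ℤ, f (x + P * k) = f x) (hcard : #t = P)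
    (hinj : ∀ i ∈ t, ∀ j ∈ t, (P : ℤ) ∣ φ i - φ j → i = j) :
    ∑ i ∈ t, f (φ i) = ∑ y ∈ range P, f y := by
  classical
  have hP' : (P : ℤ) ≠ 0 := by exact_mod_cast hP.ne'
  have hnn : ∀ i, 0 ≤ φ i % P := fun i => Int.emod_nonneg _ hP'
  have hval : ∀ i, (((φ i % P).toNat : ℕ) : ℤ) = φ i % P := fun i => Int.toNat_of_nonneg (hnn i)
  have hinj' : Set.InjOn (fun i => (φ i % P).toNat) (t : Set ι) := by
    intro i hi j hj hij
    refine hinj i hi j hj ?_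
    have h1 : φ i % P = φ j % P := by rw [← hval i, ← hval j]; exact_mod_cast hij
    exact Int.ModEq.dvd (show φ j ≡ φ i [ZMOD P] from h1.symm)
  have himg : t.image (fun i => (φ i % P).toNat) = range P := by
    refine eq_of_subset_of_card_le (fun y hy => ?_) ?_
    · obtain ⟨i, _, rfl⟩ := mem_image.mp hy
      rw [mem_range]
      have := Int.emod_lt_of_pos (φ i) (by exact_mod_cast hP : (0 : ℤ) < P)
      have := hval i
      omega
    · rw [card_image_of_injOn hinj', hcard, card_range]
  rw [← himg, sum_image hinj']
  refine sum_congr rfl fun i _ => ?_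
  rw [hval, periodic_emod hf]

theorem sum_range_mul_unit {P : ℕ} (hP : 0 < P) {f : ℤ → ℂ}
    (hf : ∀ x k : ℤ, f (x + P * k) = f x) {u : ℤ} (hu : IsCoprime u P) :
    ∑ y ∈ range P, f (u * y) = ∑ y ∈ range P, f y := by
  refine sum_residue_system (range P) (fun y : ℕ => u * (y : ℤ)) hP hf (card_range P) ?_
  intro i hi j hj h
  rw [mem_range] at hi hj
  rw [← mul_sub] at h
  have h1 : (P : ℤ) ∣ (i : ℤ) - j := hu.symm.dvd_of_dvd_mul_left h
  have h2 := Int.eq_zero_of_abs_lt_dvd h1 (by rw [abs_lt]; omega)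
  omega

theorem sum_range_add {P : ℕ} (hP : 0 < P) {f : ℤ → ℂ}
    (hf : ∀ x k : ℤ, f (x + P * k) = f x) (c : ℤ) :
    ∑ y ∈ range P, f (c + y) = ∑ y ∈ range P, f y := by
  refine sum_residue_system (range P) (fun y : ℕ => c + (y : ℤ)) hP hf (card_range P) ?_
  intro i hi j hj h
  rw [mem_range] at hi hj
  have h1 : (P : ℤ) ∣ (i : ℤ) - j := by convert h using 1; ring
  have h2 := Int.eq_zero_of_abs_lt_dvd h1 (by rw [abs_lt]; omega)
  omega

/-- The quadratic Gauss sum. -/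
noncomputable def gaussSum₂ (c : ℤ) (q : ℕ) : ℂ := ∑ r ∈ range q, e (c * r ^ 2 / q)

theorem e_quadratic_periodic {q : ℕ} (hq : 0 < q) (c x k : ℤ) :
    e (c * ((x + q * k : ℤ) : ℝ) ^ 2 / q) = e (c * (x : ℝ) ^ 2 / q) := by
  have hq' : (q : ℝ) ≠ 0 := by positivity
  have h : (c : ℝ) * ((x + q * k : ℤ) : ℝ) ^ 2 / q =
      c * (x : ℝ) ^ 2 / q + ((c * (2 * x * k + q * k ^ 2) : ℤ) : ℝ) := by
    push_cast; field_simp; ring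
  rw [h, e_add_int]

/-- The map `h ↦ m * h / q` sends these `h` injectively into `[0, m)`. -/
theorem card_dvd_mul_le {q m : ℕ} (hq : 0 < q) (hm : 0 < m) :
    #((range q).filter fun h => q ∣ m * h) ≤ m := by
  calc _ ≤ #(range m) := by
        refine card_le_card_of_injOn (fun h => m * h / q) (fun h hh => ?_) ?_
        · have hh := mem_filter.mp hh
          rw [coe_range, Set.mem_Iio, Nat.div_lt_iff_lt_mul hq]
          exact (Nat.mul_lt_mul_left hm).mpr (mem_range.mp hh.1)
        · intro h hh h' hh' heq
          have hh := (mem_filter.mp hh).2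
          have hh' := (mem_filter.mp hh').2
          have h1 : m * h = m * h' := by
            rw [← Nat.div_mul_cancel hh, ← Nat.div_mul_cancel hh']
            simp only at heq
            rw [heq]
          exact Nat.eq_of_mul_eq_mul_left hm h1
    _ = m := card_range m

/-- After squaring, substitute `r = s + l`: the phase becomes linear in `s`, and the sum over `s`
vanishes unless `q` divides `2 * c * l`. The hypothesis leaves at most `m` such `l`. -/
theorem norm_gaussSum₂_sq_le {q m : ℕ} (hq : 0 < q) (hm : 0 < m) {c : ℤ}
    (h : ∀ h : ℕ, (q : ℤ) ∣ 2 * c * h → q ∣ m * h) : ‖gaussSum₂ c q‖ ^ 2 ≤ q * m := by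
  have hq' : (q : ℝ) ≠ 0 := by positivity
  have h1 : ((‖gaussSum₂ c q‖ ^ 2 : ℝ) : ℂ) = ∑ l ∈ range q, e (c * l ^ 2 / q) *
      if (q : ℤ) ∣ 2 * c * l then (q : ℂ) else 0 := by
    rw [gaussSum₂, norm_sum_sq_eq, sum_comm]
    have h2 : ∀ s ∈ range q, ∑ r ∈ range q, e (c * r ^ 2 / q) * (starRingEnd ℂ) (e (c * s ^ 2 / q)) =
        ∑ l ∈ range q, e (c * l ^ 2 / q) * e (((2 * c * l : ℤ) : ℝ) * s / q) := by
      intro s _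
      have h3 := sum_range_add (P := q) hq (f := fun x : ℤ => e (c * (x : ℝ) ^ 2 / q))
        (fun x k => e_quadratic_periodic hq c x k) s
      simp only [Int.cast_natCast] at h3
      rw [← sum_mul, ← h3, sum_mul]
      refine sum_congr rfl fun l _ => ?_
      rw [conj_e, ← e_add, ← e_add]
      congr 1
      push_cast; ring
    rw [sum_congr rfl h2, sum_comm]
    refine sum_congr rfl fun l _ => ?_
    rw [← mul_sum, sum_e_div hq]
  have h4 : ‖((‖gaussSum₂ c q‖ ^ 2 : ℝ) : ℂ)‖ ≤ q * m := by
    rw [h1]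
    calc _ ≤ ∑ l ∈ range q, (if q ∣ m * l then (q : ℝ) else 0) := by
          refine norm_sum_le_of_le _ fun l _ => ?_
          rw [norm_mul, norm_e, one_mul]
          by_cases h5 : (q : ℤ) ∣ 2 * c * l
          · rw [if_pos h5, if_pos (h l h5)]; simp
          · rw [if_neg h5, norm_zero]; positivity
      _ = #((range q).filter fun l => q ∣ m * l) * (q : ℝ) := by
          rw [← sum_filter, sum_const, nsmul_eq_mul]
      _ ≤ m * q := by gcongr; exact card_dvd_mul_le hq hm
      _ = q * m := mul_comm _ _
  rw [Complex.norm_real] at h4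
  exact (le_abs_self _).trans h4

open Classical in
/-- The additive character at the points `(x ^ 2 - b) / W`, with the congruence condition. -/
noncomputable def squarePhase (q W : ℕ) (a b x : ℤ) : ℂ :=
  if (W : ℤ) ∣ x ^ 2 - b then e (a * (x ^ 2 - b) / (q * W)) else 0

theorem norm_squarePhase_le (q W : ℕ) (a b x : ℤ) : ‖squarePhase q W a b x‖ ≤ 1 := by
  unfold squarePhase
  split_ifs
  · rw [norm_e]
  · simp

theorem squarePhase_periodic {q W : ℕ} (hq : 0 < q) (hW : 0 < W) (a b x k : ℤ) :
    squarePhase q W a b (x + (q * W : ℕ) * k) = squarePhase q W a b x := by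
  have hq' : (q : ℝ) ≠ 0 := by positivity
  have hW' : (W : ℝ) ≠ 0 := by positivity
  have h1 : (x + (q * W : ℕ) * k) ^ 2 - b =
      x ^ 2 - b + W * (q * (k * (2 * x + q * W * k))) := by push_cast; ring
  have hiff : (W : ℤ) ∣ (x + (q * W : ℕ) * k) ^ 2 - b ↔ (W : ℤ) ∣ x ^ 2 - b := by
    rw [h1]; exact Int.dvd_add_left (dvd_mul_right _ _)
  unfold squarePhase
  by_cases h : (W : ℤ) ∣ x ^ 2 - b
  · rw [if_pos h, if_pos (hiff.mpr h), ← e_add_int (a * ((x : ℝ) ^ 2 - b) / (q * W)) (a * (k * (2 * x + q * W * k)))]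
    congr 1
    push_cast
    field_simp
    ring
  · rw [if_neg h, if_neg (mt hiff.mp h)]

/-- Put `m = qW/k`. Since `qW` divides `m²`, the number `1 + m` is a unit with inverse `1 - m`.
Multiplication by it permutes the residues modulo `qW`, preserves the condition modulo `W`, and
multiplies the phase by the constant `e(2ab/k) ≠ 1`; so the sum is zero. -/
theorem sum_squarePhase_eq_zero_of_unit {q W k : ℕ} (hq : 0 < q) (hW : 0 < W) {a b : ℤ}
    (hk0 : 0 < k) (hkW : k ∣ W) (hk2 : k ^ 2 ∣ q * W) (hW2 : W ∣ 2 * (q * W / k))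
    (hab : ¬ (k : ℤ) ∣ 2 * a * b) (d : ℤ) :
    ∑ y ∈ range (q * W), squarePhase q W a b (d * y) = 0 := by
  have hqW : 0 < q * W := Nat.mul_pos hq hW
  obtain ⟨m, hm⟩ : k ∣ q * W := (dvd_pow_self k two_ne_zero).trans hk2
  have hmk : q * W / k = m := by rw [hm]; exact Nat.mul_div_cancel_left m hk0
  rw [hmk] at hW2
  obtain ⟨t, ht⟩ := hk2
  have hmkt : m = k * t := by
    have : k * m = k * (k * t) := by rw [← hm, ht]; ring
    exact Nat.eq_of_mul_eq_mul_left hk0 this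
  have hm2 : m ^ 2 = q * W * t := by rw [ht, hmkt]; ring
  have hu : IsCoprime (1 + m : ℤ) ((q * W : ℕ) : ℤ) := by
    refine ⟨1 - m, t, ?_⟩
    have : (m : ℤ) ^ 2 = (q * W : ℕ) * t := by exact_mod_cast hm2
    linear_combination (-1 : ℤ) * this
  have hper : ∀ x l : ℤ, squarePhase q W a b (d * (x + (q * W : ℕ) * l)) =
      squarePhase q W a b (d * x) := by
    intro x l
    rw [← squarePhase_periodic hq hW a b (d * x) (d * l)]
    congr 1; ring
  have h1 := sum_range_mul_unit hqW (f := fun x => squarePhase q W a b (d * x)) hper hu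
  have hq' : (q : ℝ) ≠ 0 := by positivity
  have hW' : (W : ℝ) ≠ 0 := by positivity
  have hk' : (k : ℝ) ≠ 0 := by positivity
  have h2 : ∀ x : ℤ, squarePhase q W a b ((1 + m) * x) =
      e (((2 * a * b : ℤ) : ℝ) / k) * squarePhase q W a b x := by
    intro x
    obtain ⟨w, hw⟩ := hW2
    have hm2' : (m : ℤ) ^ 2 = q * W * t := by exact_mod_cast hm2
    have hw' : 2 * (m : ℤ) = W * w := by exact_mod_cast hw
    have h3 : ((1 + m) * x) ^ 2 - b = x ^ 2 - b + W * (x ^ 2 * (w + q * t)) := by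
      linear_combination x ^ 2 * hw' + x ^ 2 * hm2'
    have hiff : (W : ℤ) ∣ ((1 + m) * x) ^ 2 - b ↔ (W : ℤ) ∣ x ^ 2 - b := by
      rw [h3]; exact Int.dvd_add_left (dvd_mul_right _ _)
    have h3r : (((1 + m) * x : ℤ) : ℝ) ^ 2 - b = x ^ 2 - b + W * (x ^ 2 * (w + q * t)) := by
      exact_mod_cast h3
    unfold squarePhase
    by_cases h : (W : ℤ) ∣ x ^ 2 - b
    · rw [if_pos h, if_pos (hiff.mpr h), h3r]
      obtain ⟨j, hj⟩ := h
      obtain ⟨v, hv⟩ := hkW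
      rw [← e_add, ← e_add_int _ (-(a * (2 * v * j + x ^ 2 * t)))]
      congr 1
      have hx2 : (x : ℝ) ^ 2 = b + W * j := by
        have : x ^ 2 = b + W * j := by linarith
        exact_mod_cast this
      have hwr : (W : ℝ) * w = 2 * m := by exact_mod_cast hw'.symm
      have hmr : (m : ℝ) * k = q * W := by rw [mul_comm]; exact_mod_cast hm.symm
      have hWv : (W : ℝ) = k * v := by exact_mod_cast hv
      have h5 : (a : ℝ) * ((x : ℝ) ^ 2 - b) / (q * W) = a * j / q := by
        rw [hx2]; field_simp; ring
      have h6 : (w : ℝ) / q = 2 / k := by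
        rw [div_eq_div_iff hq' hk']
        have : (W : ℝ) * (w * k) = W * (2 * q) := by
          rw [← mul_assoc, hwr]; linear_combination 2 * hmr
        exact mul_left_cancel₀ hW' this
      have h7 : (a : ℝ) * ((x : ℝ) ^ 2 - b + W * (x ^ 2 * (w + q * t))) / (q * W) =
          a * j / q + a * x ^ 2 * (w / q) + a * x ^ 2 * t := by
        rw [hx2]; field_simp; ring
      push_cast
      rw [h7, h5, h6, hx2]
      have h8 : (W : ℝ) / k = v := by rw [hWv]; field_simp
      have h9 : (a : ℝ) * (b + W * j) * (2 / k) = 2 * a * b / k + 2 * a * j * (W / k) := by ring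
      rw [h9, h8]
      ring
    · rw [if_neg h, if_neg (mt hiff.mp h), mul_zero]
  have h3 : ∑ y ∈ range (q * W), squarePhase q W a b (d * ((1 + m) * y)) =
      e (((2 * a * b : ℤ) : ℝ) / k) * ∑ y ∈ range (q * W), squarePhase q W a b (d * y) := by
    rw [mul_sum]
    refine sum_congr rfl fun y _ => ?_
    rw [← h2]; congr 1; ring
  rw [h1] at h3
  by_contra hne
  have h4 : e (((2 * a * b : ℤ) : ℝ) / k) = 1 := by
    have h5 : (e (((2 * a * b : ℤ) : ℝ) / k) - 1) *
        ∑ y ∈ range (q * W), squarePhase q W a b (d * y) = 0 := by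
      rw [sub_mul, one_mul, ← h3, sub_self]
    exact sub_eq_zero.mp ((mul_eq_zero.mp h5).resolve_right hne)
  have h6 := sum_e_div hk0 (2 * a * b)
  rw [if_neg hab] at h6
  have h7 : ∀ i : ℕ, e (((2 * a * b : ℤ) : ℝ) * i / k) = 1 := by
    intro i
    rw [show ((2 * a * b : ℤ) : ℝ) * i / k = i * (((2 * a * b : ℤ) : ℝ) / k) by ring, e_nat_mul, h4,
      one_pow]
  simp only [h7, sum_const, card_range, nsmul_eq_mul, mul_one] at h6
  exact hk0.ne' (by exact_mod_cast h6)

/-- The complete sums vanish if `q` and `W` have a common factor. -/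
theorem sum_squarePhase_eq_zero {q W : ℕ} (hq : 0 < q) (hW : 0 < W) (h8 : 8 ∣ W) {a : ℤ} {b : ℕ}
    (ha : IsCoprime a q) (hb : Nat.Coprime b W) (hqW : ¬ Nat.Coprime q W) (d : ℤ) :
    ∑ y ∈ range (q * W), squarePhase q W a b (d * y) = 0 := by
  obtain ⟨l, hl, hlq, hlW⟩ := Nat.Prime.not_coprime_iff_dvd.mp hqW
  have hlp : Prime (l : ℤ) := Nat.prime_iff_prime_int.mp hl
  have hla : ¬ (l : ℤ) ∣ a := by
    intro h
    have h1 := ha.isUnit_of_dvd' h (by exact_mod_cast hlq)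
    exact hlp.not_isUnit h1
  have hlb : ¬ (l : ℤ) ∣ (b : ℤ) := by
    intro h
    have h1 : l ∣ b := by exact_mod_cast h
    have h2 := Nat.dvd_gcd h1 hlW
    rw [hb.gcd_eq_one] at h2
    exact hl.one_lt.ne' (Nat.dvd_one.mp h2)
  -- For an odd common prime, `k = l` works. For `l = 2` the phase `e(2ab/2)` would be trivial, so
  -- `k = 4` is taken, giving `e(ab/2) = -1`; the requirement `16 ∣ qW` holds because `q` is even
  -- and `8 ∣ W`.
  rcases eq_or_ne l 2 with rfl | hl2
  · obtain ⟨q', rfl⟩ := hlq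
    obtain ⟨W', rfl⟩ := h8
    refine sum_squarePhase_eq_zero_of_unit (k := 4) hq hW (by norm_num) ⟨2 * W', by ring⟩
      ⟨q' * W', by ring⟩ ?_ ?_ d
    · have : 2 * q' * (8 * W') / 4 = 4 * q' * W' := by
        rw [show 2 * q' * (8 * W') = 4 * (4 * q' * W') by ring]
        exact Nat.mul_div_cancel_left _ (by norm_num)
      rw [this]
      exact ⟨q', by ring⟩
    · intro h
      have h1 : (2 : ℤ) ∣ a * b := by
        obtain ⟨c, hc⟩ := h
        refine ⟨c, ?_⟩
        push_cast at hc
        linarith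
      rcases hlp.dvd_or_dvd h1 with h2 | h2
      · exact hla h2
      · exact hlb h2
  · obtain ⟨q', rfl⟩ := hlq
    obtain ⟨W', hW'⟩ := hlW
    refine sum_squarePhase_eq_zero_of_unit (k := l) hq hW hl.pos ⟨W', hW'⟩
      ⟨q' * W', by rw [hW']; ring⟩ ?_ ?_ d
    · have : l * q' * W / l = q' * W := by
        rw [mul_assoc]; exact Nat.mul_div_cancel_left _ hl.pos
      rw [this]
      exact ⟨2 * q', by ring⟩
    · intro h
      rcases hlp.dvd_or_dvd h with h1 | h1
      · rcases hlp.dvd_or_dvd h1 with h2 | h2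
        · have h3 : l ∣ 2 := by exact_mod_cast h2
          exact hl2 ((Nat.prime_dvd_prime_iff_eq hl Nat.prime_two).mp h3)
        · exact hla h2
      · exact hlb h1

theorem sum_range_mul_eq_sum_product {q W : ℕ} (hq : 0 < q) (hW : 0 < W) (hqW : Nat.Coprime q W)
    {f : ℤ → ℂ} (hf : ∀ x k : ℤ, f (x + (q * W : ℕ) * k) = f x) :
    ∑ y ∈ range (q * W), f y = ∑ r ∈ range q, ∑ s ∈ range W, f (W * r + q * s) := by
  rw [← sum_product']
  symm
  have hcop : IsCoprime (q : ℤ) W := Nat.isCoprime_iff_coprime.mpr hqW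
  refine sum_residue_system (range q ×ˢ range W) (fun p : ℕ × ℕ => (W : ℤ) * p.1 + q * p.2)
    (Nat.mul_pos hq hW) hf (by simp) ?_
  rintro ⟨r, s⟩ hp ⟨r', s'⟩ hp' h
  simp only [mem_product, mem_range] at hp hp' h
  have h1 : (q : ℤ) ∣ W * ((r : ℤ) - r') := by
    have h2 : (q : ℤ) ∣ W * r + q * s - (W * r' + q * s') :=
      (Dvd.intro _ (by push_cast; rfl)).trans h
    have h3 : (W : ℤ) * (r - r') = (W * r + q * s - (W * r' + q * s')) - q * (s - s') := by ring
    rw [h3]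
    exact dvd_sub h2 (dvd_mul_right _ _)
  have h2 : (W : ℤ) ∣ q * ((s : ℤ) - s') := by
    have h2 : (W : ℤ) ∣ W * r + q * s - (W * r' + q * s') :=
      (Dvd.intro_left _ (by push_cast; rfl)).trans h
    have h3 : (q : ℤ) * (s - s') = (W * r + q * s - (W * r' + q * s')) - W * (r - r') := by ring
    rw [h3]
    exact dvd_sub h2 (dvd_mul_right _ _)
  have h3 := Int.eq_zero_of_abs_lt_dvd (hcop.dvd_of_dvd_mul_left h1) (by rw [abs_lt]; omega)
  have h4 := Int.eq_zero_of_abs_lt_dvd (hcop.symm.dvd_of_dvd_mul_left h2) (by rw [abs_lt]; omega)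
  ext <;> simp only <;> omega

open Classical in
theorem sum_range_dvd_eq_sigma {W : ℕ} (hW : 0 < W) (b : ℕ) {u : ℤ} (hu : IsCoprime u W) :
    ∑ s ∈ range W, (if (W : ℤ) ∣ (u * s) ^ 2 - b then (1 : ℂ) else 0) = sigma W b := by
  have hper : ∀ x k : ℤ, (if (W : ℤ) ∣ (x + W * k) ^ 2 - b then (1 : ℂ) else 0) =
      if (W : ℤ) ∣ x ^ 2 - b then (1 : ℂ) else 0 := by
    intro x k
    have h : (W : ℤ) ∣ (x + W * k) ^ 2 - b ↔ (W : ℤ) ∣ x ^ 2 - b := by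
      rw [show (x + W * k) ^ 2 - (b : ℤ) = x ^ 2 - b + W * (k * (2 * x + W * k)) by ring]
      exact Int.dvd_add_left (dvd_mul_right _ _)
    simp only [h]
  rw [sum_range_mul_unit hW (f := fun x : ℤ => if (W : ℤ) ∣ x ^ 2 - b then (1 : ℂ) else 0) hper hu]
  rw [← sum_residue_system (Icc 1 W) (fun i : ℕ => (i : ℤ)) hW
    (f := fun x : ℤ => if (W : ℤ) ∣ x ^ 2 - b then (1 : ℂ) else 0) hper (by simp)]
  · rw [sigma, ← sum_filter, sum_const, nsmul_eq_mul, mul_one]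
    congr 2
    refine filter_congr fun x _ => ?_
    rw [Nat.ModEq.comm, Nat.modEq_iff_dvd]
    push_cast
    rfl
  · intro i hi j hj h
    rw [mem_Icc] at hi hj
    have := Int.eq_zero_of_abs_lt_dvd h (by rw [abs_lt]; omega)
    omega

/-- The complete sums factor if `q` and `W` are coprime. -/
theorem sum_squarePhase_eq {q W : ℕ} (hq : 0 < q) (hW : 0 < W) (hqW : Nat.Coprime q W) (a : ℤ)
    (b : ℕ) : ∃ ω : ℂ, ‖ω‖ = 1 ∧ ∀ d : ℕ, Nat.Coprime d W →
      ∑ y ∈ range (q * W), squarePhase q W a b (d * y) =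
        sigma W b * ω * gaussSum₂ (a * W * d ^ 2) q := by
  classical
  have hcop : IsCoprime (q : ℤ) W := Nat.isCoprime_iff_coprime.mpr hqW
  obtain ⟨v, u, huv⟩ := id hcop
  have hq' : (q : ℝ) ≠ 0 := by positivity
  have hW' : (W : ℝ) ≠ 0 := by positivity
  -- Here `u` is an inverse of `W` modulo `q`, and this factor is the contribution of the constant
  -- `-b` to the phase modulo `q`; it does not depend on `d`.
  refine ⟨e (-(a * u * b) / q), norm_e _, fun d hd => ?_⟩
  have hper : ∀ x l : ℤ, squarePhase q W a b (d * (x + (q * W : ℕ) * l)) =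
      squarePhase q W a b (d * x) := by
    intro x l
    rw [← squarePhase_periodic hq hW a b (d * x) (d * l)]
    congr 1; ring
  rw [sum_range_mul_eq_sum_product hq hW hqW (f := fun x => squarePhase q W a b (d * x)) hper]
  have hterm : ∀ r s : ℕ, squarePhase q W a b (d * (W * r + q * s)) =
      (e (((a * W * d ^ 2 : ℤ) : ℝ) * r ^ 2 / q) * e (-(a * u * b) / q)) *
        if (W : ℤ) ∣ ((d * q : ℤ) * s) ^ 2 - b then (1 : ℂ) else 0 := by
    intro r s
    have h1 : ((d : ℤ) * (W * r + q * s)) ^ 2 - b =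
        ((d * q : ℤ) * s) ^ 2 - b + W * (d ^ 2 * r * (W * r + 2 * q * s)) := by ring
    have hiff : (W : ℤ) ∣ ((d : ℤ) * (W * r + q * s)) ^ 2 - b ↔
        (W : ℤ) ∣ ((d * q : ℤ) * s) ^ 2 - b := by
      rw [h1]; exact Int.dvd_add_left (dvd_mul_right _ _)
    unfold squarePhase
    by_cases h : (W : ℤ) ∣ ((d * q : ℤ) * s) ^ 2 - b
    · rw [if_pos h, if_pos (hiff.mpr h), mul_one, ← e_add]
      obtain ⟨j, hj⟩ := h
      rw [← e_add_int (_ + _) (a * (j * v + u * d ^ 2 * q * s ^ 2 + 2 * d ^ 2 * r * s))]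
      congr 1
      have hjr : ((d * q : ℝ) * s) ^ 2 - b = W * j := by exact_mod_cast hj
      have huvr : (v : ℝ) * q + u * W = 1 := by exact_mod_cast huv
      have h1r : (((d : ℤ) * (W * r + q * s) : ℤ) : ℝ) ^ 2 - ((b : ℤ) : ℝ) =
        W * j + W * (d ^ 2 * r * (W * r + 2 * q * s)) := by
        rw [← hjr]; push_cast; ring
      rw [h1r]
      have hb : (b : ℝ) = ((d * q : ℝ) * s) ^ 2 - W * j := by linarith
      push_cast
      rw [hb]
      field_simp
      linear_combination (-(a : ℝ) * j) * huvr
    · rw [if_neg h, if_neg (mt hiff.mp h), mul_zero]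
  simp only [hterm, ← mul_sum]
  have hdq : IsCoprime ((d : ℤ) * q) W :=
    IsCoprime.mul_left (Nat.isCoprime_iff_coprime.mpr hd) hcop
  rw [sum_range_dvd_eq_sigma hW b hdq, ← sum_mul, ← sum_mul, gaussSum₂]
  ring

theorem gaussSum₂_mul_sq {q : ℕ} (hq : 0 < q) (c : ℤ) {f : ℕ} (hf : Nat.Coprime f q) :
    gaussSum₂ (c * f ^ 2) q = gaussSum₂ c q := by
  have h := sum_range_mul_unit hq (f := fun x : ℤ => e (c * (x : ℝ) ^ 2 / q))
    (fun x k => e_quadratic_periodic hq c x k) (u := f) (Nat.isCoprime_iff_coprime.mpr hf)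
  unfold gaussSum₂
  simp only [Int.cast_natCast] at h
  rw [← h]
  refine sum_congr rfl fun r _ => ?_
  congr 1
  push_cast; ring

/-- The factor `l` allows for common factors of `l` and `q`; in `sieveMean` it is cancelled by the
density `1 / lcm`. -/
theorem norm_gaussSum₂_le {q l : ℕ} (hq : 0 < q) (hl : 0 < l) {c : ℤ} (hc : IsCoprime c q) :
    ‖gaussSum₂ (c * l ^ 2) q‖ ≤ 2 * Real.sqrt q * l := by
  have h1 := norm_gaussSum₂_sq_le (q := q) (m := 2 * l ^ 2) (c := c * l ^ 2) hq (by positivity)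
    (fun h hdvd => by
      have h2 : (q : ℤ) ∣ c * (2 * l ^ 2 * h) := by convert hdvd using 1; ring
      have h3 := hc.symm.dvd_of_dvd_mul_left h2
      exact_mod_cast h3)
  refine abs_le_of_sq_le_sq' ?_ (by positivity) |>.2
  refine h1.trans ?_
  rw [mul_pow, mul_pow, Real.sq_sqrt (by positivity)]
  push_cast
  have : 0 ≤ (q : ℝ) * (l : ℝ) ^ 2 := by positivity
  linarith

/-! ### The main term on the major arcs -/

/-- A squarefree `d` is uniquely its gcd with `q` times a number coprime to `q`. Pairs whose product
leaves the support contribute zero, so `f` may run up to `D`. -/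
theorem sum_eq_sum_divisors_coprime {W D q : ℕ} (hq : q ≠ 0) (F : ℕ → ℂ)
    (hF : ∀ d, d ∉ sieveSupport W D → F d = 0) :
    ∑ d ∈ Icc 1 D, F d =
      ∑ e' ∈ q.divisors, ∑ f ∈ (Icc 1 D).filter fun f => f.Coprime q, F (e' * f) := by
  rw [← sum_product' (f := fun e' f => F (e' * f))]
  refine sum_bij_ne_zero (fun d _ _ => (Nat.gcd d q, d / Nat.gcd d q)) ?_ ?_ ?_ ?_
  · intro d hd hne
    have hdS : d ∈ sieveSupport W D := by
      by_contra h; exact hne (hF d h)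
    simp only [sieveSupport, mem_filter, mem_Icc] at hdS
    have hg : Nat.gcd d q ∣ d := Nat.gcd_dvd_left d q
    have hg0 : 0 < Nat.gcd d q := Nat.gcd_pos_of_pos_left _ hdS.1.1
    simp only [mem_product, Nat.mem_divisors, mem_filter, mem_Icc]
    refine ⟨⟨Nat.gcd_dvd_right d q, hq⟩, ⟨?_, ?_⟩, ?_⟩
    · exact Nat.div_pos (Nat.le_of_dvd hdS.1.1 hg) hg0
    · exact (Nat.div_le_self _ _).trans hdS.1.2
    · have hsq : Squarefree (Nat.gcd d q * (d / Nat.gcd d q)) := by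
        rw [Nat.mul_div_cancel' hg]; exact hdS.2.1
      have hcop := Nat.coprime_of_squarefree_mul hsq
      rw [Nat.coprime_iff_gcd_eq_one]
      refine Nat.eq_one_of_dvd_coprimes hcop (Nat.dvd_gcd ?_ (Nat.gcd_dvd_right _ q))
        (Nat.gcd_dvd_left _ q)
      exact (Nat.gcd_dvd_left _ q).trans (Nat.div_dvd_of_dvd hg)
  · intro d _ _ d' _ _ h
    rw [Prod.mk.injEq] at h
    rw [← Nat.mul_div_cancel' (Nat.gcd_dvd_left d q), h.2, h.1,
      Nat.mul_div_cancel' (Nat.gcd_dvd_left d' q)]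
  · rintro ⟨e', f⟩ hp hne
    simp only [mem_product, Nat.mem_divisors, mem_filter, mem_Icc] at hp
    have hdS : e' * f ∈ sieveSupport W D := by
      by_contra h; exact hne (hF _ h)
    have hgcd : Nat.gcd (e' * f) q = e' := by
      rw [Nat.Coprime.gcd_mul_right_cancel e' hp.2.2]
      exact Nat.gcd_eq_left hp.1.1
    have he0 : 0 < e' := Nat.pos_of_dvd_of_pos hp.1.1 (Nat.pos_of_ne_zero hq)
    refine ⟨e' * f, (mem_filter.mp hdS).1, hne, ?_⟩
    rw [hgcd, Nat.mul_div_cancel_left f he0]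
  · intro d _ _
    simp only
    rw [Nat.mul_div_cancel' (Nat.gcd_dvd_left d q)]

theorem coprime_lcm {a b q : ℕ} (ha : a.Coprime q) (hb : b.Coprime q) : (Nat.lcm a b).Coprime q :=
  (ha.mul_left hb).coprime_dvd_left (Nat.lcm_dvd_mul a b)

theorem lcm_mul_lcm {q e₁ e₂ f₁ f₂ : ℕ} (h₁ : e₁ ∣ q) (h₂ : e₂ ∣ q) (hf₁ : f₁.Coprime q)
    (hf₂ : f₂.Coprime q) :
    Nat.lcm (e₁ * f₁) (e₂ * f₂) = Nat.lcm e₁ e₂ * Nat.lcm f₁ f₂ := by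
  refine Nat.dvd_antisymm (Nat.lcm_dvd ?_ ?_) ?_
  · exact mul_dvd_mul (Nat.dvd_lcm_left _ _) (Nat.dvd_lcm_left _ _)
  · exact mul_dvd_mul (Nat.dvd_lcm_right _ _) (Nat.dvd_lcm_right _ _)
  · have hE : Nat.lcm e₁ e₂ ∣ q := Nat.lcm_dvd h₁ h₂
    have hF : (Nat.lcm f₁ f₂).Coprime q := coprime_lcm hf₁ hf₂
    refine Nat.Coprime.mul_dvd_of_dvd_of_dvd (hF.coprime_dvd_right hE).symm
      (Nat.lcm_dvd ?_ ?_) (Nat.lcm_dvd ?_ ?_)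
    · exact (dvd_mul_right _ _).trans (Nat.dvd_lcm_left _ _)
    · exact (dvd_mul_right _ _).trans (Nat.dvd_lcm_right _ _)
    · exact (dvd_mul_left _ _).trans (Nat.dvd_lcm_left _ _)
    · exact (dvd_mul_left _ _).trans (Nat.dvd_lcm_right _ _)

/-- The mean value of the sieve majorant twisted by an additive character of modulus `q`. -/
noncomputable def sieveMean (q W D : ℕ) (a b : ℤ) : ℂ :=
  ∑ d₁ ∈ Icc 1 D, ∑ d₂ ∈ Icc 1 D, ((sieveWeight W D d₁ * sieveWeight W D d₂ : ℝ) : ℂ) *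
    ((1 / (Nat.lcm d₁ d₂ * (q * W)) : ℝ) *
      ∑ y ∈ range (q * W), squarePhase q W a b ((Nat.lcm d₁ d₂ : ℕ) * y))

/-- Splitting each `d` into `e * f` with `e ∣ q` and `f` coprime to `q`, the complete sum depends
only on the lcm of the `e`'s, because that of the `f`'s enters as the square of a unit modulo `q`.
The sums over the `f`'s are then Selberg's form. The `d(q) ^ 2` pairs of `e`'s and the `d(q) ^ 4` of
the form give the sixth power. -/
theorem norm_sieveMean_le {q W D : ℕ} (hD : 1 ≤ D) (hq : 0 < q) (hW : 0 < W) (h8 : 8 ∣ W) {a : ℤ}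
    {b : ℕ} (ha : IsCoprime a q) (hb : Nat.Coprime b W) :
    ‖sieveMean q W D a b‖ ≤
      2 * (#q.divisors : ℝ) ^ 6 * (sigma W b / W) / (Real.sqrt q * sieveTotal W D) := by
  have hG := sieveTotal_pos (W := W) hD
  have hq' : (0 : ℝ) < q := by exact_mod_cast hq
  have hW' : (0 : ℝ) < W := by exact_mod_cast hW
  by_cases hqW : Nat.Coprime q W
  swap
  · have h0 : sieveMean q W D a b = 0 := by
      refine sum_eq_zero fun d₁ _ => sum_eq_zero fun d₂ _ => ?_
      rw [sum_squarePhase_eq_zero hq hW h8 ha hb hqW, mul_zero, mul_zero]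
    rw [h0, norm_zero]
    positivity
  obtain ⟨ω, hω, hsum⟩ := sum_squarePhase_eq hq hW hqW a b
  set d : ℝ := (#q.divisors : ℝ) with hd
  set K : ℕ → ℂ := fun E => ((1 / (E * (q * W)) : ℝ) : ℂ) *
    (sigma W b * ω * gaussSum₂ (a * W * (E : ℕ) ^ 2) q) with hK
  have hqne : q ≠ 0 := hq.ne'
  have hexp : sieveMean q W D a b = ∑ e₁ ∈ q.divisors, ∑ e₂ ∈ q.divisors, K (Nat.lcm e₁ e₂) *
      ((∑ f₁ ∈ (Icc 1 D).filter fun f => f.Coprime q, ∑ f₂ ∈ (Icc 1 D).filter fun f => f.Coprime q,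
        sieveWeight W D (e₁ * f₁) * sieveWeight W D (e₂ * f₂) * (1 / (Nat.lcm f₁ f₂) : ℝ) : ℝ) :
        ℂ) := by
    rw [sieveMean, sum_eq_sum_divisors_coprime (W := W) hqne]
    · refine sum_congr rfl fun e₁ he₁ => ?_
      have h1 : ∀ f₁ ∈ (Icc 1 D).filter fun f => f.Coprime q,
          ∑ d₂ ∈ Icc 1 D, ((sieveWeight W D (e₁ * f₁) * sieveWeight W D d₂ : ℝ) : ℂ) *
            ((1 / (Nat.lcm (e₁ * f₁) d₂ * (q * W)) : ℝ) *
            ∑ y ∈ range (q * W), squarePhase q W a b ((Nat.lcm (e₁ * f₁) d₂ : ℕ) * y)) =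
          ∑ e₂ ∈ q.divisors, ∑ f₂ ∈ (Icc 1 D).filter fun f => f.Coprime q,
            ((sieveWeight W D (e₁ * f₁) * sieveWeight W D (e₂ * f₂) *
              (1 / (Nat.lcm f₁ f₂)) : ℝ) : ℂ) * K (Nat.lcm e₁ e₂) := by
        intro f₁ hf₁
        rw [sum_eq_sum_divisors_coprime (W := W) hqne]
        · refine sum_congr rfl fun e₂ he₂ => sum_congr rfl fun f₂ hf₂ => ?_
          rw [mem_filter] at hf₁ hf₂
          by_cases h1 : e₁ * f₁ ∈ sieveSupport W D
          swap
          · simp [sieveWeight_eq_zero h1]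
          by_cases h2 : e₂ * f₂ ∈ sieveSupport W D
          swap
          · simp [sieveWeight_eq_zero h2]
          have hc1 := (mem_filter.mp h1).2.2
          have hc2 := (mem_filter.mp h2).2.2
          have hcl : Nat.Coprime (Nat.lcm (e₁ * f₁) (e₂ * f₂)) W := coprime_lcm hc1 hc2
          rw [hsum _ hcl, lcm_mul_lcm (Nat.dvd_of_mem_divisors he₁) (Nat.dvd_of_mem_divisors he₂)
            hf₁.2 hf₂.2, hK]
          have hgs : gaussSum₂ (a * W * ((Nat.lcm e₁ e₂ * Nat.lcm f₁ f₂ : ℕ) : ℤ) ^ 2) q =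
              gaussSum₂ (a * W * ((Nat.lcm e₁ e₂ : ℕ) : ℤ) ^ 2) q := by
            rw [← gaussSum₂_mul_sq hq (a * W * ((Nat.lcm e₁ e₂ : ℕ) : ℤ) ^ 2)
              (coprime_lcm hf₁.2 hf₂.2)]
            congr 1
            push_cast; ring
          rw [hgs]
          have hl1 : (Nat.lcm e₁ e₂ : ℂ) ≠ 0 := by
            have h3 := Nat.pos_of_mem_divisors he₁
            have h4 := Nat.pos_of_mem_divisors he₂
            exact_mod_cast Nat.lcm_ne_zero h3.ne' h4.ne'
          have hl2 : (Nat.lcm f₁ f₂ : ℂ) ≠ 0 := by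
            have h3 := (mem_Icc.mp hf₁.1).1
            have h4 := (mem_Icc.mp hf₂.1).1
            exact_mod_cast Nat.lcm_ne_zero (by omega) (by omega)
          push_cast
          field_simp
        · intro d₂ hd₂
          simp [sieveWeight_eq_zero hd₂]
      rw [sum_congr rfl h1, sum_comm]
      refine sum_congr rfl fun e₂ _ => ?_
      rw [mul_comm, Complex.ofReal_sum, sum_mul]
      refine sum_congr rfl fun f₁ _ => ?_
      rw [Complex.ofReal_sum, sum_mul]
    · intro d₁ hd₁
      refine sum_eq_zero fun d₂ _ => ?_
      simp [sieveWeight_eq_zero hd₁]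
  have haW : IsCoprime (a * W) q :=
    IsCoprime.mul_left ha (Nat.isCoprime_iff_coprime.mpr hqW.symm)
  have hKle : ∀ E : ℕ, 0 < E → ‖K E‖ ≤ 2 * (sigma W b / W) / Real.sqrt q := by
    intro E hE
    have hE' : (0 : ℝ) < E := by exact_mod_cast hE
    have h1 := norm_gaussSum₂_le hq hE haW
    rw [hK]
    simp only [norm_mul, hω, Complex.norm_real, Complex.norm_natCast, mul_one]
    rw [Real.norm_of_nonneg (by positivity)]
    calc _ ≤ 1 / (E * (q * W)) * (sigma W b * (2 * Real.sqrt q * E)) := by gcongr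
      _ = 2 * (sigma W b / W) / Real.sqrt q := by
          have hsq : Real.sqrt q * Real.sqrt q = q := Real.mul_self_sqrt hq'.le
          have hs0 : 0 < Real.sqrt q := Real.sqrt_pos.mpr hq'
          field_simp
          nlinarith
  rw [hexp]
  calc _ ≤ ∑ e₁ ∈ q.divisors, ∑ e₂ ∈ q.divisors,
        2 * (sigma W b / W) / Real.sqrt q * (d ^ 4 / sieveTotal W D) := by
        refine norm_sum_le_of_le _ fun e₁ he₁ => norm_sum_le_of_le _ fun e₂ he₂ => ?_
        rw [norm_mul, Complex.norm_real]
        refine mul_le_mul (hKle _ (Nat.pos_of_ne_zero (Nat.lcm_ne_zero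
          (Nat.pos_of_mem_divisors he₁).ne' (Nat.pos_of_mem_divisors he₂).ne'))) ?_
          (norm_nonneg _) (by positivity)
        exact abs_sieve_form_le hD hqne (Nat.dvd_of_mem_divisors he₁) (Nat.dvd_of_mem_divisors he₂)
    _ = _ := by
        rw [sum_const, sum_const, nsmul_eq_mul, nsmul_eq_mul, ← hd]
        have hs0 : 0 < Real.sqrt q := Real.sqrt_pos.mpr hq'
        field_simp

/-! ### Sums over the sieve majorant on the major arcs -/

theorem norm_sum_le_card_of_le_one {ι : Type*} {s : Finset ι} {f : ι → ℂ}
    (hf : ∀ i ∈ s, ‖f i‖ ≤ 1) : ‖∑ i ∈ s, f i‖ ≤ #s :=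
  (norm_sum_le_of_le s hf).trans_eq (by simp)

/-- Sums of periodic functions over intervals. -/
theorem norm_sum_periodic_sub_le {f : ℤ → ℂ} {P : ℕ} (hP : 0 < P)
    (hf : ∀ x k : ℤ, f (x + P * k) = f x) (hf1 : ∀ x, ‖f x‖ ≤ 1) (Y : ℕ) :
    ‖∑ y ∈ Icc 1 Y, f y - (Y / P : ℝ) * ∑ y ∈ range P, f y‖ ≤ 2 * P := by
  have hP' : (P : ℝ) ≠ 0 := by positivity
  set S := ∑ y ∈ range P, f y with hS
  have hSP : ‖S‖ ≤ P := by
    simpa using norm_sum_le_card_of_le_one (s := range P) fun y _ => hf1 y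
  induction Y using Nat.strong_induction_on with
  | _ Y ih =>
    rcases lt_or_ge Y P with h | h
    · have hY : (Y : ℝ) ≤ P := by exact_mod_cast h.le
      have h1 : ‖∑ y ∈ Icc 1 Y, f y‖ ≤ Y := by
        simpa using norm_sum_le_card_of_le_one (s := Icc 1 Y) fun y _ => hf1 y
      have h2 : ‖((Y / P : ℝ) : ℂ) * S‖ ≤ Y := by
        rw [norm_mul, Complex.norm_real, Real.norm_of_nonneg (by positivity)]
        calc (Y / P : ℝ) * ‖S‖ ≤ (Y / P : ℝ) * P := by gcongr
          _ = Y := by field_simp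
      refine (norm_sub_le _ _).trans ?_
      linarith
    · obtain ⟨Z, rfl⟩ := Nat.exists_eq_add_of_le' h
      have h1 := ih Z (by omega)
      have h2 : ∑ y ∈ Icc 1 (Z + P), f y = ∑ y ∈ Icc 1 Z, f y + S := by
        have h3 : ∑ y ∈ Icc 1 (Z + P), f y = ∑ y ∈ range (Z + P), f (1 + y) := by
          rw [← Ico_add_one_right_eq_Icc, sum_Ico_eq_sum_range]
          simp
        have h4 : ∑ y ∈ Icc 1 Z, f y = ∑ y ∈ range Z, f (1 + y) := by
          rw [← Ico_add_one_right_eq_Icc, sum_Ico_eq_sum_range]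
          simp
        rw [h3, h4, Finset.sum_range_add, hS, ← WPrimeSquares.sum_range_add hP hf (1 + Z)]
        congr 1
        refine sum_congr rfl fun y _ => ?_
        congr 1; push_cast; ring
      have h5 : ((((Z + P : ℕ) : ℝ) / P : ℝ) : ℂ) * S = ((Z / P : ℝ) : ℂ) * S + S := by
        have : (((Z + P : ℕ) : ℝ) / P : ℝ) = Z / P + 1 := by push_cast; field_simp
        rw [this]; push_cast; ring
      rw [h2, h5]
      convert h1 using 2
      ring

theorem sum_filter_dvd_eq {l : ℕ} (hl : 0 < l) (g : ℕ → ℂ) (X : ℕ) :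
    ∑ x ∈ (Icc 1 X).filter (l ∣ ·), g x = ∑ y ∈ Icc 1 (X / l), g (l * y) := by
  symm
  refine sum_bij (fun y _ => l * y) ?_ ?_ ?_ ?_
  · intro y hy
    rw [mem_Icc] at hy
    simp only [mem_filter, mem_Icc, dvd_mul_right, and_true]
    exact ⟨Nat.mul_pos hl hy.1, by rw [mul_comm]; exact (Nat.le_div_iff_mul_le hl).mp hy.2⟩
  · intro y _ y' _ h
    exact Nat.eq_of_mul_eq_mul_left hl h
  · intro x hx
    simp only [mem_filter, mem_Icc] at hx
    obtain ⟨⟨hx1, hx2⟩, y, rfl⟩ := hx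
    refine ⟨y, mem_Icc.mpr ⟨Nat.pos_of_mul_pos_left hx1, ?_⟩, rfl⟩
    rw [Nat.le_div_iff_mul_le hl, mul_comm]; exact hx2
  · intro y _
    rfl

/-- Sums of periodic functions over the multiples of `l`. -/
theorem norm_sum_dvd_periodic_sub_le {f : ℤ → ℂ} {P l : ℕ} (hP : 0 < P) (hl : 0 < l)
    (hf : ∀ x k : ℤ, f (x + P * k) = f x) (hf1 : ∀ x, ‖f x‖ ≤ 1) (X : ℕ) :
    ‖∑ x ∈ (Icc 1 X).filter (l ∣ ·), f x -
      X * ((1 / (l * P) : ℝ) * ∑ y ∈ range P, f ((l : ℕ) * y))‖ ≤ 3 * P := by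
  have hP' : (0 : ℝ) < P := by exact_mod_cast hP
  have hl' : (0 : ℝ) < l := by exact_mod_cast hl
  have h1 : ∑ x ∈ (Icc 1 X).filter (l ∣ ·), f x = ∑ y ∈ Icc 1 (X / l), f ((l : ℕ) * y) := by
    rw [sum_filter_dvd_eq hl fun x : ℕ => f x]
    push_cast; rfl
  set S := ∑ y ∈ range P, f ((l : ℕ) * y) with hS
  have hSP : ‖S‖ ≤ P := by
    simpa using norm_sum_le_card_of_le_one (s := range P) fun y _ => hf1 ((l : ℕ) * y)
  have h2 := norm_sum_periodic_sub_le (f := fun y => f (l * y)) hP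
    (fun x k => by rw [mul_add, mul_left_comm]; exact hf _ _) (fun x => hf1 _) (X / l)
  rw [h1]
  have h3 : ‖(((X / l : ℕ) / P : ℝ) : ℂ) * S - X * ((1 / (l * P) : ℝ) * S)‖ ≤ 1 := by
    have h4 : (((X / l : ℕ) / P : ℝ) : ℂ) * S - X * ((1 / (l * P) : ℝ) * S) =
        ((((X / l : ℕ) : ℝ) - X / l) / P : ℝ) * S := by
      have hPc : (P : ℂ) ≠ 0 := by exact_mod_cast hP.ne'
      have hlc : (l : ℂ) ≠ 0 := by exact_mod_cast hl.ne'
      push_cast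
      field_simp
    rw [h4, norm_mul, Complex.norm_real, Real.norm_eq_abs, abs_div, abs_of_pos hP']
    have h5 : |((X / l : ℕ) : ℝ) - X / l| ≤ 1 := by
      have h6 : ((X / l : ℕ) : ℝ) ≤ X / l := Nat.cast_div_le
      have h7 : (X / l : ℝ) < ((X / l : ℕ) : ℝ) + 1 := by
        rw [div_lt_iff₀ hl']
        exact_mod_cast (by
          have := Nat.lt_mul_div_succ X hl
          rw [mul_comm]; exact this : X < (X / l + 1) * l)
      rw [abs_le]; constructor <;> linarith
    calc _ ≤ 1 / P * (P : ℝ) := by gcongr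
      _ = 1 := by field_simp
  have h8 : (1 : ℝ) ≤ P := by exact_mod_cast hP
  calc _ ≤ _ := norm_sub_le_norm_sub_add_norm_sub _ ((((X / l : ℕ) / P : ℝ) : ℂ) * S) _
    _ ≤ 2 * P + 1 := add_le_add h2 h3
    _ ≤ 3 * P := by linarith

/-- The Selberg majorant of the integers free of prime factors up to the level. -/
noncomputable def sieveSq (W D x : ℕ) : ℝ :=
  (∑ d ∈ (Icc 1 D).filter (· ∣ x), sieveWeight W D d) ^ 2

theorem sum_abs_sieveWeight_le (W : ℕ) {D : ℕ} (hD : 1 ≤ D) :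
    ∑ d ∈ Icc 1 D, |sieveWeight W D d| ≤ (D : ℝ) ^ 2 := by
  calc _ ≤ ∑ d ∈ Icc 1 D, (D : ℝ) := by
        refine sum_le_sum fun d hd => (abs_sieveWeight_le hD d).trans ?_
        exact_mod_cast (mem_Icc.mp hd).2
    _ = _ := by simp; ring

theorem sieveSq_nonneg (W D x : ℕ) : 0 ≤ sieveSq W D x := sq_nonneg _

theorem sum_sieveSq_mul (W D X : ℕ) (f : ℕ → ℂ) :
    ∑ x ∈ Icc 1 X, (sieveSq W D x : ℂ) * f x =
      ∑ d₁ ∈ Icc 1 D, ∑ d₂ ∈ Icc 1 D, ((sieveWeight W D d₁ * sieveWeight W D d₂ : ℝ) : ℂ) *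
        ∑ x ∈ (Icc 1 X).filter (Nat.lcm d₁ d₂ ∣ ·), f x := by
  have h1 : ∀ x : ℕ, (sieveSq W D x : ℂ) * f x = ∑ d₁ ∈ Icc 1 D, ∑ d₂ ∈ Icc 1 D,
      ((sieveWeight W D d₁ * sieveWeight W D d₂ : ℝ) : ℂ) *
        (if Nat.lcm d₁ d₂ ∣ x then f x else 0) := by
    intro x
    unfold sieveSq
    rw [pow_two, sum_filter, sum_mul_sum]
    push_cast
    rw [sum_mul]
    refine sum_congr rfl fun d₁ _ => ?_
    rw [sum_mul]
    refine sum_congr rfl fun d₂ _ => ?_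
    by_cases h₁ : d₁ ∣ x <;> by_cases h₂ : d₂ ∣ x <;> simp [h₁, h₂, Nat.lcm_dvd_iff]
  simp_rw [h1]
  rw [sum_comm]
  refine sum_congr rfl fun d₁ _ => ?_
  rw [sum_comm]
  refine sum_congr rfl fun d₂ _ => ?_
  rw [← mul_sum, sum_filter]

/-- Each pair of divisors has error at most `3qW`, and the absolute weights sum to at most `D ^ 2`,
whence `D ^ 4`. -/
theorem norm_sum_sieveSq_mul_squarePhase_sub_le {q W D : ℕ} (hD : 1 ≤ D) (hq : 0 < q) (hW : 0 < W)
    (a b : ℤ) (X : ℕ) :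
    ‖∑ x ∈ Icc 1 X, (sieveSq W D x : ℂ) * squarePhase q W a b x - X * sieveMean q W D a b‖ ≤
      3 * (q * W) * (D : ℝ) ^ 4 := by
  rw [sum_sieveSq_mul W D X fun x => squarePhase q W a b x, sieveMean, mul_sum, ← sum_sub_distrib]
  simp_rw [fun i => mul_sum (Icc 1 D) (fun j => ((sieveWeight W D i * sieveWeight W D j : ℝ) : ℂ) *
    ((1 / (Nat.lcm i j * (q * W)) : ℝ) *
      ∑ y ∈ range (q * W), squarePhase q W a b ((Nat.lcm i j : ℕ) * y))) (X : ℂ),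
    ← sum_sub_distrib]
  calc _ ≤ ∑ d₁ ∈ Icc 1 D, ∑ d₂ ∈ Icc 1 D,
        |sieveWeight W D d₁| * |sieveWeight W D d₂| * (3 * (q * W)) := by
        refine norm_sum_le_of_le _ fun d₁ h₁ => norm_sum_le_of_le _ fun d₂ h₂ => ?_
        have h := norm_sum_dvd_periodic_sub_le (f := squarePhase q W a b) (P := q * W)
          (l := Nat.lcm d₁ d₂) (Nat.mul_pos hq hW)
          (Nat.lcm_pos (mem_Icc.mp h₁).1 (mem_Icc.mp h₂).1)
          (fun x k => squarePhase_periodic hq hW a b x k) (norm_squarePhase_le q W a b) X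
        push_cast at h
        rw [mul_left_comm, ← mul_sub, norm_mul, Complex.norm_real,
          Real.norm_eq_abs, abs_mul]
        refine mul_le_mul_of_nonneg_left ?_ (by positivity)
        refine le_of_eq_of_le ?_ h
        congr 2
        push_cast
        rfl
    _ = (∑ d ∈ Icc 1 D, |sieveWeight W D d|) ^ 2 * (3 * (q * W)) := by
        rw [pow_two, sum_mul_sum, sum_mul]
        refine sum_congr rfl fun d₁ _ => ?_
        rw [sum_mul]
    _ ≤ ((D : ℝ) ^ 2) ^ 2 * (3 * (q * W)) := by
        gcongr
        exact sum_abs_sieveWeight_le W hD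
    _ = _ := by ring

theorem norm_sieveMean_le_pow {q W D : ℕ} (hD : 1 ≤ D) (hq : 0 < q) (hW : 0 < W) (a b : ℤ) :
    ‖sieveMean q W D a b‖ ≤ (D : ℝ) ^ 4 := by
  unfold sieveMean
  have hq' : (0 : ℝ) < q := by exact_mod_cast hq
  have hW' : (0 : ℝ) < W := by exact_mod_cast hW
  calc _ ≤ ∑ d₁ ∈ Icc 1 D, ∑ d₂ ∈ Icc 1 D, |sieveWeight W D d₁| * |sieveWeight W D d₂| := by
        refine norm_sum_le_of_le _ fun d₁ h₁ => norm_sum_le_of_le _ fun d₂ h₂ => ?_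
        rw [norm_mul, Complex.norm_real, Real.norm_eq_abs, abs_mul]
        refine mul_le_of_le_one_right (by positivity) ?_
        rw [norm_mul, Complex.norm_real, Real.norm_of_nonneg (by positivity)]
        have h3 : (1 : ℝ) ≤ Nat.lcm d₁ d₂ := by
          exact_mod_cast Nat.lcm_pos (mem_Icc.mp h₁).1 (mem_Icc.mp h₂).1
        have h4 : ‖∑ y ∈ range (q * W), squarePhase q W a b ((Nat.lcm d₁ d₂ : ℕ) * y)‖ ≤
            (q * W : ℝ) := by
          refine (norm_sum_le _ _).trans
            ((sum_le_sum fun y _ => norm_squarePhase_le q W a b _).trans ?_)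
          simp
        calc _ ≤ 1 / (Nat.lcm d₁ d₂ * (q * W) : ℝ) * (q * W) := by gcongr
          _ = 1 / (Nat.lcm d₁ d₂ : ℝ) := by field_simp
          _ ≤ 1 := by rw [div_le_one (by linarith)]; exact h3
    _ = (∑ d ∈ Icc 1 D, |sieveWeight W D d|) ^ 2 := by rw [pow_two, sum_mul_sum]
    _ ≤ ((D : ℝ) ^ 2) ^ 2 := by
        gcongr
        exact sum_abs_sieveWeight_le W hD
    _ = _ := by ring

/-- Partial summation. -/
theorem norm_sum_mul_sub_le_of_sum {h F : ℕ → ℂ} {ρ : ℂ} {E : ℝ} {M : ℕ}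
    (hE : ∀ X ≤ M, ‖∑ x ∈ Icc 1 X, F x - X * ρ‖ ≤ E) :
    ‖∑ x ∈ Icc 1 M, h x * F x - ρ * ∑ x ∈ Icc 1 M, h x‖ ≤
      E * (‖h M‖ + ∑ x ∈ range M, ‖h (x + 1) - h x‖) := by
  set R : ℕ → ℂ := fun X => ∑ x ∈ Icc 1 X, F x - X * ρ with hR
  have hid : ∀ M : ℕ, ∑ x ∈ Icc 1 M, h x * F x - ρ * ∑ x ∈ Icc 1 M, h x =
      h M * R M - ∑ x ∈ range M, R x * (h (x + 1) - h x) := by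
    intro M
    induction M with
    | zero => simp [hR]
    | succ M ih =>
      have h1 : R (M + 1) = R M + F (M + 1) - ρ := by
        simp only [hR]; rw [sum_Icc_succ_top (by omega)]; push_cast; ring
      rw [sum_Icc_succ_top (by omega), sum_Icc_succ_top (by omega), sum_range_succ, h1]
      linear_combination ih
  rw [hid M]
  refine (norm_sub_le _ _).trans ?_
  rw [mul_add, mul_sum]
  refine add_le_add ?_ (norm_sum_le_of_le _ fun x hx => ?_)
  · rw [norm_mul, mul_comm]
    exact mul_le_mul_of_nonneg_right (hE M le_rfl) (norm_nonneg _)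
  · rw [norm_mul]
    exact mul_le_mul_of_nonneg_right (hE x (mem_range.mp hx).le) (norm_nonneg _)

/-! ### The weighted exponential sum on the major arcs -/

theorem norm_e_sub_one_sub_le (t : ℝ) :
    ‖e t - 1 - (2 * Real.pi * t : ℝ) * Complex.I‖ ≤ 3 * (2 * Real.pi * t) ^ 2 := by
  set u : ℝ := 2 * Real.pi * t with hu
  have hnu : ‖(u : ℂ) * Complex.I‖ = |u| := by simp
  rcases le_or_gt |u| 1 with h | h
  · have h1 := Complex.norm_exp_sub_one_sub_id_le (x := (u : ℂ) * Complex.I) (by rw [hnu]; exact h)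
    rw [hnu, sq_abs] at h1
    have h2 : e t = Complex.exp ((u : ℂ) * Complex.I) := by
      rw [e, hu]; congr 1; push_cast; ring
    rw [h2]
    nlinarith [sq_nonneg u]
  · have h1 : ‖e t - 1 - (u : ℂ) * Complex.I‖ ≤ 1 + 1 + |u| := by
      refine (norm_sub_le _ _).trans (add_le_add ((norm_sub_le _ _).trans ?_) hnu.le)
      rw [norm_e, norm_one]
    rw [← sq_abs u]
    nlinarith

theorem e_quadratic_succ (β b W : ℝ) (hW : W ≠ 0) (x : ℝ) :
    e (β * ((x + 1) ^ 2 - b) / W) = e (β * (x ^ 2 - b) / W) * e (β * (2 * x + 1) / W) := by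
  rw [← e_add]; congr 1; field_simp; ring

/-- The smooth quadratic exponential sum. -/
theorem norm_sum_mul_e_sq_le {M W N : ℕ} (hW : 0 < W) (hM : (M : ℝ) ^ 2 ≤ 2 * W * N) (β b : ℝ) :
    ‖∑ x ∈ Icc 1 M, (x : ℂ) * e (β * ((x : ℝ) ^ 2 - b) / W)‖ ≤
      3 * W * N / (1 + N * |β|) + M * (1 + 170 * (N * |β|)) := by
  have hW' : (0 : ℝ) < W := by exact_mod_cast hW
  have hMsum : ∑ x ∈ Icc 1 M, (x : ℝ) = M * (M + 1) / 2 := by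
    induction M with
    | zero => simp
    | succ n ih =>
      rw [sum_Icc_succ_top (by omega), ih (le_trans (by push_cast; nlinarith [n.cast_nonneg (α := ℝ)]) hM)]
      push_cast; ring
  have hNβ : 0 ≤ N * |β| := by positivity
  rcases le_or_gt (N * |β|) 1 with h | h
  · calc _ ≤ ∑ x ∈ Icc 1 M, (x : ℝ) := by
          refine norm_sum_le_of_le _ fun x _ => ?_
          rw [norm_mul, norm_e, mul_one, Complex.norm_natCast]
      _ = (M : ℝ) ^ 2 / 2 + M / 2 := by rw [hMsum]; ring
      _ ≤ 3 * W * N / 2 + M * 1 := by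
          nlinarith [M.cast_nonneg (α := ℝ), mul_nonneg hW'.le (N.cast_nonneg (α := ℝ))]
      _ ≤ _ := by gcongr <;> linarith
  · have hπ := Real.pi_pos
    have hβ : 0 < |β| := by
      by_contra h0
      have : |β| = 0 := le_antisymm (not_lt.mp h0) (abs_nonneg _)
      rw [this] at h; norm_num at h
    have hN : (0 : ℝ) < N := by
      by_contra h0
      have : (N : ℝ) = 0 := le_antisymm (not_lt.mp h0) (Nat.cast_nonneg _)
      rw [this] at h; norm_num at h
    have hβ0 : β ≠ 0 := abs_pos.mp hβ
    set g : ℕ → ℂ := fun x => e (β * ((x : ℝ) ^ 2 - b) / W) with hg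
    have hg1 : ∀ x, ‖g x‖ = 1 := fun x => norm_e _
    set t : ℕ → ℝ := fun x => 2 * Real.pi * (β * (2 * x + 1) / W) with ht
    -- To first order `g (x + 1) - g x` is `i t(x) g(x)`, with `t(x)` proportional to `2x + 1`.
    -- Hence the sum of `x g(x)` telescopes up to second-order errors and one unweighted sum, and
    -- gains the factor `W / |β|`.
    have hstep : ∀ x, ‖g (x + 1) - g x - g x * (t x * Complex.I)‖ ≤ 3 * (t x) ^ 2 := by
      intro x
      have h1 : g (x + 1) = g x * e (β * (2 * x + 1) / W) := by
        simp only [hg]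
        rw [← e_quadratic_succ β b W hW'.ne']
        push_cast; rfl
      rw [h1, ← mul_sub_one, ← mul_sub, norm_mul, hg1, one_mul]
      exact norm_e_sub_one_sub_le _
    have htel : ∑ x ∈ Icc 1 M, (g (x + 1) - g x) = g (M + 1) - g 1 := by
      clear hMsum hM
      induction M with
      | zero => simp
      | succ n ih => rw [sum_Icc_succ_top (by omega), ih]; ring
    have h2 : (4 * Real.pi * β / W : ℝ) * Complex.I * ∑ x ∈ Icc 1 M, (x : ℂ) * g x =
        (g (M + 1) - g 1) - ∑ x ∈ Icc 1 M, (g (x + 1) - g x - g x * (t x * Complex.I)) -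
          (2 * Real.pi * β / W : ℝ) * Complex.I * ∑ x ∈ Icc 1 M, g x := by
      rw [← htel, mul_sum, mul_sum, ← sum_sub_distrib, ← sum_sub_distrib]
      refine sum_congr rfl fun x _ => ?_
      simp only [ht]
      have hWc : (W : ℂ) ≠ 0 := by exact_mod_cast hW.ne'
      push_cast
      field_simp
      ring
    have h3 : 4 * Real.pi * |β| / W * ‖∑ x ∈ Icc 1 M, (x : ℂ) * g x‖ ≤
        2 + M * (3 * (2 * Real.pi * (|β| * (3 * M) / W)) ^ 2) + 2 * Real.pi * |β| / W * M := by
      have h4 : ‖(4 * Real.pi * β / W : ℝ) * Complex.I * ∑ x ∈ Icc 1 M, (x : ℂ) * g x‖ =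
          4 * Real.pi * |β| / W * ‖∑ x ∈ Icc 1 M, (x : ℂ) * g x‖ := by
        rw [norm_mul, norm_mul, Complex.norm_I, Complex.norm_real, Real.norm_eq_abs, abs_div, abs_mul,
          abs_of_pos (by positivity : 0 < 4 * Real.pi), abs_of_pos hW', mul_one]
      rw [← h4, h2]
      refine (norm_sub_le _ _).trans (add_le_add ((norm_sub_le _ _).trans (add_le_add ?_ ?_)) ?_)
      · refine (norm_sub_le _ _).trans ?_
        rw [hg1, hg1]; norm_num
      · calc _ ≤ ∑ x ∈ Icc 1 M, 3 * (2 * Real.pi * (|β| * (3 * M) / W)) ^ 2 := by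
              refine norm_sum_le_of_le _ fun x hx => (hstep x).trans ?_
              rw [mem_Icc] at hx
              have hx1 : (1 : ℝ) ≤ x := by exact_mod_cast hx.1
              have hx2 : (x : ℝ) ≤ M := by exact_mod_cast hx.2
              rw [← sq_abs (t x)]
              have h5 : |t x| = 2 * Real.pi * (|β| * (2 * x + 1) / W) := by
                simp only [ht]
                rw [abs_mul, abs_div, abs_mul β, abs_of_pos (by positivity : 0 < 2 * Real.pi),
                  abs_of_pos hW', abs_of_pos (by positivity : (0 : ℝ) < 2 * x + 1)]
              rw [h5]
              gcongr
              linarith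
          _ = _ := by simp
      · rw [norm_mul, norm_mul, Complex.norm_I, Complex.norm_real, Real.norm_eq_abs, abs_div, abs_mul,
          abs_of_pos (by positivity : 0 < 2 * Real.pi), abs_of_pos hW', mul_one]
        gcongr
        simpa using norm_sum_le_card_of_le_one (s := Icc 1 M) fun y _ => (hg1 y).le
    have h6 : ‖∑ x ∈ Icc 1 M, (x : ℂ) * g x‖ ≤
        W / (2 * Real.pi * |β|) + 27 * Real.pi * |β| * M * ((M : ℝ) ^ 2 / W) + M / 2 := by
      have hpos : 0 < 4 * Real.pi * |β| / W := by positivity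
      refine le_of_mul_le_mul_left (h3.trans_eq ?_) hpos
      field_simp
      ring
    refine h6.trans ?_
    have h7 : (M : ℝ) ^ 2 / W ≤ 2 * N := by
      rw [div_le_iff₀ hW']; linarith
    have h8 : W / (2 * Real.pi * |β|) ≤ 3 * W * N / (1 + N * |β|) := by
      rw [div_le_div_iff₀ (by positivity) (by positivity)]
      have := Real.pi_gt_three
      have h9 : (W : ℝ) * (1 + N * |β|) ≤ W * (2 * (N * |β|)) := by gcongr; linarith
      have h10 : (W : ℝ) * (2 * (N * |β|)) ≤ 3 * W * N * (2 * 3 * |β|) := by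
        have : 0 ≤ (W : ℝ) * N * |β| := by positivity
        nlinarith
      refine h9.trans (h10.trans ?_)
      gcongr
    -- The constant 170 is `54π` rounded up.
    have h9 : 27 * Real.pi * |β| * M * ((M : ℝ) ^ 2 / W) ≤ M * (170 * (N * |β|)) := by
      calc _ ≤ 27 * 3.1416 * |β| * M * (2 * N) := by
            have := Real.pi_lt_d4
            gcongr
        _ = 169.6464 * (M * (N * |β|)) := by ring
        _ ≤ 170 * (M * (N * |β|)) := by gcongr; norm_num
        _ = _ := by ring
    have : (0 : ℝ) ≤ M := Nat.cast_nonneg _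
    linarith

/-- The total variation of the smooth weight. -/
theorem variation_mul_e_sq_le {M W N : ℕ} (hW : 0 < W) (hM : (M : ℝ) ^ 2 ≤ 2 * W * N) (β b : ℝ) :
    ∑ x ∈ range M, ‖((x + 1 : ℕ) : ℂ) * e (β * (((x + 1 : ℕ) : ℝ) ^ 2 - b) / W) -
      (x : ℂ) * e (β * ((x : ℝ) ^ 2 - b) / W)‖ ≤ M * (1 + 26 * (N * |β|)) := by
  have hW' : (0 : ℝ) < W := by exact_mod_cast hW
  calc _ ≤ ∑ x ∈ range M, (1 + 26 * (N * |β|)) := by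
        refine sum_le_sum fun x hx => ?_
        have hx' : (x : ℝ) + 1 ≤ M := by exact_mod_cast mem_range.mp hx
        have hx0 : (0 : ℝ) ≤ x := Nat.cast_nonneg _
        push_cast
        rw [e_quadratic_succ β b W hW'.ne']
        set g := e (β * ((x : ℝ) ^ 2 - b) / W)
        have h1 : ((x : ℂ) + 1) * (g * e (β * (2 * x + 1) / W)) - x * g =
            g * (e (β * (2 * x + 1) / W) + x * (e (β * (2 * x + 1) / W) - 1)) := by ring
        rw [h1, norm_mul, norm_e, one_mul]
        refine (norm_add_le _ _).trans (add_le_add (norm_e _).le ?_)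
        rw [norm_mul, Complex.norm_natCast]
        calc (x : ℝ) * ‖e (β * (2 * x + 1) / W) - 1‖
            ≤ x * (2 * Real.pi * |β * (2 * x + 1) / W|) := by
              gcongr; exact norm_e_sub_one_le _
          _ = 2 * Real.pi * |β| * ((x * (2 * x + 1)) / W) := by
              rw [abs_div, abs_mul, abs_of_pos hW', abs_of_pos (by positivity : (0:ℝ) < 2 * x + 1)]
              ring
          _ ≤ 2 * 3.15 * |β| * (4 * N) := by
              have := Real.pi_lt_d2
              gcongr
              rw [div_le_iff₀ hW']
              nlinarith
          _ = 25.2 * (N * |β|) := by ring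
          _ ≤ 26 * (N * |β|) := by gcongr; norm_num
    _ = _ := by simp; ring

/-- The sieve-weighted exponential sum near a rational. -/
theorem norm_sum_major_le {q W D M N : ℕ} (hD : 1 ≤ D) (hq : 0 < q) (hW : 0 < W)
    (hM : (M : ℝ) ^ 2 ≤ 2 * W * N) (a b : ℤ) (β : ℝ) :
    ‖∑ x ∈ Icc 1 M, (x : ℂ) * e (β * ((x : ℝ) ^ 2 - b) / W) *
        ((sieveSq W D x : ℂ) * squarePhase q W a b x)‖ ≤
      ‖sieveMean q W D a b‖ * (3 * W * N / (1 + N * |β|)) +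
        4 * q * W * (D : ℝ) ^ 4 * M * (2 + 170 * (N * |β|)) := by
  have h1 := norm_sum_mul_sub_le_of_sum
    (h := fun x => (x : ℂ) * e (β * ((x : ℝ) ^ 2 - b) / W))
    (fun X (_ : X ≤ M) => norm_sum_sieveSq_mul_squarePhase_sub_le hD hq hW a b X)
  have h2 := variation_mul_e_sq_le hW hM β b
  have h3 := norm_sum_mul_e_sq_le hW hM β b
  have h4 := norm_sieveMean_le_pow hD hq hW a b
  have hq1 : (1 : ℝ) ≤ q := by exact_mod_cast hq
  have hW1 : (1 : ℝ) ≤ W := by exact_mod_cast hW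
  have hqW : (1 : ℝ) ≤ q * W := by nlinarith
  have hM0 : (0 : ℝ) ≤ M := Nat.cast_nonneg _
  have hNβ : 0 ≤ N * |β| := by positivity
  have h5 : ‖(M : ℂ) * e (β * ((M : ℝ) ^ 2 - b) / W)‖ = M := by
    rw [norm_mul, norm_e, mul_one, Complex.norm_natCast]
  have h6 := norm_le_insert' (∑ x ∈ Icc 1 M, (x : ℂ) * e (β * ((x : ℝ) ^ 2 - b) / W) *
        ((sieveSq W D x : ℂ) * squarePhase q W a b x))
    (sieveMean q W D a b * ∑ x ∈ Icc 1 M, (x : ℂ) * e (β * ((x : ℝ) ^ 2 - b) / W))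
  rw [norm_mul] at h6
  simp only [h5] at h1
  have h7 : ‖sieveMean q W D a b‖ * ‖∑ x ∈ Icc 1 M, (x : ℂ) * e (β * ((x : ℝ) ^ 2 - b) / W)‖ ≤
      ‖sieveMean q W D a b‖ * (3 * W * N / (1 + N * |β|)) +
        q * W * (D : ℝ) ^ 4 * (M * (2 + 170 * (N * |β|))) := by
    calc _ ≤ ‖sieveMean q W D a b‖ *
          (3 * W * N / (1 + N * |β|) + M * (1 + 170 * (N * |β|))) := by gcongr
      _ = ‖sieveMean q W D a b‖ * (3 * W * N / (1 + N * |β|)) +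
          ‖sieveMean q W D a b‖ * (M * (1 + 170 * (N * |β|))) := mul_add _ _ _
      _ ≤ _ := by
          gcongr
          · calc _ ≤ 1 * (D : ℝ) ^ 4 := by linarith
              _ ≤ _ := by gcongr
          · norm_num
  have h8 : 3 * (q * W) * (D : ℝ) ^ 4 * (M + M * (1 + 26 * (N * |β|))) ≤
      3 * (q * W) * (D : ℝ) ^ 4 * (M * (2 + 170 * (N * |β|))) := by
    gcongr
    nlinarith [mul_nonneg hM0 hNβ]
  have h9 := h1.trans (mul_le_mul_of_nonneg_left (add_le_add_right h2 (M : ℝ)) (by positivity))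
  linarith

/-! ### The weighted exponential sum on the minor arcs -/

theorem sum_sum_Icc_eq_diag_add {R : Type*} [AddCommMonoid R] (F : ℕ → ℕ → R) (Y : ℕ) :
    ∑ x ∈ Icc 1 Y, ∑ y ∈ Icc 1 Y, F x y = ∑ x ∈ Icc 1 Y, F x x +
      ∑ h ∈ Icc 1 Y, ∑ y ∈ Icc 1 (Y - h), (F (y + h) y + F y (y + h)) := by
  induction Y with
  | zero => simp
  | succ Y ih =>
    have h1 : ∀ G : ℕ → R, ∑ x ∈ Icc 1 Y, G x = ∑ h ∈ Icc 1 Y, G (Y + 1 - h) := by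
      intro G
      refine sum_nbij' (fun x => Y + 1 - x) (fun x => Y + 1 - x) ?_ ?_ ?_ ?_ ?_
      · intro x hx; rw [mem_Icc] at hx ⊢; omega
      · intro x hx; rw [mem_Icc] at hx ⊢; omega
      · intro x hx; rw [mem_Icc] at hx; omega
      · intro x hx; rw [mem_Icc] at hx; omega
      · intro x hx; rw [mem_Icc] at hx; congr 1; omega
    have h2 : ∑ h ∈ Icc 1 (Y + 1), ∑ y ∈ Icc 1 (Y + 1 - h), (F (y + h) y + F y (y + h)) =
        ∑ h ∈ Icc 1 Y, ∑ y ∈ Icc 1 (Y - h), (F (y + h) y + F y (y + h)) +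
          ∑ h ∈ Icc 1 Y, (F (Y + 1) (Y + 1 - h) + F (Y + 1 - h) (Y + 1)) := by
      rw [sum_Icc_succ_top (by omega), Nat.sub_self, ← sum_add_distrib]
      simp only [Icc_eq_empty_of_lt zero_lt_one, sum_empty, add_zero]
      refine sum_congr rfl fun h hh => ?_
      rw [mem_Icc] at hh
      have h3 : Y + 1 - h = (Y - h) + 1 := by omega
      have h4 : Y - h + 1 + h = Y + 1 := by omega
      rw [h3, sum_Icc_succ_top (by omega), h4]
    rw [sum_Icc_succ_top (by omega), sum_Icc_succ_top (by omega), h2]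
    simp_rw [sum_Icc_succ_top (show 1 ≤ Y + 1 by omega)]
    rw [sum_add_distrib, ih, sum_add_distrib, ← h1 (fun x => F (Y + 1) x),
      ← h1 (fun x => F x (Y + 1))]
    abel

/-- Weyl differencing for the quadratic exponential sum. -/
theorem norm_sum_e_sq_sq_le (ω : ℝ) (Y : ℕ) :
    ‖∑ y ∈ Icc 1 Y, e (ω * (y : ℝ) ^ 2)‖ ^ 2 ≤
      Y + 2 * ∑ h ∈ Icc 1 Y, ‖∑ y ∈ range (Y - h), e (2 * ω * h * y)‖ := by
  have h0 := norm_sum_sq_eq (Icc 1 Y) fun y : ℕ => e (ω * (y : ℝ) ^ 2)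
  have h1 : ‖∑ y ∈ Icc 1 Y, e (ω * (y : ℝ) ^ 2)‖ ^ 2 =
      ‖∑ x ∈ Icc 1 Y, ∑ y ∈ Icc 1 Y, e (ω * (x : ℝ) ^ 2) *
        (starRingEnd ℂ) (e (ω * (y : ℝ) ^ 2))‖ := by
    rw [← h0, Complex.norm_real, Real.norm_of_nonneg (by positivity)]
  rw [h1, sum_sum_Icc_eq_diag_add]
  refine (norm_add_le _ _).trans (add_le_add ?_ ?_)
  · have := norm_sum_le_card_of_le_one (s := Icc 1 Y) (f := fun x : ℕ => e (ω * (x : ℝ) ^ 2) *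
        (starRingEnd ℂ) (e (ω * (x : ℝ) ^ 2))) fun x _ => by
      rw [norm_mul, RCLike.norm_conj, norm_e, mul_one]
    simpa using this
  · rw [mul_sum]
    refine norm_sum_le_of_le _ fun h _ => ?_
    rw [sum_add_distrib]
    have h2 : ∑ y ∈ Icc 1 (Y - h), e (ω * ((y + h : ℕ) : ℝ) ^ 2) *
        (starRingEnd ℂ) (e (ω * (y : ℝ) ^ 2)) =
        e (ω * h ^ 2 + 2 * ω * h) * ∑ y ∈ range (Y - h), e (2 * ω * h * y) := by
      rw [← Ico_add_one_right_eq_Icc, sum_Ico_eq_sum_range, mul_sum]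
      refine sum_congr (by simp) fun y _ => ?_
      rw [conj_e, ← e_add, ← e_add]
      congr 1; push_cast; ring
    have h3 : ∑ y ∈ Icc 1 (Y - h), e (ω * (y : ℝ) ^ 2) *
        (starRingEnd ℂ) (e (ω * ((y + h : ℕ) : ℝ) ^ 2)) =
        (starRingEnd ℂ) (∑ y ∈ Icc 1 (Y - h), e (ω * ((y + h : ℕ) : ℝ) ^ 2) *
        (starRingEnd ℂ) (e (ω * (y : ℝ) ^ 2))) := by
      rw [map_sum]
      refine sum_congr rfl fun y _ => ?_
      rw [map_mul, Complex.conj_conj, mul_comm]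
    rw [h3, h2]
    refine (norm_add_le _ _).trans ?_
    rw [RCLike.norm_conj, norm_mul, norm_e]
    linarith

/-- The number of small fractional parts `k θ`. -/
theorem card_nnInt_le {q K : ℕ} {a : ℤ} (hq : 0 < q) (ha : IsCoprime a q) {θ ρ : ℝ}
    (hρ : 0 ≤ ρ) (hθ : K * |θ - a / q| ≤ 1 / q) :
    (#((Icc 1 K).filter fun k : ℕ => nnInt (k * θ) ≤ ρ) : ℝ) ≤ (2 * (ρ * q) + 3) * (K / q + 1) := by
  have hq' : (0 : ℝ) < q := by exact_mod_cast hq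
  set s := (Icc 1 K).filter fun k : ℕ => nnInt (k * θ) ≤ ρ with hs
  set R : ℕ := ⌊ρ * q + 1⌋₊ with hR
  have hRle : (R : ℝ) ≤ ρ * q + 1 := Nat.floor_le (by positivity)
  have hcard : #s ≤ #(Icc (-(R : ℤ)) R ×ˢ range (K / q + 1)) := by
    -- When `kθ` is near an integer, the first coordinate is an integer of size at most `ρq + 1`,
    -- and it determines `k` modulo `q`. The second determines the quotient.
    refine card_le_card_of_injOn (fun k => (k * a - round (k * θ) * q, k / q)) ?_ ?_
    · intro k hk
      simp only [hs, coe_filter, Set.mem_ofPred_eq, mem_Icc] at hk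
      obtain ⟨⟨hk1, hk2⟩, hk3⟩ := hk
      have hkK : (k : ℝ) ≤ K := by exact_mod_cast hk2
      have h1 : |(((k * a - round (k * θ) * q : ℤ)) : ℝ)| ≤ ρ * q + 1 := by
        have h2 : (((k * a - round (k * θ) * q : ℤ)) : ℝ) =
            (k * θ - round (k * θ)) * q - k * (θ - a / q) * q := by
          push_cast; field_simp; ring
        rw [h2]
        refine (abs_sub _ _).trans (add_le_add ?_ ?_)
        · rw [abs_mul, abs_of_pos hq']
          exact mul_le_mul_of_nonneg_right hk3 hq'.le
        · rw [abs_mul, abs_mul, abs_of_pos hq', Nat.abs_cast]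
          calc (k : ℝ) * |θ - a / q| * q ≤ K * |θ - a / q| * q := by gcongr
            _ ≤ 1 / q * q := by gcongr
            _ = 1 := by field_simp
      have h3 : |(k * a - round (k * θ) * q : ℤ)| ≤ R := by
        have h4 : ((k * a - round (k * θ) * q : ℤ).natAbs : ℝ) ≤ ρ * q + 1 := by
          rw [Nat.cast_natAbs, Int.cast_abs]; exact h1
        have := Nat.le_floor h4
        rw [Int.abs_eq_natAbs]
        exact_mod_cast this
      simp only [coe_product, Set.mem_prod, mem_coe, mem_Icc, mem_range]
      exact ⟨abs_le.mp h3, Nat.lt_succ_of_le (Nat.div_le_div_right hk2)⟩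
    · intro k _ k' _ h
      simp only [Prod.mk.injEq] at h
      obtain ⟨h1, h2⟩ := h
      have h3 : (q : ℤ) ∣ a * ((k : ℤ) - k') := ⟨round (k * θ) - round (k' * θ), by linarith⟩
      have h4 : (q : ℤ) ∣ (k : ℤ) - k' := ha.symm.dvd_of_dvd_mul_left h3
      have h5 : k' % q = k % q := (Nat.modEq_iff_dvd.mpr h4)
      rw [← Nat.div_add_mod k q, ← Nat.div_add_mod k' q, h5, h2]
  have h6 : (#(Icc (-(R : ℤ)) R ×ˢ range (K / q + 1)) : ℝ) = (2 * R + 1) * ((K / q : ℕ) + 1) := by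
    rw [card_product, Int.card_Icc, card_range]
    have : ((R : ℤ) + 1 - -R).toNat = 2 * R + 1 := by omega
    rw [this]; push_cast; ring
  calc (#s : ℝ) ≤ (#(Icc (-(R : ℤ)) R ×ˢ range (K / q + 1)) : ℝ) := by exact_mod_cast hcard
    _ = (2 * R + 1) * ((K / q : ℕ) + 1) := h6
    _ ≤ (2 * (ρ * q + 1) + 1) * (K / q + 1) := by
        gcongr
        exact Nat.cast_div_le
    _ = _ := by ring

theorem nnInt_nat_mul_le (W : ℕ) (t : ℝ) : nnInt (W * t) ≤ W * nnInt t := by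
  have h := nnInt_le (W * t) (W * round t)
  refine h.trans_eq ?_
  rw [nnInt]; push_cast
  rw [← mul_sub, abs_mul, Nat.abs_cast]

theorem nnInt_add_int (t : ℝ) (k : ℤ) : nnInt (t + k) = nnInt t := by
  rw [nnInt, round_add_intCast, nnInt]; push_cast; congr 1; ring

/-- Weyl differencing leaves linear sums of frequency `t`, where `W t` agrees with `kθ` modulo 1 for
`k = 2 l² h`; the integer `j` drops out. Unless `‖kθ‖ ≤ ρ`, this gives `‖t‖ > ρ/W` and a geometric
sum of size at most `W/(2ρ)`. The exceptional `h` are bounded trivially and counted. -/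
theorem norm_sum_e_sq_sq_le_of_card {W l Y K : ℕ} (hW : 0 < W) (hl : 0 < l) {θ ρ : ℝ} (hρ : 0 < ρ)
    (hK : 2 * l ^ 2 * Y ≤ K) (j : ℤ) :
    ‖∑ y ∈ Icc 1 Y, e ((θ + j) * l ^ 2 / W * (y : ℝ) ^ 2)‖ ^ 2 ≤
      Y * (1 + W / ρ + 2 * #((Icc 1 K).filter fun k : ℕ => nnInt (k * θ) ≤ ρ)) := by
  have hW' : (0 : ℝ) < W := by exact_mod_cast hW
  set C := (Icc 1 K).filter fun k : ℕ => nnInt (k * θ) ≤ ρ with hC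
  refine (norm_sum_e_sq_sq_le _ Y).trans ?_
  have h1 : ∀ h ∈ Icc 1 Y,
      ‖∑ y ∈ range (Y - h), e (2 * ((θ + j) * l ^ 2 / W) * h * y)‖ ≤
        W / (2 * ρ) + if nnInt ((2 * l ^ 2 * h : ℕ) * θ) ≤ ρ then (Y : ℝ) else 0 := by
    intro h _
    set t := 2 * ((θ + j) * l ^ 2 / W) * h with ht
    split_ifs with hh
    · refine (norm_sum_e_le_card t _).trans ?_
      have h2 : ((Y - h : ℕ) : ℝ) ≤ Y := by exact_mod_cast Nat.sub_le _ _
      have : 0 ≤ W / (2 * ρ) := by positivity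
      linarith
    · rw [add_zero]
      have h2 : (W : ℝ) * t = (2 * l ^ 2 * h : ℕ) * θ + ((2 * l ^ 2 * h * j : ℤ) : ℝ) := by
        rw [ht]; push_cast; field_simp
      have h3 := nnInt_nat_mul_le W t
      rw [h2, nnInt_add_int] at h3
      have h4 : ρ / W < nnInt t := by
        rw [div_lt_iff₀ hW']; linarith [not_le.mp hh]
      have h5 : 0 < ρ / W := by positivity
      refine (norm_sum_e_le t (h5.trans h4) _).trans ?_
      rw [div_le_div_iff₀ (by linarith) (by positivity)]
      rw [div_lt_iff₀ hW'] at h4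
      linarith
  have h2 : (#((Icc 1 Y).filter fun h : ℕ => nnInt ((2 * l ^ 2 * h : ℕ) * θ) ≤ ρ)) ≤ #C := by
    refine card_le_card_of_injOn (fun h => 2 * l ^ 2 * h) ?_ ?_
    · intro h hh
      simp only [coe_filter, Set.mem_ofPred_eq, mem_Icc, hC] at hh ⊢
      refine ⟨⟨Nat.mul_pos (by positivity) hh.1.1, ?_⟩, hh.2⟩
      exact (Nat.mul_le_mul_left _ hh.1.2).trans hK
    · intro h _ h' _ hh
      exact Nat.eq_of_mul_eq_mul_left (by positivity : 0 < 2 * l ^ 2) hh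
  have h3 : ∑ h ∈ Icc 1 Y, ‖∑ y ∈ range (Y - h), e (2 * ((θ + j) * l ^ 2 / W) * h * y)‖ ≤
      Y * (W / (2 * ρ)) + #C * Y := by
    refine (sum_le_sum h1).trans ?_
    rw [sum_add_distrib, ← sum_filter, sum_const, sum_const, nsmul_eq_mul, nsmul_eq_mul,
      Nat.card_Icc, Nat.add_sub_cancel]
    gcongr
  calc _ ≤ (Y : ℝ) + 2 * (Y * (W / (2 * ρ)) + #C * Y) := by gcongr
    _ = _ := by field_simp; ring

/-- The quadratic phase `e(n θ)` at `x`, where `W n + b = x²`. -/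
noncomputable def quadPhase (W : ℕ) (b : ℤ) (θ : ℝ) (x : ℤ) : ℂ :=
  if (W : ℤ) ∣ x ^ 2 - b then e (θ * (x ^ 2 - b) / W) else 0

/-- Detecting the congruence modulo `W` by additive characters replaces `θ` by `θ + j`, and the
bound for the quadratic sums is uniform in the integer `j`. -/
theorem norm_sum_dvd_quadPhase_le {W l X K : ℕ} (hW : 0 < W) (hl : 0 < l) {θ ρ B : ℝ} (hρ : 0 < ρ)
    (hB : 0 ≤ B) (hK : 2 * l ^ 2 * X ≤ K) (b : ℤ)
    (h : X * (1 + W / ρ + 2 * #((Icc 1 K).filter fun k : ℕ => nnInt (k * θ) ≤ ρ)) ≤ B ^ 2) :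
    ‖∑ x ∈ (Icc 1 X).filter (l ∣ ·), quadPhase W b θ x‖ ≤ B := by
  have hW' : (0 : ℝ) < W := by exact_mod_cast hW
  have hWc : (W : ℂ) ≠ 0 := by exact_mod_cast hW.ne'
  have hphase : ∀ x : ℤ, quadPhase W b θ x =
      (1 / W : ℝ) * ∑ j ∈ range W, e ((θ + j) * ((x : ℝ) ^ 2 - b) / W) := by
    intro x
    have h1 := sum_e_div hW (x ^ 2 - b)
    have h2 : ∑ j ∈ range W, e ((θ + j) * ((x : ℝ) ^ 2 - b) / W) = e (θ * ((x : ℝ) ^ 2 - b) / W) *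
        ∑ j ∈ range W, e (((x ^ 2 - b : ℤ) : ℝ) * j / W) := by
      rw [mul_sum]
      refine sum_congr rfl fun j _ => ?_
      rw [← e_add]; congr 1; push_cast; ring
    rw [h2, h1, quadPhase]
    split_ifs
    · push_cast; field_simp
    · simp
  have hX : ∑ x ∈ (Icc 1 X).filter (l ∣ ·), quadPhase W b θ x = (1 / W : ℝ) * ∑ j ∈ range W,
      e (-((θ + j) * b / W)) *
        ∑ y ∈ Icc 1 (X / l), e ((θ + (j : ℤ)) * l ^ 2 / W * (y : ℝ) ^ 2) := by
    simp_rw [hphase]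
    rw [← mul_sum, sum_comm]
    congr 1
    refine sum_congr rfl fun j _ => ?_
    rw [mul_sum, sum_filter_dvd_eq hl fun x : ℕ => e ((θ + j) * (((x : ℤ) : ℝ) ^ 2 - b) / W)]
    refine sum_congr rfl fun y _ => ?_
    rw [← e_add]; congr 1; push_cast; ring
  rw [hX, norm_mul, Complex.norm_real, Real.norm_of_nonneg (by positivity)]
  calc _ ≤ (1 / W : ℝ) * ∑ j ∈ range W, B := by
        gcongr
        refine norm_sum_le_of_le _ fun j _ => ?_
        rw [norm_mul, norm_e, one_mul]
        refine abs_le_of_sq_le_sq' ?_ hB |>.2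
        have hXl : X / l ≤ X := Nat.div_le_self _ _
        refine (norm_sum_e_sq_sq_le_of_card hW hl hρ
          ((Nat.mul_le_mul_left _ hXl).trans hK) j).trans (le_trans ?_ h)
        gcongr
    _ = B := by simp; field_simp

/-- The sieve-weighted exponential sum away from rationals of small denominator. -/
theorem norm_sum_minor_le {W D M K : ℕ} (hD : 1 ≤ D) (hW : 0 < W) {θ ρ B : ℝ} (hρ : 0 < ρ)
    (hB : 0 ≤ B) (hK : 2 * D ^ 4 * M ≤ K) (b : ℤ)
    (h : M * (1 + W / ρ + 2 * #((Icc 1 K).filter fun k : ℕ => nnInt (k * θ) ≤ ρ)) ≤ B ^ 2) :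
    ‖∑ x ∈ Icc 1 M, (x : ℂ) * ((sieveSq W D x : ℂ) * quadPhase W b θ x)‖ ≤
      (D : ℝ) ^ 4 * B * (2 * M) := by
  have hE : ∀ X ≤ M, ‖∑ x ∈ Icc 1 X, (sieveSq W D x : ℂ) * quadPhase W b θ x - X * 0‖ ≤
      (D : ℝ) ^ 4 * B := by
    intro X hX
    rw [mul_zero, sub_zero, sum_sieveSq_mul W D X fun x => quadPhase W b θ x]
    calc _ ≤ ∑ d₁ ∈ Icc 1 D, ∑ d₂ ∈ Icc 1 D, |sieveWeight W D d₁| * |sieveWeight W D d₂| * B := by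
          refine norm_sum_le_of_le _ fun d₁ h₁ => norm_sum_le_of_le _ fun d₂ h₂ => ?_
          rw [mem_Icc] at h₁ h₂
          rw [norm_mul, Complex.norm_real, Real.norm_eq_abs, abs_mul]
          refine mul_le_mul_of_nonneg_left ?_ (by positivity)
          have hl : Nat.lcm d₁ d₂ ≤ D ^ 2 := by
            refine (Nat.le_of_dvd (by have := h₁.1; have := h₂.1; positivity)
              (Nat.lcm_dvd_mul d₁ d₂)).trans ?_
            rw [pow_two]; exact Nat.mul_le_mul h₁.2 h₂.2
          refine norm_sum_dvd_quadPhase_le (K := K) hW (Nat.lcm_pos h₁.1 h₂.1) hρ hB ?_ b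
            (le_trans ?_ h)
          · calc _ ≤ 2 * (D ^ 2) ^ 2 * M := by gcongr
              _ = 2 * D ^ 4 * M := by ring
              _ ≤ K := hK
          · gcongr
      _ = (∑ d ∈ Icc 1 D, |sieveWeight W D d|) ^ 2 * B := by
          rw [pow_two, sum_mul_sum, sum_mul]
          refine sum_congr rfl fun d₁ _ => ?_
          rw [sum_mul]
      _ ≤ ((D : ℝ) ^ 2) ^ 2 * B := by
          gcongr
          exact sum_abs_sieveWeight_le W hD
      _ = _ := by ring
  have h1 := norm_sum_mul_sub_le_of_sum (h := fun x => (x : ℂ)) hE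
  rw [zero_mul, sub_zero] at h1
  refine h1.trans_eq ?_
  have h2 : ∀ x : ℕ, ‖((x + 1 : ℕ) : ℂ) - x‖ = 1 := fun x => by simp
  simp_rw [h2]
  rw [Complex.norm_natCast, sum_const, card_range, nsmul_eq_mul]
  ring

/-! ### The Fourier transform of the majorant -/

/-- The positive integers up to `M` whose squares are congruent to `b` modulo `W`. -/
def squareRoots (W b M : ℕ) : Finset ℕ := (Icc 1 M).filter fun x => (W : ℤ) ∣ (x : ℤ) ^ 2 - b

/-- The normalizing factor of the weights. -/
noncomputable def weightFactor (W b N : ℕ) : ℝ :=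
  2 * W.totient * Real.log N / (W * sigma W b)

/-- A majorant of the weighted prime squares. -/
noncomputable def majorantWeight (W D b N x : ℕ) : ℝ :=
  weightFactor W b N * (x * (sieveSq W D x + if x ≤ D then 1 else 0))

theorem weightFactor_nonneg (W b N : ℕ) : 0 ≤ weightFactor W b N := by
  have := Real.log_natCast_nonneg N
  unfold weightFactor; positivity

theorem weightFactor_le {W : ℕ} (hW : 0 < W) (b N : ℕ) : weightFactor W b N ≤ 2 * Real.log N := by
  have h0 := Real.log_natCast_nonneg N
  have hW' : (0 : ℝ) < W := by exact_mod_cast hW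
  unfold weightFactor
  rcases Nat.eq_zero_or_pos (sigma W b) with h | h
  -- If `b` is not a square modulo `W`, division by zero makes the factor 0.
  · rw [h]; simpa using h0
  · have h1 : (1 : ℝ) ≤ sigma W b := by exact_mod_cast h
    have h2 : (W.totient : ℝ) ≤ W := by exact_mod_cast Nat.totient_le W
    rw [div_le_iff₀ (by positivity)]
    calc 2 * (W.totient : ℝ) * Real.log N ≤ 2 * W * Real.log N := by gcongr
      _ = 2 * Real.log N * (W * 1) := by ring
      _ ≤ _ := by gcongr

theorem intCast_ediv_of_mem_squareRoots {W b M x : ℕ} (hW : 0 < W) (hx : x ∈ squareRoots W b M) :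
    ((((x : ℤ) ^ 2 - b) / W : ℤ) : ℝ) = ((x : ℝ) ^ 2 - b) / W := by
  have h := (mem_filter.mp hx).2
  have hW' : ((W : ℤ) : ℝ) ≠ 0 := by exact_mod_cast hW.ne'
  rw [Int.cast_div h hW']
  push_cast; rfl

theorem sum_squareRoots_eq_quadPhase {W b M : ℕ} (hW : 0 < W) (θ : ℝ) (f : ℕ → ℂ) :
    ∑ x ∈ squareRoots W b M, f x * e ((((x : ℤ) ^ 2 - b) / W : ℤ) * θ) =
      ∑ x ∈ Icc 1 M, f x * quadPhase W b θ x := by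
  have h1 : ∀ x ∈ squareRoots W b M, f x * e ((((x : ℤ) ^ 2 - b) / W : ℤ) * θ) =
      f x * quadPhase W b θ x := by
    intro x hx
    rw [quadPhase, if_pos (mem_filter.mp hx).2, intCast_ediv_of_mem_squareRoots hW hx]
    congr 2
    push_cast; ring
  rw [sum_congr rfl h1]
  refine sum_subset (filter_subset _ _) fun x hx hx' => ?_
  have h2 : ¬ (W : ℤ) ∣ (x : ℤ) ^ 2 - b := fun h => hx' (mem_filter.mpr ⟨hx, h⟩)
  rw [quadPhase, if_neg h2, mul_zero]

theorem quadPhase_eq_squarePhase_mul {q W : ℕ} (hq : 0 < q) (hW : 0 < W) (a b x : ℤ) (β : ℝ) :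
    quadPhase W b (a / q + β) x = squarePhase q W a b x * e (β * ((x : ℝ) ^ 2 - b) / W) := by
  have hq' : (q : ℝ) ≠ 0 := by exact_mod_cast hq.ne'
  have hW' : (W : ℝ) ≠ 0 := by exact_mod_cast hW.ne'
  unfold quadPhase squarePhase
  split_ifs
  · rw [← e_add]; congr 1; field_simp
  · simp

/-- The main term on the major arcs, in normalized form. -/
theorem weightFactor_mul_norm_sieveMean_le {q W D N b : ℕ} (hD : 1 ≤ D) (hq : 0 < q) (hW : 0 < W)
    (h8 : 8 ∣ W) {a : ℤ} (ha : IsCoprime a q) (hb : Nat.Coprime b W)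
    (hlog : Real.log N ≤ 200 * Real.log (D + 1)) :
    weightFactor W b N * (‖sieveMean q W D a b‖ * (3 * W * N)) ≤
      4800 * N * ((#q.divisors : ℝ) ^ 6 / √q) := by
  have h1 := norm_sieveMean_le hD hq hW h8 ha hb
  have h2 := log_le_mul_sieveTotal hW.ne' D
  have hG : 0 < sieveTotal W D := sieveTotal_pos hD
  have hW' : (0 : ℝ) < W := by exact_mod_cast hW
  have hφ : (0 : ℝ) < W.totient := by exact_mod_cast Nat.totient_pos.mpr hW
  have hq' : (0 : ℝ) < √q := Real.sqrt_pos.mpr (by exact_mod_cast hq)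
  have hl := Real.log_natCast_nonneg N
  -- This is where uniformity in `W` is won: the lower bound for `sieveTotal` carries exactly the
  -- factor `φ(W)/W` present in `weightFactor`.
  have h3 : W.totient * Real.log N ≤ 400 * (W * sieveTotal W D) := by
    have h4 : Real.log N ≤ 400 * (W * sieveTotal W D) / W.totient := by
      calc _ ≤ 200 * (2 * ((W : ℝ) / W.totient * sieveTotal W D)) := hlog.trans (by gcongr)
        _ = _ := by ring
    rw [le_div_iff₀ hφ] at h4
    linarith
  have h5 : weightFactor W b N * (sigma W b / W) ≤ 800 * sieveTotal W D / W := by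
    unfold weightFactor
    rcases Nat.eq_zero_or_pos (sigma W b) with h | h
    · rw [h]; simp; positivity
    · have h1 : (0 : ℝ) < sigma W b := by exact_mod_cast h
      have h6 : 2 * (W.totient : ℝ) * Real.log N / (W * sigma W b) * (sigma W b / W) =
          2 * (W.totient * Real.log N) / (W * W) := by field_simp
      rw [h6, div_le_div_iff₀ (by positivity) hW']
      nlinarith
  calc _ ≤ weightFactor W b N * (2 * (#q.divisors : ℝ) ^ 6 * (sigma W b / W) /
        (√q * sieveTotal W D) * (3 * W * N)) := by
        have := weightFactor_nonneg W b N
        gcongr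
    _ = weightFactor W b N * (sigma W b / W) * (6 * (#q.divisors : ℝ) ^ 6 * W * N /
        (√q * sieveTotal W D)) := by ring
    _ ≤ 800 * sieveTotal W D / W * (6 * (#q.divisors : ℝ) ^ 6 * W * N /
        (√q * sieveTotal W D)) := by gcongr
    _ = _ := by field_simp; ring

theorem exists_card_divisors_pow_le {ε : ℝ} (hε : 0 < ε) : ∃ C : ℝ, 1 ≤ C ∧ ∀ q : ℕ, 0 < q →
    (#q.divisors : ℝ) ^ 6 / √q ≤ C * (q : ℝ) ^ (-1 / 2 + ε) := by
  obtain ⟨C, hC1, hC⟩ := exists_card_divisors_le (ε / 6) (by positivity)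
  refine ⟨C ^ 6, one_le_pow₀ hC1, fun q hq => ?_⟩
  have hq' : (0 : ℝ) < q := by exact_mod_cast hq
  have h1 : (#q.divisors : ℝ) ^ 6 ≤ C ^ 6 * (q : ℝ) ^ ε := by
    calc _ ≤ (C * (q : ℝ) ^ (ε / 6)) ^ 6 := by gcongr; exact hC q hq.ne'
      _ = _ := by
        rw [mul_pow, ← Real.rpow_mul_natCast hq'.le]
        congr 2; push_cast; ring
  have h2 : (q : ℝ) ^ (-1 / 2 + ε) = (q : ℝ) ^ ε / √q := by
    rw [Real.sqrt_eq_rpow, ← Real.rpow_sub hq']; congr 1; ring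
  rw [h2, ← mul_div_assoc]
  gcongr

/-- With `N = L ^ 200`, the error contains `q N |β| ≤ L ^ 80`, which together with `M ≤ L ^ 101` and
a few powers of `L` for `W`, `D` and the logarithm stays below `L ^ 190`. -/
theorem norm_sum_major_le_of_large {ε A : ℝ}
    (hA : ∀ q : ℕ, 0 < q → (#q.divisors : ℝ) ^ 6 / √q ≤ A * (q : ℝ) ^ (-1 / 2 + ε))
    {q W D M N b : ℕ} {L β : ℝ} (hD : 1 ≤ D) (hq : 0 < q) (hW : 0 < W) (h8 : 8 ∣ W) {a : ℤ}
    (ha : IsCoprime a q) (hb : Nat.Coprime b W) (hL : 10 ^ 4 ≤ L) (hN : (N : ℝ) = L ^ 200)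
    (hWL : (W : ℝ) ≤ L) (hNL : Real.log N ≤ L) (hDL : (D : ℝ) ≤ L)
    (hlog : Real.log N ≤ 200 * Real.log (D + 1)) (hM : (M : ℝ) ^ 2 ≤ 2 * W * N)
    (hML : (M : ℝ) ≤ L ^ 101) (hqL : (q : ℝ) ≤ L ^ 80) (hβ : q * |β| ≤ 1 / L ^ 120) :
    weightFactor W b N * ‖∑ x ∈ Icc 1 M, (x : ℂ) * ((sieveSq W D x : ℂ) *
      quadPhase W b (a / q + β) x)‖ ≤
      4800 * A * N * (q : ℝ) ^ (-1 / 2 + ε) / (1 + N * |β|) + L ^ 190 := by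
  have hL0 : 0 < L := by linarith
  have hC0 := weightFactor_nonneg W b N
  have hC1 : weightFactor W b N ≤ 2 * L := (weightFactor_le hW b N).trans (by linarith)
  have h1 := norm_sum_major_le hD hq hW hM a b β
  have h2 : ∑ x ∈ Icc 1 M, (x : ℂ) * ((sieveSq W D x : ℂ) * quadPhase W b (a / q + β) x) =
      ∑ x ∈ Icc 1 M, (x : ℂ) * e (β * ((x : ℝ) ^ 2 - b) / W) *
        ((sieveSq W D x : ℂ) * squarePhase q W a b x) := by
    refine sum_congr rfl fun x _ => ?_
    rw [quadPhase_eq_squarePhase_mul hq hW]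
    push_cast; ring
  rw [h2]
  refine (mul_le_mul_of_nonneg_left h1 hC0).trans ?_
  rw [mul_add]
  refine add_le_add ?_ ?_
  · have hden : 0 < 1 + N * |β| := by positivity
    rw [← mul_div_assoc, ← mul_div_assoc]
    refine div_le_div_of_nonneg_right ?_ hden.le
    refine (weightFactor_mul_norm_sieveMean_le hD hq hW h8 ha hb hlog).trans ?_
    calc _ ≤ 4800 * N * (A * (q : ℝ) ^ (-1 / 2 + ε)) := by gcongr; exact hA q hq
      _ = _ := by ring
  · have h3 : (q : ℝ) * (2 + 170 * (N * |β|)) ≤ 172 * L ^ 80 := by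
      have h4 : (N : ℝ) * (q * |β|) ≤ L ^ 80 := by
        calc _ ≤ L ^ 200 * (1 / L ^ 120) := by rw [hN]; gcongr
          _ = L ^ 80 := by field_simp
      nlinarith
    calc _ = weightFactor W b N * (4 * W * (D : ℝ) ^ 4 * M * (q * (2 + 170 * (N * |β|)))) := by ring
      _ ≤ 2 * L * (4 * L * L ^ 4 * L ^ 101 * (172 * L ^ 80)) := by gcongr
      _ = 1376 * L ^ 187 := by ring
      _ ≤ L ^ 3 * L ^ 187 := by
          gcongr
          calc (1376 : ℝ) ≤ (10 ^ 4) ^ 3 := by norm_num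
            _ ≤ L ^ 3 := by gcongr
      _ = _ := by ring

theorem norm_sum_minor_le_of_large {q W D M N b : ℕ} {L θ : ℝ} (hD : 1 ≤ D) (hq : 0 < q)
    (hW : 0 < W) {a : ℤ} (ha : IsCoprime a q) (hL : 10 ^ 4 ≤ L)
    (hWL : (W : ℝ) ≤ L) (hNL : Real.log N ≤ L) (hDL : (D : ℝ) ≤ L)
    (hML : (M : ℝ) ≤ L ^ 101) (hqL : L ^ 80 ≤ q) (hqL' : (q : ℝ) ≤ L ^ 120)
    (hθ : q * |θ - a / q| ≤ 1 / L ^ 120) :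
    weightFactor W b N * ‖∑ x ∈ Icc 1 M, (x : ℂ) * ((sieveSq W D x : ℂ) * quadPhase W b θ x)‖ ≤
      L ^ 190 := by
  have hL0 : 0 < L := by linarith
  have hL1 : 1 ≤ L := by linarith
  have hq' : (0 : ℝ) < q := by exact_mod_cast hq
  have hC0 := weightFactor_nonneg W b N
  have hC1 : weightFactor W b N ≤ 2 * L := (weightFactor_le hW b N).trans (by linarith)
  set K := 2 * D ^ 4 * M with hK
  have hKL : (K : ℝ) ≤ 2 * L ^ 105 := by
    rw [hK]; push_cast
    calc 2 * (D : ℝ) ^ 4 * M ≤ 2 * L ^ 4 * L ^ 101 := by gcongr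
      _ = _ := by ring
  have hKθ : K * |θ - a / q| ≤ 1 / q := by
    have h1 : |θ - a / q| ≤ 1 / L ^ 120 / q := by
      rw [le_div_iff₀ hq']; linarith
    calc _ ≤ L ^ 106 * (1 / L ^ 120 / q) := by
          gcongr
          calc _ ≤ 2 * L ^ 105 := hKL
            _ ≤ L * L ^ 105 := by gcongr; linarith
            _ = _ := by ring
      _ = (1 / L ^ 14) * (1 / q) := by field_simp
      _ ≤ 1 * (1 / q) := by
          gcongr
          rw [div_le_one (by positivity)]
          exact one_le_pow₀ hL1
      _ = _ := one_mul _
  have hcard := card_nnInt_le hq ha (ρ := 1 / L ^ 60) (by positivity) hKθ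
  have h1 : (2 * (1 / L ^ 60 * (q : ℝ)) + 3) * (K / q + 1) ≤ 25 * L ^ 60 := by
    have h2 : (K : ℝ) / q ≤ 2 * L ^ 25 := by
      rw [div_le_iff₀ hq']
      calc _ ≤ 2 * L ^ 105 := hKL
        _ = 2 * L ^ 25 * L ^ 80 := by ring
        _ ≤ _ := by gcongr
    have h3 : 1 / L ^ 60 * (q : ℝ) ≤ L ^ 60 := by
      calc _ ≤ 1 / L ^ 60 * L ^ 120 := by gcongr
        _ = _ := by field_simp
    have h4 : 1 / L ^ 60 * (q : ℝ) * (K / q) ≤ 2 * L ^ 45 := by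
      calc _ = 1 / L ^ 60 * (K : ℝ) := by field_simp
        _ ≤ 1 / L ^ 60 * (2 * L ^ 105) := by gcongr
        _ = _ := by field_simp
    have h5 : L ^ 45 ≤ L ^ 60 := pow_le_pow_right₀ hL1 (by norm_num)
    have h6 : L ^ 25 ≤ L ^ 60 := pow_le_pow_right₀ hL1 (by norm_num)
    have h7 : 1 ≤ L ^ 60 := one_le_pow₀ hL1
    nlinarith
  -- With `ρ = L ^ (-60)`, both `W/ρ` and the count are about `L ^ 60` up to a factor of order `L`;
  -- multiplied by `M ≤ L ^ 101` this is below `L ^ 164`, the square of the chosen `B = L ^ 82`.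
  have h2 := norm_sum_minor_le (W := W) (D := D) (M := M) (K := K) (θ := θ) (ρ := 1 / L ^ 60)
    (B := L ^ 82) hD hW (by positivity) (by positivity) le_rfl b (by
      calc _ ≤ L ^ 101 * (L ^ 60 + L / (1 / L ^ 60) + 2 * (25 * L ^ 60)) := by
            gcongr
            · exact one_le_pow₀ hL1
            · exact hcard.trans h1
        _ = L ^ 161 * (51 + L) := by field_simp; ring
        _ ≤ L ^ 161 * L ^ 3 := by
            gcongr
            nlinarith [mul_pos hL0 hL0]
        _ = _ := by ring)
  calc _ ≤ 2 * L * ((D : ℝ) ^ 4 * L ^ 82 * (2 * M)) := by gcongr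
    _ ≤ 2 * L * (L ^ 4 * L ^ 82 * (2 * L ^ 101)) := by gcongr
    _ = 4 * L ^ 188 := by ring
    _ ≤ L ^ 2 * L ^ 188 := by gcongr; nlinarith
    _ = _ := by ring

theorem nnInt_sub_le (θ : ℝ) {q : ℕ} (hq : 0 < q) (a : ℤ) :
    ∃ a' : ℕ, a' < q ∧ nnInt (θ - a' / q) ≤ |θ - a / q| := by
  have hq' : (q : ℝ) ≠ 0 := by exact_mod_cast hq.ne'
  have hq0 : (0 : ℤ) < q := by exact_mod_cast hq
  refine ⟨(a % q).toNat, ?_, ?_⟩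
  · have := Int.emod_lt_of_pos a hq0
    have := Int.emod_nonneg a hq0.ne'
    omega
  · have h1 : (((a % q).toNat : ℕ) : ℝ) = a - q * ((a / q : ℤ) : ℝ) := by
      have h2 : (((a % q).toNat : ℕ) : ℤ) = a - q * (a / q) := by
        rw [Int.toNat_of_nonneg (Int.emod_nonneg a hq0.ne'), Int.emod_def]
      exact_mod_cast congrArg (Int.cast : ℤ → ℝ) h2
    have h3 := nnInt_le (θ - ((a % q).toNat : ℕ) / q) (a / q)
    refine h3.trans_eq ?_
    rw [h1]
    congr 1
    field_simp
    ring

/-- The Fourier transform of the majorant is small away from rationals of small denominator. -/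
theorem exists_norm_sum_majorantWeight_le {ε : ℝ} (hε : 0 < ε) : ∃ A : ℝ, 1 ≤ A ∧
    ∀ (W D M N b : ℕ) (L : ℝ), 0 < W → 8 ∣ W → Nat.Coprime b W → 10 ^ 4 ≤ L → (N : ℝ) = L ^ 200 →
      (W : ℝ) ≤ L → Real.log N ≤ L → D = ⌊L⌋₊ → (M : ℝ) ^ 2 ≤ 2 * W * N → ∀ θ : ℝ,
      ∃ q a : ℕ, 1 ≤ q ∧ a < q ∧
        ‖∑ x ∈ squareRoots W b M, (majorantWeight W D b N x : ℂ) *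
          e ((((x : ℤ) ^ 2 - b) / W : ℤ) * θ)‖ ≤
          A * N * (q : ℝ) ^ (-1 / 2 + ε) / (1 + N * nnInt (θ - a / q)) + L ^ 198 := by
  obtain ⟨A, hA1, hA⟩ := exists_card_divisors_pow_le hε
  refine ⟨4800 * A, by linarith, ?_⟩
  intro W D M N b L hW h8 hb hL hN hWL hNL hDdef hM θ
  have hL0 : 0 < L := by linarith
  have hL1 : 1 ≤ L := by linarith
  have hD : 1 ≤ D := by rw [hDdef]; exact Nat.le_floor (by exact_mod_cast hL1)
  have hDL : (D : ℝ) ≤ L := by rw [hDdef]; exact Nat.floor_le hL0.le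
  have hlog : Real.log N ≤ 200 * Real.log (D + 1) := by
    rw [hN, Real.log_pow]
    push_cast
    gcongr
    rw [hDdef]; exact (Nat.lt_floor_add_one L).le
  have hML : (M : ℝ) ≤ L ^ 101 := by
    refine (abs_le_of_sq_le_sq' ?_ (by positivity)).2
    calc (M : ℝ) ^ 2 ≤ 2 * W * N := hM
      _ ≤ L * L * L ^ 200 := by rw [hN]; gcongr; linarith
      _ = _ := by ring
  -- Dirichlet's theorem at this level: denominators up to `L ^ 80` give the major arcs, those
  -- between `L ^ 80` and `L ^ 120` the minor arcs.
  set n := ⌊L ^ 120⌋₊ with hn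
  have hnpos : 0 < n := Nat.floor_pos.mpr (one_le_pow₀ hL1)
  obtain ⟨r, hr1, hr2⟩ := Real.exists_rat_abs_sub_le_and_den_le θ hnpos
  set q := r.den with hq
  set a := r.num with ha
  have hqpos : 0 < q := r.den_pos
  have hq' : (0 : ℝ) < q := by exact_mod_cast hqpos
  have hr : (r : ℝ) = a / q := by rw [Rat.cast_def]
  rw [hr] at hr1
  have hcop : IsCoprime a q := Rat.isCoprime_num_den r
  have hqn : (q : ℝ) ≤ L ^ 120 := by
    calc (q : ℝ) ≤ n := by exact_mod_cast hr2
      _ ≤ _ := Nat.floor_le (by positivity)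
  have hθ : q * |θ - a / q| ≤ 1 / L ^ 120 := by
    have h1 : L ^ 120 ≤ n + 1 := (Nat.lt_floor_add_one _).le
    calc q * |θ - a / q| ≤ q * (1 / ((n + 1) * q)) := by gcongr
      _ = 1 / (n + 1) := by field_simp
      _ ≤ _ := by gcongr
  have hC0 := weightFactor_nonneg W b N
  have hC1 : weightFactor W b N ≤ 2 * L := (weightFactor_le hW b N).trans (by linarith)
  obtain ⟨a', ha', ha'2⟩ := nnInt_sub_le θ hqpos a
  refine ⟨q, a', hqpos, ha', ?_⟩
  have hsplit : ∑ x ∈ squareRoots W b M, (majorantWeight W D b N x : ℂ) *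
        e ((((x : ℤ) ^ 2 - b) / W : ℤ) * θ) =
      weightFactor W b N * ∑ x ∈ Icc 1 M, (x : ℂ) * ((sieveSq W D x : ℂ) * quadPhase W b θ x) +
        weightFactor W b N * ∑ x ∈ Icc 1 M, if x ≤ D then (x : ℂ) * quadPhase W b θ x else 0 := by
    rw [sum_squareRoots_eq_quadPhase hW, mul_sum, mul_sum, ← sum_add_distrib]
    refine sum_congr rfl fun x _ => ?_
    unfold majorantWeight
    split_ifs <;> push_cast <;> ring
  have hsmall : ‖∑ x ∈ Icc 1 M, if x ≤ D then (x : ℂ) * quadPhase W b θ x else 0‖ ≤ L * L := by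
    rw [← sum_filter]
    calc _ ≤ ∑ x ∈ (Icc 1 M).filter (· ≤ D), (D : ℝ) := by
          refine norm_sum_le_of_le _ fun x hx => ?_
          have hxD : (x : ℝ) ≤ D := by exact_mod_cast (mem_filter.mp hx).2
          rw [norm_mul, Complex.norm_natCast]
          have : ‖quadPhase W b θ x‖ ≤ 1 := by
            unfold quadPhase; split_ifs
            · exact (norm_e _).le
            · simp
          nlinarith [norm_nonneg (quadPhase W b θ x), x.cast_nonneg (α := ℝ)]
      _ = #((Icc 1 M).filter (· ≤ D)) * (D : ℝ) := by simp
      _ ≤ D * D := by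
          gcongr
          calc #((Icc 1 M).filter (· ≤ D)) ≤ #(Icc 1 D) := by
                refine card_le_card fun x hx => ?_
                simp only [mem_filter, mem_Icc] at hx ⊢
                exact ⟨hx.1.1, hx.2⟩
            _ = D := by simp
      _ ≤ _ := by gcongr
  have hmain : weightFactor W b N *
      ‖∑ x ∈ Icc 1 M, (x : ℂ) * ((sieveSq W D x : ℂ) * quadPhase W b θ x)‖ ≤
      4800 * A * N * (q : ℝ) ^ (-1 / 2 + ε) / (1 + N * nnInt (θ - a' / q)) + L ^ 190 := by
    rcases le_or_gt (q : ℝ) (L ^ 80) with hc | hc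
    · have h1 := norm_sum_major_le_of_large (β := θ - a / q) hA hD hqpos hW h8 hcop hb hL hN hWL hNL
        hDL hlog hM hML hc hθ
      rw [add_sub_cancel] at h1
      refine h1.trans ?_
      have := nnInt_nonneg (θ - a' / q)
      gcongr
    · refine (norm_sum_minor_le_of_large hD hqpos hW hcop hL hWL hNL hDL hML hc.le hqn hθ).trans ?_
      have := nnInt_nonneg (θ - a' / q)
      have : 0 ≤ 4800 * A * N * (q : ℝ) ^ (-1 / 2 + ε) / (1 + N * nnInt (θ - a' / q)) := by
        positivity
      linarith
  rw [hsplit]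
  refine (norm_add_le _ _).trans ?_
  rw [norm_mul, norm_mul, Complex.norm_real, Real.norm_of_nonneg hC0]
  have h2 : weightFactor W b N * ‖∑ x ∈ Icc 1 M, if x ≤ D then (x : ℂ) * quadPhase W b θ x else 0‖ ≤
      2 * L * (L * L) := by gcongr
  have h3 : 2 * L * (L * L) ≤ L ^ 190 := by
    calc 2 * L * (L * L) ≤ L * L * (L * L) := by gcongr; linarith
      _ = L ^ 4 := by ring
      _ ≤ _ := pow_le_pow_right₀ hL1 (by norm_num)
  have h4 : 2 * L ^ 190 ≤ L ^ 198 := by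
    calc 2 * L ^ 190 ≤ L * L ^ 190 := by gcongr; linarith
      _ = L ^ 191 := by ring
      _ ≤ _ := pow_le_pow_right₀ hL1 (by norm_num)
  linarith

/-! ### The weighted prime squares and their majorant -/

theorem modulus_pos (w : ℝ) : 0 < modulus w := by
  unfold modulus
  refine Nat.mul_pos (by norm_num) (prod_pos fun p hp => ?_)
  exact (mem_filter.mp hp).2.pos

theorem eight_dvd_modulus (w : ℝ) : 8 ∣ modulus w := Dvd.intro _ rfl

theorem log_sieveLevel_nonneg {δ : ℝ} (hδ : δ < 1 / 8) {N : ℕ} (hN : 1 ≤ N) :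
    0 ≤ Real.log (sieveLevel δ N) := by
  refine Real.log_nonneg (Real.one_le_rpow (by exact_mod_cast hN) (by linarith))

theorem log_sieveLevel_le {δ : ℝ} (hδ : 0 < δ) {N : ℕ} (hN : 1 ≤ N) :
    Real.log (sieveLevel δ N) ≤ Real.log N := by
  have hN' : (1 : ℝ) ≤ N := by exact_mod_cast hN
  have := Real.log_nonneg hN'
  rw [sieveLevel, Real.log_rpow (by linarith)]
  nlinarith

theorem a_nonneg {w δ : ℝ} (hδ : δ < 1 / 8) {b N : ℕ} (hN : 1 ≤ N) (n : ℤ) : 0 ≤ a w δ b N n := by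
  have := log_sieveLevel_nonneg hδ hN
  unfold a
  split_ifs
  · positivity
  · exact le_rfl

theorem modulus_mul_ediv_add {W b M x : ℕ} (hx : x ∈ squareRoots W b M) :
    (W : ℤ) * (((x : ℤ) ^ 2 - b) / W) + b = (x : ℤ) ^ 2 := by
  rw [Int.mul_ediv_cancel' (mem_filter.mp hx).2]; ring

theorem ediv_injOn_squareRoots (W b M : ℕ) :
    Set.InjOn (fun x : ℕ => ((x : ℤ) ^ 2 - b) / W) (squareRoots W b M : Set ℕ) := by
  intro x hx y hy h
  have h1 := modulus_mul_ediv_add hx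
  have h2 := modulus_mul_ediv_add hy
  simp only at h
  rw [h, h2] at h1
  have h3 : y ^ 2 = x ^ 2 := by exact_mod_cast h1
  exact (Nat.pow_left_injective two_ne_zero h3).symm

/-- The equation `W n + b = x²` matches `n` with `x`. All square roots may be admitted, prime or
not, since `a` vanishes at the irrelevant ones. -/
theorem fourierTransform_a_eq_sum_squareRoots (w δ : ℝ) (b N : ℕ) (θ : ℝ) :
    fourierTransform (a w δ b N) θ =
      ∑ x ∈ squareRoots (modulus w) b ⌊√((modulus w : ℝ) * N + b)⌋₊,
        (a w δ b N (((x : ℤ) ^ 2 - b) / modulus w) : ℂ) *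
          e ((((x : ℤ) ^ 2 - b) / modulus w : ℤ) * θ) := by
  rw [fourierTransform_a]
  symm
  refine sum_bij_ne_zero (fun x _ _ => ((x : ℤ) ^ 2 - b) / modulus w) ?_ ?_ ?_ ?_
  · intro x _ hne
    by_contra hn
    refine hne ?_
    rw [a, if_neg fun hc => hn (mem_Icc.mpr hc.1)]
    simp
  · intro x hx _ y hy _ h
    exact ediv_injOn_squareRoots _ _ _ hx hy h
  · intro n hn hne
    have hc : IsPrimeSquarePoint (modulus w) b N (sieveLevel δ N) n := by
      by_contra hc
      refine hne ?_
      rw [a, if_neg fun h => hc h.2]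
      simp
    obtain ⟨x, hx, hxn, hz, hxM⟩ := hc
    have hW : (modulus w : ℤ) ≠ 0 := by exact_mod_cast (modulus_pos w).ne'
    have h1 : (x : ℤ) ^ 2 - b = modulus w * n := by linarith
    have h2 : ((x : ℤ) ^ 2 - b) / modulus w = n := by
      rw [h1, Int.mul_ediv_cancel_left _ hW]
    refine ⟨x, ?_, ?_, h2⟩
    · exact mem_filter.mpr ⟨mem_Icc.mpr ⟨hx.one_le, Nat.le_floor hxM⟩, Dvd.intro _ h1.symm⟩
    · rw [h2]; exact hne
  · intro x _ _; rfl

theorem sieveSq_of_prime {W D x : ℕ} (hD : 1 ≤ D) (hx : x.Prime) (hDx : D < x) :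
    sieveSq W D x = 1 := by
  have h1 : (Icc 1 D).filter (· ∣ x) = {1} := by
    ext d
    simp only [mem_filter, mem_Icc, mem_singleton]
    constructor
    · rintro ⟨⟨h1, h2⟩, h3⟩
      rcases (Nat.dvd_prime hx).mp h3 with h | h
      · exact h
      · omega
    · rintro rfl
      exact ⟨⟨le_rfl, hD⟩, one_dvd _⟩
  rw [sieveSq, h1, sum_singleton, sieveWeight_one hD, one_pow]

/-- The parameter `δ` enters only here, through `log z ≤ log N`, and in the nonnegativity of `log
z`. -/
theorem a_le_weightFactor_mul {w δ : ℝ} (hδ0 : 0 < δ) {b N M x : ℕ} (hN : 1 ≤ N)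
    (hx : x ∈ squareRoots (modulus w) b M) :
    a w δ b N (((x : ℤ) ^ 2 - b) / modulus w) ≤ weightFactor (modulus w) b N * x ∧
      (¬ x.Prime → a w δ b N (((x : ℤ) ^ 2 - b) / modulus w) = 0) := by
  have hC0 := weightFactor_nonneg (modulus w) b N
  have h1 := modulus_mul_ediv_add hx
  set n := ((x : ℤ) ^ 2 - b) / modulus w with hn
  have h2 : √((modulus w : ℝ) * n + b) = x := by
    have h3 : (modulus w : ℝ) * n + b = (x : ℝ) ^ 2 := by exact_mod_cast h1
    rw [h3, Real.sqrt_sq (Nat.cast_nonneg x)]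
  unfold a
  split_ifs with hc
  · refine ⟨?_, fun hnp => ?_⟩
    · rw [h2, weightFactor, div_mul_eq_mul_div]
      have := log_sieveLevel_le hδ0 hN
      refine div_le_div_of_nonneg_right ?_ (by positivity)
      calc 2 * ((modulus w).totient : ℝ) * x * Real.log (sieveLevel δ N)
          ≤ 2 * ((modulus w).totient : ℝ) * x * Real.log N := by gcongr
        _ = _ := by ring
    · obtain ⟨y, hy, hyn, -⟩ := hc.2
      rw [h1] at hyn
      have h3 : x ^ 2 = y ^ 2 := by exact_mod_cast hyn
      rw [Nat.pow_left_injective two_ne_zero h3] at hnp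
      exact absurd hy hnp
  · exact ⟨by positivity, fun _ => rfl⟩

theorem a_le_majorantWeight {w δ : ℝ} (hδ0 : 0 < δ) {b N M D x : ℕ} (hN : 1 ≤ N) (hD : 1 ≤ D)
    (hx : x ∈ squareRoots (modulus w) b M) :
    a w δ b N (((x : ℤ) ^ 2 - b) / modulus w) ≤ majorantWeight (modulus w) D b N x := by
  have hC0 := weightFactor_nonneg (modulus w) b N
  have hsq := sieveSq_nonneg (modulus w) D x
  obtain ⟨h1, h2⟩ := a_le_weightFactor_mul (δ := δ) hδ0 hN hx
  unfold majorantWeight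
  by_cases hp : x.Prime
  · refine h1.trans (mul_le_mul_of_nonneg_left ?_ hC0)
    refine le_mul_of_one_le_right (Nat.cast_nonneg x) ?_
    -- Primes up to `D` are covered by the extra indicator in `majorantWeight`; for larger ones the
    -- only divisor in the sieve sum is 1, of weight 1.
    split_ifs with hxD
    · linarith
    · rw [sieveSq_of_prime hD hp (not_le.mp hxD)]; norm_num
  · rw [h2 hp]
    have : (0 : ℝ) ≤ if x ≤ D then 1 else 0 := by split_ifs <;> norm_num
    positivity

theorem exists_log_le_rpow (c : ℝ) {η : ℝ} (hη : 0 < η) :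
    ∀ᶠ N : ℕ in Filter.atTop, c * Real.log N ≤ (N : ℝ) ^ η := by
  have h1 := (isLittleO_log_rpow_atTop hη).comp_tendsto tendsto_natCast_atTop_atTop
  have h2 := h1.bound (show 0 < 1 / (|c| + 1) by positivity)
  filter_upwards [h2] with N hN
  simp only [Function.comp] at hN
  have h3 : (0 : ℝ) ≤ (N : ℝ) ^ η := by positivity
  rw [Real.norm_of_nonneg (Real.log_natCast_nonneg N), Real.norm_of_nonneg h3, one_div,
    inv_mul_eq_div, le_div_iff₀ (by positivity)] at hN
  have h4 := Real.log_natCast_nonneg N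
  nlinarith [le_abs_self c]

/-- The square root bounds on the range of the square roots. -/
theorem floor_sqrt_sq_le {W b N : ℕ} (hb : b ≤ W) (hN : 1 ≤ N) :
    ((⌊√((W : ℝ) * N + b)⌋₊ : ℕ) : ℝ) ^ 2 ≤ 2 * W * N := by
  have h0 : (0 : ℝ) ≤ (W : ℝ) * N + b := by positivity
  have hb' : (b : ℝ) ≤ W := by exact_mod_cast hb
  have hN' : (1 : ℝ) ≤ N := by exact_mod_cast hN
  calc _ ≤ √((W : ℝ) * N + b) ^ 2 := by gcongr; exact Nat.floor_le (Real.sqrt_nonneg _)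
    _ = W * N + b := Real.sq_sqrt h0
    _ ≤ _ := by nlinarith [W.cast_nonneg (α := ℝ)]

/-! ### The restriction estimate -/

theorem continuous_norm_fourierTransform_a (w δ : ℝ) (b N : ℕ) :
    Continuous fun θ => ‖fourierTransform (a w δ b N) θ‖ := by
  simp_rw [fourierTransform_a]
  refine continuous_norm.comp (continuous_finsetSum _ fun n _ => continuous_const.mul ?_)
  exact continuous_e.comp (continuous_const.mul continuous_id)

theorem integral_norm_fourierTransform_pow_four_le {η : ℝ} (hη : 0 < η) :
    ∀ᶠ N : ℕ in Filter.atTop, ∀ w δ : ℝ, 0 < δ → δ < 1 / 8 → ∀ b : ℕ, 1 ≤ b → b ≤ modulus w →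
      (modulus w : ℝ) ≤ Real.log N →
      ∫ θ in Set.Icc (0 : ℝ) 1, ‖fourierTransform (a w δ b N) θ‖ ^ 4 ≤ (N : ℝ) ^ (3 + η) := by
  obtain ⟨C, hC1, hC⟩ := exists_fourth_moment_le (η / 2) (by positivity)
  filter_upwards [exists_log_le_rpow (128 * C) (show 0 < η / 14 by positivity),
    exists_log_le_rpow 2 one_pos, Filter.eventually_ge_atTop 1] with N h1 h2 hN
    w δ hδ0 hδ1 b hb1 hbW hWN
  have hN' : (1 : ℝ) ≤ N := by exact_mod_cast hN
  have hN0 : (0 : ℝ) < N := by linarith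
  rw [Real.rpow_one] at h2
  set l := Real.log N with hl
  have hl0 : 0 ≤ l := Real.log_natCast_nonneg N
  set W := modulus w with hW
  have hWpos : 0 < W := modulus_pos w
  set M := ⌊√((W : ℝ) * N + b)⌋₊ with hM
  have hb' : (1 : ℝ) ≤ b := by exact_mod_cast hb1
  have hM1 : 1 ≤ M := by
    refine Nat.le_floor ?_
    rw [Nat.cast_one, Real.one_le_sqrt]
    have : 0 ≤ (W : ℝ) * N := by positivity
    linarith
  have hM2 : (M : ℝ) ^ 2 ≤ 2 * W * N := floor_sqrt_sq_le hbW hN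
  have hM3 : (M : ℝ) ^ 2 ≤ 2 * l * N := hM2.trans (by gcongr)
  have hMN : (M : ℝ) ≤ N := (abs_le_of_sq_le_sq' (by nlinarith) hN0.le).2
  simp_rw [fourierTransform_a_eq_sum_squareRoots]
  refine (hC M W b (squareRoots W b M) (fun x => ((x : ℤ) ^ 2 - b) / W)
    (fun x => a w δ b N (((x : ℤ) ^ 2 - b) / W)) (2 * l * M) hM1 hWpos (filter_subset _ _)
    (fun x hx => modulus_mul_ediv_add hx) (fun x _ => a_nonneg hδ1 hN _) (fun x hx => ?_)).trans ?_
  · refine (a_le_weightFactor_mul hδ0 hN hx).1.trans ?_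
    have hxM : (x : ℝ) ≤ M := by exact_mod_cast (mem_Icc.mp (mem_filter.mp hx).1).2
    have := weightFactor_le hWpos b N
    gcongr
  · have hMpos : (0 : ℝ) < M := by exact_mod_cast hM1
    -- Seven logarithms must be absorbed: four from the weights and three from `M ^ 6 ≤ (2 * l * N)
    -- ^ 3`. Hence the exponent `η / 14`.
    have h3 : (128 * C * l) ^ 7 ≤ (N : ℝ) ^ (η / 2) := by
      calc _ ≤ ((N : ℝ) ^ (η / 14)) ^ 7 := by gcongr
        _ = _ := by
          rw [← Real.rpow_mul_natCast hN0.le]; congr 1; push_cast; ring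
    have h4 : 128 * C * l ^ 7 ≤ (128 * C * l) ^ 7 := by
      rw [mul_pow]
      gcongr
      exact le_self_pow₀ (by linarith) (by norm_num)
    calc C * (2 * l * M) ^ 4 * (M : ℝ) ^ (2 + η / 2)
        = 16 * C * l ^ 4 * ((M : ℝ) ^ 2) ^ 3 * (M : ℝ) ^ (η / 2) := by
          rw [Real.rpow_add hMpos, Real.rpow_two]; ring
      _ ≤ 16 * C * l ^ 4 * (2 * l * N) ^ 3 * (N : ℝ) ^ (η / 2) := by gcongr
      _ = 128 * C * l ^ 7 * (N : ℝ) ^ (η / 2) * (N : ℝ) ^ 3 := by ring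
      _ ≤ (N : ℝ) ^ (η / 2) * (N : ℝ) ^ (η / 2) * (N : ℝ) ^ 3 := by
          gcongr; exact h4.trans h3
      _ = _ := by
          rw [← Real.rpow_add hN0, Real.rpow_add hN0 3 η, mul_comm]
          congr 1
          · norm_cast
          · congr 1; ring

theorem exists_integral_fourierTransform_rpow_le {p : ℝ} (hp : 4 < p) : ∃ C : ℝ, 0 ≤ C ∧
    ∀ᶠ N : ℕ in Filter.atTop, ∀ w δ : ℝ, 0 < δ → δ < 1 / 8 → ∀ b : ℕ, 1 ≤ b → b ≤ modulus w →
      Nat.Coprime b (modulus w) → (modulus w : ℝ) ≤ Real.log N →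
      ∫ θ in Set.Icc (0 : ℝ) 1, ‖fourierTransform (a w δ b N) θ‖ ^ p ≤
        C * (N : ℝ) ^ (p - 1) := by
  -- The second entry makes `r = 4 + 11ε` at most the midpoint of 4 and `p`.
  set ε : ℝ := min (1 / 20) ((p - 4) / 22) with hε
  have hε0 : 0 < ε := lt_min (by norm_num) (by linarith)
  have hε1 : ε ≤ 1 / 20 := min_le_left _ _
  have hε2 : ε ≤ (p - 4) / 22 := min_le_right _ _
  set r : ℝ := 4 + 11 * ε with hr
  have hrp : r < p := by rw [hr]; linarith
  obtain ⟨A, hA1, hA⟩ := exists_norm_sum_majorantWeight_le hε0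
  obtain ⟨α₁, C, hα₁, hα₁1, hC0, hC⟩ := exists_measure_level_le (κ := 1 / 100) hε0 hε1
    (by norm_num) (by norm_num) hA1
  set C' : ℝ := p * (C * ((A + 1) / α₁) ^ r * ((A + 1) ^ (p - r) / (p - r))) with hC'
  have hC'0 : 0 ≤ C' := by
    have : 0 < p - r := by linarith
    positivity
  refine ⟨1 + C', by positivity, ?_⟩
  have hη : 0 < (p - 4) / 800 := by linarith
  have hbig : ∀ᶠ N : ℕ in Filter.atTop, (10 : ℝ) ^ 4 ≤ (N : ℝ) ^ (1 / 200 : ℝ) :=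
    ((tendsto_rpow_atTop (by norm_num)).comp tendsto_natCast_atTop_atTop).eventually_ge_atTop _
  have hsmall : ∀ᶠ N : ℕ in Filter.atTop, (N : ℝ) ^ (-(1 / 100) / 8 : ℝ) ≤ α₁ := by
    have h1 := (tendsto_rpow_neg_atTop (show (0 : ℝ) < 1 / 800 by norm_num)).comp
      (tendsto_natCast_atTop_atTop (R := ℝ))
    filter_upwards [h1.eventually_le_const hα₁] with N h
    refine le_of_eq_of_le ?_ h
    simp only [Function.comp]
    congr 1; norm_num
  filter_upwards [integral_norm_fourierTransform_pow_four_le hη, hbig, hsmall,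
    exists_log_le_rpow 1 (show (0 : ℝ) < 1 / 200 by norm_num), Filter.eventually_ge_atTop 1]
    with N h4 hL hα hlog hN w δ hδ0 hδ1 b hb1 hbW hbc hWN
  have hN' : (1 : ℝ) ≤ N := by exact_mod_cast hN
  have hN0 : (0 : ℝ) < N := by linarith
  rw [one_mul] at hlog
  set L : ℝ := (N : ℝ) ^ (1 / 200 : ℝ) with hLdef
  have hNL : (N : ℝ) = L ^ 200 := by
    rw [hLdef, ← Real.rpow_mul_natCast hN0.le]; norm_num
  have hL198 : L ^ 198 = (N : ℝ) ^ (1 - 1 / 100 : ℝ) := by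
    rw [hLdef, ← Real.rpow_mul_natCast hN0.le]; congr 1; norm_num
  set W := modulus w with hW
  set M := ⌊√((W : ℝ) * N + b)⌋₊ with hM
  have hM2 : (M : ℝ) ^ 2 ≤ 2 * W * N := floor_sqrt_sq_le hbW hN
  have hD : 1 ≤ ⌊L⌋₊ := Nat.le_floor (by push_cast; linarith)
  have hV := hA W ⌊L⌋₊ M N b L (modulus_pos w) (eight_dvd_modulus w) hbc hL hNL (hWN.trans hlog) hlog
    rfl hM2
  rw [hL198] at hV
  set s := squareRoots W b M with hs
  set k : ℕ → ℤ := fun x => ((x : ℤ) ^ 2 - b) / W with hk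
  set c : ℕ → ℝ := fun x => a w δ b N (k x) with hc
  set ν : ℕ → ℝ := majorantWeight W ⌊L⌋₊ b N with hν
  have hS : ∀ θ, fourierTransform (a w δ b N) θ = ∑ x ∈ s, (c x : ℂ) * e (k x * θ) :=
    fourierTransform_a_eq_sum_squareRoots w δ b N
  have hc0 : ∀ x ∈ s, 0 ≤ c x := fun x _ => a_nonneg hδ1 hN _
  have hcν : ∀ x ∈ s, c x ≤ ν x := fun x hx => a_le_majorantWeight hδ0 hN hD hx
  have hlevel := hC s k c ν N hN hc0 hcν hV
  set f : ℝ → ℝ := fun θ => ‖fourierTransform (a w δ b N) θ‖ / N with hf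
  have hfc : Continuous f := (continuous_norm_fourierTransform_a w δ b N).div_const _
  have hf0 : ∀ θ, 0 ≤ f θ := fun θ => by positivity
  have hfle : ∀ θ, f θ ≤ A + 1 := by
    intro θ
    rw [hf]; simp only
    rw [div_le_iff₀ hN0, hS]
    obtain ⟨q, a', hq1, -, hq⟩ := hV 0
    have h1 : ‖∑ x ∈ s, (c x : ℂ) * e (k x * θ)‖ ≤ ∑ x ∈ s, ν x := by
      refine norm_sum_le_of_le _ fun x hx => ?_
      rw [norm_mul, norm_e, mul_one, Complex.norm_real, Real.norm_of_nonneg (hc0 x hx)]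
      exact hcν x hx
    have h2 : ∑ x ∈ s, ν x ≤ ‖∑ x ∈ s, (ν x : ℂ) * e (k x * 0)‖ := by
      simp_rw [mul_zero, e_zero, mul_one]
      rw [← Complex.ofReal_sum, Complex.norm_real]
      exact Real.le_norm_self _
    refine h1.trans (h2.trans (hq.trans ?_))
    have hq' : (1 : ℝ) ≤ q := by exact_mod_cast hq1
    have h3 : (q : ℝ) ^ (-1 / 2 + ε) ≤ 1 := Real.rpow_le_one_of_one_le_of_nonpos hq' (by linarith)
    have h4 : (N : ℝ) ^ (1 - 1 / 100 : ℝ) ≤ N := by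
      calc _ ≤ (N : ℝ) ^ (1 : ℝ) := Real.rpow_le_rpow_of_exponent_le hN' (by norm_num)
        _ = N := Real.rpow_one _
    have h5 : A * N * (q : ℝ) ^ (-1 / 2 + ε) / (1 + N * nnInt (0 - a' / q)) ≤ A * N := by
      have := nnInt_nonneg (0 - a' / q)
      have h6 : 1 ≤ 1 + N * nnInt (0 - a' / q) := by
        have : 0 ≤ N * nnInt (0 - a' / q) := by positivity
        linarith
      refine (div_le_self (by positivity) h6).trans ?_
      exact mul_le_of_le_one_right (by positivity) h3
    linarith
  have hJ : ∫ θ in Set.Icc (0 : ℝ) 1, f θ ^ 4 ≤ (N : ℝ) ^ (-1 + (p - 4) / 800) := by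
    have h1 : ∀ θ, f θ ^ 4 = ‖fourierTransform (a w δ b N) θ‖ ^ 4 / (N : ℝ) ^ 4 :=
      fun θ => div_pow _ _ _
    simp_rw [h1]
    rw [integral_div, div_le_iff₀ (by positivity)]
    refine (h4 w δ hδ0 hδ1 b hb1 hbW hWN).trans_eq ?_
    rw [← Real.rpow_natCast (N : ℝ) 4, ← Real.rpow_add hN0]
    congr 1; push_cast; ring
  have hmain := integral_rpow_le_of_level hfc hf0 (M := A + 1) (p := p) (r := r) (C := C / N)
    (by linarith) hfle (by rw [hr]; linarith) hrp (by positivity) (by positivity) hα hα₁1 hJ (by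
      intro α hα0 hα1
      have h1 := hlevel α hα0 hα1 {x ∈ Set.Icc (0 : ℝ) 1 | α ≤ f x}
        (measurableSet_Icc.inter (measurableSet_le measurable_const hfc.measurable))
        (fun x hx => hx.1) (fun θ hθ => by
          have h2 := hθ.2
          simp only [hf] at h2
          rw [le_div_iff₀ hN0, hS] at h2
          exact h2)
      refine h1.trans_eq ?_
      rw [hr]; ring)
  -- The loss `(p - 4)/800` in the fourth moment was chosen to be exactly what the threshold `N ^
  -- (-1/800)`, raised to the power `p - 4`, gains.
  have h5 : ((N : ℝ) ^ (-(1 / 100) / 8 : ℝ)) ^ (p - 4) * (N : ℝ) ^ (-1 + (p - 4) / 800) =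
      1 / N := by
    rw [← Real.rpow_mul hN0.le, ← Real.rpow_add hN0, one_div (N : ℝ)]
    refine Eq.trans ?_ (Real.rpow_neg_one (N : ℝ))
    congr 1; ring
  rw [h5] at hmain
  have h6 : ∀ θ, ‖fourierTransform (a w δ b N) θ‖ ^ p = (N : ℝ) ^ p * f θ ^ p := by
    intro θ
    rw [hf, ← Real.mul_rpow hN0.le (by positivity)]
    congr 1; field_simp
  simp_rw [h6]
  rw [integral_const_mul]
  calc _ ≤ (N : ℝ) ^ p * (1 / N + p * (C / N * ((A + 1) / α₁) ^ r *
        ((A + 1) ^ (p - r) / (p - r)))) := by gcongr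
    _ = (1 + C') * ((N : ℝ) ^ p / N) := by rw [hC']; ring
    _ = _ := by rw [Real.rpow_sub_one hN0.ne']

/-- The trivial bound. -/
theorem norm_fourierTransform_a_le {w δ : ℝ} (hδ0 : 0 < δ) (hδ1 : δ < 1 / 8) {b N : ℕ} (hN : 1 ≤ N)
    (hbW : b ≤ modulus w) (hWN : (modulus w : ℝ) ≤ Real.log N) (θ : ℝ) :
    ‖fourierTransform (a w δ b N) θ‖ ≤ 4 * (N : ℝ) ^ 3 := by
  have hN' : (1 : ℝ) ≤ N := by exact_mod_cast hN
  have hlogN : Real.log N ≤ N := (Real.log_le_sub_one_of_pos (by linarith)).trans (by linarith)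
  have hl0 : 0 ≤ Real.log N := Real.log_natCast_nonneg N
  have hM2 := floor_sqrt_sq_le hbW hN
  rw [fourierTransform_a_eq_sum_squareRoots]
  set M := ⌊√((modulus w : ℝ) * N + b)⌋₊ with hM
  calc _ ≤ ∑ x ∈ squareRoots (modulus w) b M, 2 * Real.log N * (M : ℝ) := by
        refine norm_sum_le_of_le _ fun x hx => ?_
        rw [norm_mul, norm_e, mul_one, Complex.norm_real, Real.norm_of_nonneg (a_nonneg hδ1 hN _)]
        refine (a_le_weightFactor_mul hδ0 hN hx).1.trans ?_
        have hxM : (x : ℝ) ≤ M := by exact_mod_cast (mem_Icc.mp (mem_filter.mp hx).1).2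
        have := weightFactor_le (modulus_pos w) b N
        gcongr
    _ = #(squareRoots (modulus w) b M) * (2 * Real.log N * (M : ℝ)) := by simp
    _ ≤ M * (2 * Real.log N * (M : ℝ)) := by
        gcongr
        calc _ ≤ #(Icc 1 M) := card_le_card (filter_subset _ _)
          _ = M := by simp
    _ = 2 * Real.log N * (M : ℝ) ^ 2 := by ring
    _ ≤ 2 * N * (2 * N * N) := by
        gcongr
        refine hM2.trans ?_
        gcongr
        exact_mod_cast hWN.trans hlogN
    _ = _ := by ring

end WPrimeSquares

/-! ### Making the threshold independent of `p`. -/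

theorem mainTheorem5 :
    ∃ N₀ : ℝ → ℝ → ℕ, ∀ p : ℝ, 4 < p → ∃ C : ℝ,
      ∀ w δ : ℝ, 0 < δ → δ < 1 / 8 →
      ∀ b : ℕ, 1 ≤ b → b ≤ WPrimeSquares.modulus w → Nat.Coprime b (WPrimeSquares.modulus w) →
      ∀ N : ℕ, N₀ w δ ≤ N →
        ∫ θ in (0 : ℝ)..1,
            ‖WPrimeSquares.fourierTransform (WPrimeSquares.a w δ b N) θ‖ ^ p
          ≤ C * (N : ℝ) ^ (p - 1) := by
  -- This threshold means precisely `W ≤ log N`.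
  refine ⟨fun w _ => ⌈Real.exp (WPrimeSquares.modulus w)⌉₊, fun p hp => ?_⟩
  obtain ⟨C, hC0, hC⟩ := WPrimeSquares.exists_integral_fourierTransform_rpow_le hp
  obtain ⟨N₁, hN₁⟩ := Filter.eventually_atTop.mp hC
  -- For `N < N₁`, where `N₁` depends on `p` only, the trivial bound `4 N³` is absorbed by the
  -- second summand.
  refine ⟨C + (4 * (N₁ : ℝ) ^ 3) ^ p, fun w δ hδ0 hδ1 b hb1 hbW hbc N hN => ?_⟩
  have hexp : Real.exp (WPrimeSquares.modulus w) ≤ N := Nat.ceil_le.mp hN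
  have hN1 : (1 : ℝ) ≤ N := (Real.one_le_exp (Nat.cast_nonneg _)).trans hexp
  have hN1' : 1 ≤ N := by exact_mod_cast hN1
  have hWN : (WPrimeSquares.modulus w : ℝ) ≤ Real.log N :=
    (Real.le_log_iff_exp_le (by linarith)).mpr hexp
  have hone : 1 ≤ (N : ℝ) ^ (p - 1) := Real.one_le_rpow hN1 (by linarith)
  rw [intervalIntegral.integral_of_le zero_le_one, ← integral_Icc_eq_integral_Ioc]
  have hsmall0 : 0 ≤ (4 * (N₁ : ℝ) ^ 3) ^ p := by positivity
  rcases le_or_gt N₁ N with h | h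
  · refine (hN₁ N h w δ hδ0 hδ1 b hb1 hbW hbc hWN).trans ?_
    gcongr
    linarith
  · have hNN₁ : (N : ℝ) ≤ N₁ := by exact_mod_cast h.le
    calc _ ≤ ∫ _ in Set.Icc (0 : ℝ) 1, (4 * (N₁ : ℝ) ^ 3) ^ p := by
          refine setIntegral_mono_on ?_ (integrable_const _) measurableSet_Icc fun θ _ => ?_
          · exact ((WPrimeSquares.continuous_norm_fourierTransform_a w δ b N).rpow_const
              fun _ => Or.inr (by linarith)).continuousOn.integrableOn_Icc
          · have := WPrimeSquares.norm_fourierTransform_a_le hδ0 hδ1 hN1' hbW hWN θ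
            gcongr
            exact this.trans (by gcongr)
      _ = (4 * (N₁ : ℝ) ^ 3) ^ p := by simp
      _ ≤ (C + (4 * (N₁ : ℝ) ^ 3) ^ p) * 1 := by linarith
      _ ≤ _ := by gcongr
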